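/- For integers $1\le k\le n$ let $G(k,n)$ be the Grassmannian of $k$-dimensional linear subspaces of $\mathbb R^n$ with its usual topology. Represent a point of $G(k,n)$ as the row span of a real $k\times n$ matrix of rank $k$; its Plücker coordinates are the $k\times k$ minors of this matrix (defined up to a common nonzero factor). The refined open Bruhat cell $\mathcal X^0_{G(k,n)}\subset G(k,n)$ is the set of points at which, for every $i\in\{1,\dots,n\}$, the Plücker coordinate on the $k$ cyclically consecutive columns $i,i+1,\dots,i+k-1$ (taken modulo $n$) does not vanish; it carries the subspace topology. Then the number of connected components of $\mathcal X^0_{G(k,n)}$ equals $(n-1)\cdot 2^{n-2}$ for $k=2$ and every $n\ge 3$, and equals $3\cdot 2^{n-1}$ for $k=3$ and every $n\ge 7$. -/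

import Mathlib

/-- Ordered frames: `k × n` real matrices whose rows are linearly independent (rank `k`), with the
topology induced from the space of all `k × n` matrices. -/
abbrev Frame (k n : ℕ) : Type :=
  {A : Matrix (Fin k) (Fin n) ℝ // LinearIndependent ℝ (fun i => A i)}

/-- The real Grassmannian `G(k,n)`: the set of `k`-dimensional linear subspaces of `ℝⁿ`. -/
def RealGrassmannian (k n : ℕ) : Type :=
  {V : Submodule ℝ (Fin n → ℝ) // Module.finrank ℝ V = k}

/-- The row span of a frame, as a point of the Grassmannian. -/
def rowSpan {k n : ℕ} (A : Frame k n) : RealGrassmannian k n :=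
  ⟨Submodule.span ℝ (Set.range fun i => A.1 i), by
    simpa using finrank_span_eq_card A.2⟩

/-- The usual topology of `G(k,n)`: the quotient topology of the (surjective) row span map from
the space of frames. -/
instance RealGrassmannian.instTopologicalSpace (k n : ℕ) :
    TopologicalSpace (RealGrassmannian k n) :=
  TopologicalSpace.coinduced rowSpan inferInstance

/-- The columns `i, i + 1, …, i + k - 1`, taken cyclically modulo `n`. -/
def cyclicColumns (k : ℕ) {n : ℕ} (i : Fin n) (j : Fin k) : Fin n :=
  ⟨(i + j) % n, Nat.mod_lt _ i.pos⟩

/-- The minor of a `k × n` matrix on the columns `c 0, …, c (k - 1)`. On the frames of a fixed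
subspace, this is a Plücker coordinate of the subspace, well defined up to a common nonzero
factor. -/
def pluckerMinor {k n : ℕ} (c : Fin k → Fin n) (A : Frame k n) : ℝ :=
  (A.1.submatrix id c).det

/-- The open Bruhat cell of `G(k,n)` on which the Plücker coordinate of the columns `c` does not
vanish. -/
def openBruhatCell {k n : ℕ} (c : Fin k → Fin n) : Set (RealGrassmannian k n) :=
  {V | ∃ A : Frame k n, rowSpan A = V ∧ pluckerMinor c A ≠ 0}

/-- The refined open Bruhat cell of `G(k,n)`: the subspaces all of whose `n` Plücker coordinates
on `k` cyclically consecutive columns are nonzero. -/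
def refinedOpenBruhatCell (k n : ℕ) : Set (RealGrassmannian k n) :=
  ⋂ i : Fin n, openBruhatCell (cyclicColumns k i)

/-! Row reduction identifies the cell with the matrices in normal form, whose first `k` columns are
the identity. A unique choice of signs for the other `n - k` columns makes the `n - k` remaining
minors on windows that do not wrap around positive, so the cell is `2 ^ (n - k)` copies of the space
of positive frames (`normalFramesHomeomorph`). It remains to find `n - 1` components for `k = 2` and
`12` for `k = 3`.

For `k = 2` the columns start with `1, i` and turn left by an angle in `(0, π)` at each step. The
wrapping minor says that the total angle is not a multiple of `π`. The number of completed half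
turns is then an invariant with `n - 1` values, and each of its fibres is the image of a convex set
in polar coordinates.

For `k = 3` the columns after `e₁` form a chain `s₀ = e₂`, `s₁ = e₃`, …, `s_{m+1}` with `m = n - 3`
and positive consecutive volumes; the wrapping minors are its final area and final last coordinate.

Upper bound: interleave the areas `s_k ∧ s_{k+1}` and the last coordinates of `s_{k+1}`. If none of
these `2m + 2` numbers vanishes, they and the volumes are free parameters for the chain, so the
chains with a given sign pattern are connected (`coe_eq_of_hasSigns`). Patterns differing at one
interior place are joined through a wall if the product of the signs at distance one and two is
negative (`exists_wall`). In terms of bits this is a flipping game with at most four frozen patterns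
and eight other classes (`BitGame.exists_reps`), by a finite search and induction on the length.

Lower bound: four disjoint clopen parts consist of chains that are convex after a change of signs
(`isClopen_convexPart`). In general the flags of a chain lift continuously to the quaternions, and
the conditions at its end keep the last lift in one of eight sectors, one around each of `±1, ±i,
±j, ±k`. All `4 + 8` types occur (`exists_chainType_eq_inr` for the nonconvex ones). -/

/-! ### A flipping game on bit sequences -/

namespace BitGame

/-- Flip the `j`-th bit. -/
def flip (x : ℕ → Bool) (j : ℕ) : ℕ → Bool := fun i => xor (x i) (i == j)

/-- The parity of the four bits at distance one and two from `j`. -/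
def parity (x : ℕ → Bool) (j : ℕ) : Bool :=
  xor (xor (x (j - 2)) (x (j - 1))) (xor (x (j + 1)) (x (j + 2)))

/-- A move of the game on the first `M` bits: change bits beyond the first `M`, or flip an interior
bit whose four neighbours have odd sum. -/
def Move (M : ℕ) (x y : ℕ → Bool) : Prop :=
  (∀ i < M, x i = y i) ∨ ∃ j, 2 ≤ j ∧ j + 2 < M ∧ parity x j = true ∧ y = flip x j

/-- Equivalence of bit sequences under the moves of the game. -/
def Equiv (M : ℕ) : (ℕ → Bool) → (ℕ → Bool) → Prop := Relation.EqvGen (Move M)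

/-- Some flip is possible. -/
def Movable (M : ℕ) (x : ℕ → Bool) : Prop := ∃ j, 2 ≤ j ∧ j + 2 < M ∧ parity x j = true

theorem Equiv.of_move {M : ℕ} {x y : ℕ → Bool} (h : Move M x y) : Equiv M x y :=
  Relation.EqvGen.rel _ _ h

theorem Equiv.refl {M : ℕ} (x : ℕ → Bool) : Equiv M x x := Relation.EqvGen.refl _

theorem Equiv.symm {M : ℕ} {x y : ℕ → Bool} (h : Equiv M x y) : Equiv M y x :=
  Relation.EqvGen.symm _ _ h

theorem Equiv.trans {M : ℕ} {x y z : ℕ → Bool} (h : Equiv M x y) (h' : Equiv M y z) :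
    Equiv M x z :=
  Relation.EqvGen.trans _ _ _ h h'

theorem Equiv.of_eq {M : ℕ} {x y : ℕ → Bool} (h : ∀ i < M, x i = y i) : Equiv M x y :=
  .of_move (.inl h)

theorem Equiv.map {M N : ℕ} {φ : (ℕ → Bool) → ℕ → Bool}
    (hφ : ∀ x y, Move M x y → Equiv N (φ x) (φ y)) {x y : ℕ → Bool} (h : Equiv M x y) :
    Equiv N (φ x) (φ y) := by
  induction h with
  | rel x y h => exact hφ x y h
  | refl x => exact .refl _
  | symm x y _ ih => exact ih.symm
  | trans x y z _ _ ih ih' => exact ih.trans ih'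

theorem flip_ne {x : ℕ → Bool} {i j : ℕ} (h : i ≠ j) : flip x j i = x i := by
  simp [flip, beq_false_of_ne h]

theorem flip_self (x : ℕ → Bool) (j : ℕ) : flip x j j = !x j := by
  simp [flip]

theorem parity_congr {x y : ℕ → Bool} {j M : ℕ} (hj : j + 2 < M) (h : ∀ i < M, x i = y i) :
    parity x j = parity y j := by
  unfold parity
  rw [h _ (by omega), h _ (by omega), h _ (by omega), h _ (by omega)]

/-- Replace the first `W` bits of `x` by those of `y`. -/
def splice (W : ℕ) (x y : ℕ → Bool) : ℕ → Bool := fun i => if i < W then y i else x i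

/-- Moves on a prefix read and flip only bits of that prefix, so the result of a search in a short
window applies to longer words. -/
theorem Equiv.splice {W M : ℕ} (hWM : W ≤ M) (x : ℕ → Bool) {y z : ℕ → Bool}
    (h : Equiv W y z) : Equiv M (splice W x y) (splice W x z) := by
  refine h.map (φ := BitGame.splice W x) fun y z hyz => ?_
  rcases hyz with h | ⟨j, hj, hjW, hp, rfl⟩
  · refine .of_eq fun i _ => ?_
    unfold BitGame.splice
    split_ifs with hi
    · exact h i hi
    · rfl
  · refine .of_move (.inr ⟨j, hj, by omega, ?_, ?_⟩)
    · rw [← hp]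
      exact parity_congr (M := W) hjW fun i hi => by simp [BitGame.splice, hi]
    · funext i
      unfold BitGame.splice
      by_cases hi : i < W
      · simp [flip, hi]
      · have : i ≠ j := by omega
        simp [flip, hi, beq_false_of_ne this]

/-- Prepend a zero bit. -/
def cons (x : ℕ → Bool) : ℕ → Bool
  | 0 => false
  | i + 1 => x i

/-- The rule is invariant under shifts; this carries representatives from length `M` to `M + 1`. -/
theorem Equiv.cons {M : ℕ} {x y : ℕ → Bool} (h : Equiv M x y) :
    Equiv (M + 1) (cons x) (cons y) := by
  refine h.map (φ := BitGame.cons) fun x y hxy => ?_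
  rcases hxy with h | ⟨j, hj, hjM, hp, rfl⟩
  · refine .of_eq fun i hi => ?_
    cases i with
    | zero => rfl
    | succ i => exact h i (by omega)
  · refine .of_move (.inr ⟨j + 1, by omega, by omega, ?_, ?_⟩)
    · rw [← hp]
      obtain ⟨k, rfl⟩ := Nat.exists_eq_add_of_le' hj
      rfl
    · funext i
      cases i with
      | zero => simp [BitGame.cons, flip]
      | succ i => simp [BitGame.cons, flip]

/-- Bounded search for a position satisfying `goal`, flipping bits at positions from `js`. -/
def search (js : List ℕ) (goal : (ℕ → Bool) → Bool) : ℕ → (ℕ → Bool) → Bool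
  | 0, x => goal x
  | d + 1, x => goal x || js.any fun j => parity x j && search js goal d (flip x j)

theorem exists_of_search {M : ℕ} {js : List ℕ} {goal : (ℕ → Bool) → Bool}
    (hjs : ∀ j ∈ js, 2 ≤ j ∧ j + 2 < M) (d : ℕ) :
    ∀ x, search js goal d x = true → ∃ y, Equiv M x y ∧ goal y = true := by
  induction d with
  | zero => exact fun x hx => ⟨x, .refl x, hx⟩
  | succ d ih =>
    intro x hx
    simp only [search, Bool.or_eq_true, List.any_eq_true, Bool.and_eq_true] at hx
    rcases hx with hx | ⟨j, hj, hp, hx⟩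
    · exact ⟨x, .refl x, hx⟩
    · obtain ⟨y, hy, hg⟩ := ih _ hx
      exact ⟨y, (Equiv.of_move (.inr ⟨j, (hjs j hj).1, (hjs j hj).2, hp, rfl⟩)).trans hy, hg⟩

/-- Flips occur only at places `≥ 2`. The first two bits belong to the two coordinates of a chain
that always equal `1`. -/
theorem Equiv.zero_one {M : ℕ} (hM : 2 ≤ M) {x y : ℕ → Bool} (h : Equiv M x y) :
    x 0 = y 0 ∧ x 1 = y 1 := by
  induction h with
  | rel x y h =>
    rcases h with h | ⟨j, hj, hjM, hp, rfl⟩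
    · exact ⟨h 0 (by omega), h 1 (by omega)⟩
    · exact ⟨(flip_ne (by omega)).symm, (flip_ne (by omega)).symm⟩
  | refl x => exact ⟨rfl, rfl⟩
  | symm x y _ ih => exact ⟨ih.1.symm, ih.2.symm⟩
  | trans x y z _ _ ih ih' => exact ⟨ih.1.trans ih'.1, ih.2.trans ih'.2⟩

/-- The sequence with the given initial bits, followed by zeros. -/
def ofList (l : List Bool) : ℕ → Bool := fun i => l.getD i false

/-- The window contains a possible flip. -/
def movableIn (js : List ℕ) (x : ℕ → Bool) : Bool := js.any (parity x)

/-- Representatives of the movable classes on nine bits. -/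
def nineReps : List (List Bool) :=
  [[false, false, false, false, false, true, true, false, true],
   [false, false, false, false, true, true, false, true, false],
   [false, false, true, true, false, true, false, true, true],
   [false, false, false, false, false, true, false, false, false],
   [false, false, true, false, true, false, false, true, true],
   [false, false, true, false, false, false, false, false, true],
   [false, false, false, true, false, false, false, true, false],
   [false, false, true, false, false, false, true, false, false]]

/-- The first nine bits form one of the representatives. -/
def isNineRep (x : ℕ → Bool) : Bool := nineReps.contains ((List.range 9).map x)

/-- Base of the induction on the length, checked over all `2 ^ 7` words; depth four is enough. -/
theorem search_nine : ∀ a b c d e f g : Bool,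
    movableIn [2, 3, 4, 5, 6] (ofList [false, false, a, b, c, d, e, f, g]) = true →
      search [2, 3, 4, 5, 6] isNineRep 4 (ofList [false, false, a, b, c, d, e, f, g]) = true := by
  decide +kernel

/-- The third bit vanishes, and a flip is possible beyond it. -/
def isReduced (x : ℕ → Bool) : Bool := !x 2 && movableIn [3, 4, 5, 6, 7] x

/-- The check behind the induction step: once the third bit is cleared with a later flip still
available, the leading zero can be dropped without freezing the word. -/
theorem search_ten : ∀ a b c d e f g h : Bool,
    movableIn [2, 3, 4, 5, 6, 7] (ofList [false, false, a, b, c, d, e, f, g, h]) = true →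
      search [7, 6, 5, 4, 3, 2] isReduced 5 (ofList [false, false, a, b, c, d, e, f, g, h]) =
        true := by
  decide +kernel

theorem exists_parity_of_movableIn {js : List ℕ} {x : ℕ → Bool} (h : movableIn js x = true) :
    ∃ j ∈ js, parity x j = true := by
  simpa [movableIn] using h

/-- Bit `j` is one of the four neighbours of `j - 2`, so flipping it changes the parity there. -/
theorem parity_flip_sub_two {x : ℕ → Bool} {j : ℕ} (hj : 4 ≤ j) (h : parity x (j - 2) = false) :
    parity (flip x j) (j - 2) = true := by
  obtain ⟨k, rfl⟩ := Nat.exists_eq_add_of_le' hj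
  simp only [parity, show k + 4 - 2 = k + 2 by omega, Nat.add_sub_cancel] at h ⊢
  rw [show k + 2 + 2 = k + 4 by omega, flip_self, flip_ne (by omega), flip_ne (by omega),
    flip_ne (by omega)]
  revert h
  cases x k <;> cases x (k + 2 - 1) <;> cases x (k + 2 + 1) <;> cases x (k + 4) <;> simp

/-- A possible flip can be brought near the beginning. -/
theorem exists_equiv_parity_le_seven {M : ℕ} (j : ℕ) :
    ∀ x : ℕ → Bool, 2 ≤ j → j + 2 < M → parity x j = true →
      ∃ y, Equiv M x y ∧ ∃ i, 2 ≤ i ∧ i ≤ 7 ∧ parity y i = true := by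
  induction j using Nat.strong_induction_on with
  | _ j ih =>
    intro x hj hjM hp
    -- Places `2, …, 7` are those that can be flipped within a window of ten bits.
    by_cases hj7 : j ≤ 7
    · exact ⟨x, .refl x, j, hj, hj7, hp⟩
    · cases hq : parity x (j - 2) with
      | true => exact ih (j - 2) (by omega) x (by omega) (by omega) hq
      | false =>
        obtain ⟨y, hy, hi⟩ := ih (j - 2) (by omega) (flip x j) (by omega) (by omega)
          (parity_flip_sub_two (by omega) hq)
        exact ⟨y, (Equiv.of_move (.inr ⟨j, hj, hjM, hp, rfl⟩)).trans hy, hi⟩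

theorem ofList_ten {x : ℕ → Bool} (h0 : x 0 = false) (h1 : x 1 = false) :
    ∀ i < 10, ofList [false, false, x 2, x 3, x 4, x 5, x 6, x 7, x 8, x 9] i = x i := by
  intro i hi
  interval_cases i <;> simp [ofList, h0, h1]

theorem ofList_nine {x : ℕ → Bool} (h0 : x 0 = false) (h1 : x 1 = false) :
    ∀ i < 9, ofList [false, false, x 2, x 3, x 4, x 5, x 6, x 7, x 8] i = x i := by
  intro i hi
  interval_cases i <;> simp [ofList, h0, h1]

/-- A possible flip is brought into the first ten bits, where the third bit can be cleared. Of the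
three leading zeros, one is removed and two remain for the shorter word. -/
theorem exists_reduced {M : ℕ} (hM : 10 ≤ M) {x : ℕ → Bool} (h0 : x 0 = false)
    (h1 : x 1 = false) (hx : Movable M x) :
    ∃ y, Equiv M x (cons y) ∧ y 0 = false ∧ y 1 = false ∧ Movable (M - 1) y := by
  obtain ⟨j, hj, hjM, hp⟩ := hx
  obtain ⟨x', hxx', i, hi, hi7, hpi⟩ := exists_equiv_parity_le_seven j x hj hjM hp
  obtain ⟨h0', h1'⟩ := hxx'.zero_one (by omega)
  rw [h0] at h0'
  rw [h1] at h1'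
  set w := ofList [false, false, x' 2, x' 3, x' 4, x' 5, x' 6, x' 7, x' 8, x' 9] with hw
  have hwx : ∀ i < 10, w i = x' i := ofList_ten h0'.symm h1'.symm
  have hmov : movableIn [2, 3, 4, 5, 6, 7] w = true := by
    refine List.any_eq_true.mpr ⟨i, ?_, ?_⟩
    · simp only [List.mem_cons, List.not_mem_nil, or_false]
      omega
    · rw [parity_congr (M := 10) (by omega) hwx, hpi]
  obtain ⟨y, hy, hg⟩ := exists_of_search (M := 10) (js := [7, 6, 5, 4, 3, 2])
    (by simp) 5 w (search_ten _ _ _ _ _ _ _ _ hmov)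
  simp only [isReduced, Bool.and_eq_true, Bool.not_eq_true'] at hg
  obtain ⟨k, hk, hpk⟩ := exists_parity_of_movableIn hg.2
  simp only [List.mem_cons, List.not_mem_nil, or_false] at hk
  obtain ⟨hy0, hy1⟩ := hy.zero_one (by omega)
  have hz : ∀ i < 10, splice 10 x' y i = y i := fun i hi => by simp [splice, hi]
  have hsplice : cons (fun i => splice 10 x' y (i + 1)) = splice 10 x' y := by
    funext i
    cases i with
    | zero => rw [hz 0 (by omega), ← hy0, hwx 0 (by omega), ← h0']; rfl
    | succ i => rfl
  -- A flip at `k ≥ 3` in the long word is a flip at `k - 1 ≥ 2` in the short one.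
  refine ⟨fun i => splice 10 x' y (i + 1), ?_, ?_, ?_, k - 1, by omega, by omega, ?_⟩
  · rw [hsplice]
    refine (hxx'.trans ?_).trans (hy.splice hM x')
    refine .of_eq fun i _ => ?_
    unfold splice
    split_ifs with hi
    · exact (hwx i hi).symm
    · rfl
  · exact (hz 1 (by omega)).trans (hy1.symm.trans ((hwx 1 (by omega)).trans h1'.symm))
  · exact (hz 2 (by omega)).trans hg.1
  · rw [← hpk, ← parity_congr (M := 10) (j := k) (by omega) hz]
    have : 3 ≤ k := by omega
    obtain ⟨l, rfl⟩ := Nat.exists_eq_add_of_le' this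
    rfl

/-- On at least nine bits, there are at most eight movable classes. -/
theorem exists_movable_reps {M : ℕ} (hM : 9 ≤ M) :
    ∃ rep : Fin 8 → ℕ → Bool, (∀ i, rep i 0 = false ∧ rep i 1 = false) ∧
      ∀ x : ℕ → Bool, x 0 = false → x 1 = false → Movable M x → ∃ i, Equiv M x (rep i) := by
  induction M, hM using Nat.le_induction with
  | base =>
    refine ⟨fun i => ofList (nineReps.get i), by decide, fun x h0 h1 hx => ?_⟩
    set w := ofList [false, false, x 2, x 3, x 4, x 5, x 6, x 7, x 8] with hw
    have hwx : ∀ i < 9, w i = x i := ofList_nine h0 h1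
    obtain ⟨j, hj, hjM, hp⟩ := hx
    have hmov : movableIn [2, 3, 4, 5, 6] w = true := by
      refine List.any_eq_true.mpr ⟨j, ?_, ?_⟩
      · simp only [List.mem_cons, List.not_mem_nil, or_false]
        omega
      · rw [parity_congr hjM hwx, hp]
    obtain ⟨y, hy, hg⟩ := exists_of_search (M := 9) (js := [2, 3, 4, 5, 6])
      (by simp) 4 w (search_nine _ _ _ _ _ _ _ hmov)
    have hmem : (List.range 9).map y ∈ nineReps := by
      simpa [isNineRep] using hg
    obtain ⟨i, hi⟩ := List.get_of_mem hmem
    refine ⟨i, ((Equiv.of_eq fun i hi => (hwx i hi).symm).trans hy).trans (.of_eq fun k hk => ?_)⟩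
    simp only [ofList, hi]
    rw [List.getD_eq_getElem _ _ (by simpa using hk)]
    simp
  | succ M hM ih =>
    obtain ⟨rep, hrep, h⟩ := ih
    refine ⟨fun i => cons (rep i), fun i => ⟨rfl, (hrep i).1⟩, fun x h0 h1 hx => ?_⟩
    obtain ⟨y, hy, hy0, hy1, hmov⟩ := exists_reduced (by omega) h0 h1 hx
    obtain ⟨i, hi⟩ := h y hy0 hy1 hmov
    exact ⟨i, hy.trans hi.cons⟩

/-- Even parity at `i - 2` expresses bit `i` through earlier bits, so frozen words obey a linear
recurrence of order four. -/
theorem eq_of_not_movable {M : ℕ} {x y : ℕ → Bool} (hx : ¬Movable M x) (hy : ¬Movable M y)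
    (h : ∀ i < 4, x i = y i) : ∀ i < M, x i = y i := by
  intro i
  induction i using Nat.strong_induction_on with
  | _ i ih =>
    intro hi
    by_cases hi4 : i < 4
    · exact h i hi4
    · have key : ∀ z : ℕ → Bool, ¬Movable M z → parity z (i - 2) = false := fun z hz => by
        by_contra hc
        exact hz ⟨i - 2, by omega, by omega, by simpa using hc⟩
      have hx' := key x hx
      have hy' := key y hy
      unfold parity at hx' hy'
      rw [ih _ (by omega) (by omega), ih (i - 2 - 1) (by omega) (by omega),
        ih (i - 2 + 1) (by omega) (by omega)] at hx'
      rw [show i - 2 + 2 = i by omega] at hx' hy'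
      revert hx' hy'
      cases y (i - 2 - 2) <;> cases y (i - 2 - 1) <;> cases y (i - 2 + 1) <;> cases x i <;>
        cases y i <;> simp

/-- On at least nine bits, there are at most twelve classes. -/
theorem exists_reps {M : ℕ} (hM : 9 ≤ M) :
    ∃ rep : (Bool × Bool) ⊕ Fin 8 → ℕ → Bool, (∀ i, rep i 0 = false ∧ rep i 1 = false) ∧
      ∀ x : ℕ → Bool, x 0 = false → x 1 = false → ∃ i, Equiv M x (rep i) := by
  obtain ⟨rep, hrep, h⟩ := exists_movable_reps hM
  have key : ∀ b : Bool × Bool, ∃ y : ℕ → Bool, (y 0 = false ∧ y 1 = false) ∧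
      ∀ x : ℕ → Bool, x 0 = false → x 1 = false → x 2 = b.1 → x 3 = b.2 → ¬Movable M x →
        Equiv M x y := by
    intro b
    -- Given the two leading zeros, bits `2` and `3` determine a frozen word. If no frozen word has
    -- these bits, the claim is vacuous and any representative serves.
    by_cases hb : ∃ y : ℕ → Bool, y 0 = false ∧ y 1 = false ∧ y 2 = b.1 ∧ y 3 = b.2 ∧ ¬Movable M y
    · obtain ⟨y, h0, h1, h2, h3, hy⟩ := hb
      refine ⟨y, ⟨h0, h1⟩, fun x h0' h1' h2' h3' hx => .of_eq (eq_of_not_movable hx hy ?_)⟩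
      intro i hi
      interval_cases i
      · rw [h0, h0']
      · rw [h1, h1']
      · rw [h2, h2']
      · rw [h3, h3']
    · exact ⟨fun _ => false, ⟨rfl, rfl⟩, fun x h0 h1 h2 h3 hx =>
        (hb ⟨x, h0, h1, h2, h3, hx⟩).elim⟩
  choose fix hfix hfix' using key
  refine ⟨Sum.elim fix rep, ?_, fun x h0 h1 => ?_⟩
  · rintro (b | i)
    · exact hfix b
    · exact hrep i
  · by_cases hx : Movable M x
    · obtain ⟨i, hi⟩ := h x h0 h1 hx
      exact ⟨.inr i, hi⟩
    · exact ⟨.inl (x 2, x 3), hfix' (x 2, x 3) x h0 h1 rfl rfl hx⟩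

end BitGame

/-! ### Normal forms of frames -/

section NormalForm

open Matrix Topology

variable {k n : ℕ}

theorem span_rows_le {A B : Matrix (Fin k) (Fin n) ℝ} {g : Matrix (Fin k) (Fin k) ℝ}
    (h : B = g * A) :
    Submodule.span ℝ (Set.range fun i => B i) ≤ Submodule.span ℝ (Set.range fun i => A i) := by
  rw [Submodule.span_le]
  rintro _ ⟨i, rfl⟩
  refine (Submodule.mem_span_range_iff_exists_fun ℝ).mpr ⟨g i, ?_⟩
  funext j
  simp [h, Matrix.mul_apply]

theorem exists_mul_of_rowSpan_eq {A B : Frame k n} (h : rowSpan A = rowSpan B) :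
    ∃ g : Matrix (Fin k) (Fin k) ℝ, B.1 = g * A.1 := by
  have hmem : ∀ i, ∃ c : Fin k → ℝ, ∑ j, c j • A.1 j = B.1 i := fun i => by
    refine (Submodule.mem_span_range_iff_exists_fun ℝ).mp ?_
    have : Submodule.span ℝ (Set.range fun i => A.1 i) =
        Submodule.span ℝ (Set.range fun i => B.1 i) := congrArg Subtype.val h
    change B.1 i ∈ Submodule.span ℝ (Set.range fun i => A.1 i)
    rw [this]
    exact Submodule.subset_span ⟨i, rfl⟩
  choose c hc using hmem
  refine ⟨Matrix.of c, ?_⟩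
  ext i j
  rw [← hc i]
  simp [Matrix.mul_apply]

theorem submatrix_columns_mul (g : Matrix (Fin k) (Fin k) ℝ) (A : Matrix (Fin k) (Fin n) ℝ)
    {l : ℕ} (c : Fin l → Fin n) : (g * A).submatrix id c = g * A.submatrix id c := by
  ext i j
  simp [Matrix.mul_apply]

theorem pluckerMinor_ne_zero_of_rowSpan_eq {A B : Frame k n} (h : rowSpan A = rowSpan B)
    {c : Fin k → Fin n} (hB : pluckerMinor c B ≠ 0) : pluckerMinor c A ≠ 0 := by
  obtain ⟨g, hg⟩ := exists_mul_of_rowSpan_eq h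
  unfold pluckerMinor at hB ⊢
  rw [hg, submatrix_columns_mul, det_mul] at hB
  exact right_ne_zero_of_mul hB

theorem rowSpan_mem_openBruhatCell {A : Frame k n} {c : Fin k → Fin n} :
    rowSpan A ∈ openBruhatCell c ↔ pluckerMinor c A ≠ 0 :=
  ⟨fun ⟨_, hB, hBc⟩ => pluckerMinor_ne_zero_of_rowSpan_eq hB.symm hBc, fun h => ⟨A, rfl, h⟩⟩

theorem rowSpan_mem_refinedOpenBruhatCell {A : Frame k n} :
    rowSpan A ∈ refinedOpenBruhatCell k n ↔ ∀ i, pluckerMinor (cyclicColumns k i) A ≠ 0 := by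
  simp only [refinedOpenBruhatCell, Set.mem_iInter, rowSpan_mem_openBruhatCell]

theorem rowSpan_surjective : Function.Surjective (rowSpan (k := k) (n := n)) := by
  rintro ⟨V, hV⟩
  let b := Module.finBasisOfFinrankEq ℝ V hV
  have hb : LinearIndependent ℝ fun i => (b i : Fin n → ℝ) :=
    b.linearIndependent.map' V.subtype V.ker_subtype
  refine ⟨⟨fun i => b i, hb⟩, Subtype.ext ?_⟩
  change Submodule.span ℝ (Set.range (V.subtype ∘ b)) = V
  rw [Set.range_comp, Submodule.span_image, b.span_eq, Submodule.map_top, Submodule.range_subtype]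

theorem isQuotientMap_rowSpan : IsQuotientMap (rowSpan (k := k) (n := n)) :=
  ⟨⟨rfl⟩, rowSpan_surjective⟩

theorem continuous_pluckerMinor (c : Fin k → Fin n) : Continuous (pluckerMinor c) :=
  (continuous_subtype_val.matrix_submatrix id c).matrix_det

theorem isOpen_refinedOpenBruhatCell : IsOpen (refinedOpenBruhatCell k n) := by
  rw [← isQuotientMap_rowSpan.isOpen_preimage]
  have : rowSpan ⁻¹' refinedOpenBruhatCell k n =
      ⋂ i, {A : Frame k n | pluckerMinor (cyclicColumns k i) A ≠ 0} := by
    ext A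
    simp [rowSpan_mem_refinedOpenBruhatCell]
  rw [this]
  exact isOpen_iInter_of_finite fun i =>
    isOpen_ne_fun (continuous_pluckerMinor _) continuous_const

/-- Matrices whose first `k` columns form the identity matrix, with nonzero minors on cyclically
consecutive columns. -/
def normalFrames (h : k ≤ n) : Set (Matrix (Fin k) (Fin n) ℝ) :=
  {M | M.submatrix id (Fin.castLE h) = 1 ∧
    ∀ i, (M.submatrix id (cyclicColumns k i)).det ≠ 0}

theorem cyclicColumns_of_le {i : Fin n} {j : Fin k} (h : (i : ℕ) + k ≤ n) :
    cyclicColumns k i j = ⟨i + j, by omega⟩ := by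
  ext
  exact Nat.mod_eq_of_lt (by have := j.2; omega)

theorem cyclicColumns_zero (h : k ≤ n) (hn : 0 < n) :
    cyclicColumns k (⟨0, hn⟩ : Fin n) = Fin.castLE h := by
  funext j
  rw [cyclicColumns_of_le (by simpa using h)]
  ext
  simp

theorem linearIndependent_of_submatrix_eq_one {h : k ≤ n} {M : Matrix (Fin k) (Fin n) ℝ}
    (hM : M.submatrix id (Fin.castLE h) = 1) : LinearIndependent ℝ fun i => M i := by
  refine LinearIndependent.of_comp (LinearMap.funLeft ℝ ℝ (Fin.castLE h)) ?_
  have : (⇑(LinearMap.funLeft ℝ ℝ (Fin.castLE h)) ∘ fun i => M i) =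
      (1 : Matrix (Fin k) (Fin k) ℝ).row := by
    rw [← hM]
    rfl
  rw [this]
  exact linearIndependent_rows_of_isUnit isUnit_one

/-- The normal form of a frame. -/
noncomputable def normalForm (h : k ≤ n) (A : Matrix (Fin k) (Fin n) ℝ) :
    Matrix (Fin k) (Fin n) ℝ :=
  (A.submatrix id (Fin.castLE h))⁻¹ * A

/-- A change of basis of the row space cancels, so the normal form depends on the row span alone. -/
theorem normalForm_mul_left (h : k ≤ n) {A : Matrix (Fin k) (Fin n) ℝ} {g : Matrix (Fin k) (Fin k) ℝ}
    (hg : IsUnit g.det) : normalForm h (g * A) = normalForm h A := by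
  unfold normalForm
  rw [submatrix_columns_mul, Matrix.mul_inv_rev, Matrix.mul_assoc, ← Matrix.mul_assoc g⁻¹,
    Matrix.nonsing_inv_mul _ hg, Matrix.one_mul]

theorem normalForm_mem (h : k ≤ n) (hn : 0 < n) {A : Frame k n}
    (hA : rowSpan A ∈ refinedOpenBruhatCell k n) : normalForm h A.1 ∈ normalFrames h := by
  rw [rowSpan_mem_refinedOpenBruhatCell] at hA
  have h0 := hA ⟨0, hn⟩
  rw [cyclicColumns_zero h hn] at h0
  have h0 : IsUnit (A.1.submatrix id (Fin.castLE h)).det := isUnit_iff_ne_zero.mpr h0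
  refine ⟨?_, fun i => ?_⟩
  · rw [normalForm, submatrix_columns_mul, Matrix.nonsing_inv_mul _ h0]
  · rw [normalForm, submatrix_columns_mul, det_mul]
    refine mul_ne_zero ?_ (hA i)
    exact (Matrix.isUnit_nonsing_inv_det _ h0).ne_zero

theorem rowSpan_normalForm (h : k ≤ n) (hn : 0 < n) {A : Frame k n}
    (hA : rowSpan A ∈ refinedOpenBruhatCell k n)
    (hN : LinearIndependent ℝ fun i => normalForm h A.1 i) :
    rowSpan ⟨normalForm h A.1, hN⟩ = rowSpan A := by
  have h0 := rowSpan_mem_refinedOpenBruhatCell.mp hA ⟨0, hn⟩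
  rw [cyclicColumns_zero h hn] at h0
  have h0 : IsUnit (A.1.submatrix id (Fin.castLE h)).det := isUnit_iff_ne_zero.mpr h0
  refine Subtype.ext (le_antisymm (span_rows_le rfl)
    (span_rows_le (g := A.1.submatrix id (Fin.castLE h)) ?_))
  change A.1 = _ * ((A.1.submatrix id (Fin.castLE h))⁻¹ * A.1)
  rw [← Matrix.mul_assoc, Matrix.mul_nonsing_inv _ h0, Matrix.one_mul]

theorem normalForm_eq_of_rowSpan_eq (h : k ≤ n) (hn : 0 < n) {A B : Frame k n}
    (hB : rowSpan B ∈ refinedOpenBruhatCell k n) (hAB : rowSpan A = rowSpan B) :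
    normalForm h B.1 = normalForm h A.1 := by
  obtain ⟨g, hg⟩ := exists_mul_of_rowSpan_eq hAB
  have h0 := rowSpan_mem_refinedOpenBruhatCell.mp hB ⟨0, hn⟩
  unfold pluckerMinor at h0
  rw [hg, submatrix_columns_mul, det_mul] at h0
  rw [hg, normalForm_mul_left h (isUnit_iff_ne_zero.mpr (left_ne_zero_of_mul h0))]

theorem normalForm_of_mem (h : k ≤ n) {M : Matrix (Fin k) (Fin n) ℝ} (hM : M ∈ normalFrames h) :
    normalForm h M = M := by
  rw [normalForm, hM.1, inv_one, Matrix.one_mul]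

/-- The frame of a matrix in normal form. -/
def normalFrameToFrame {h : k ≤ n} (M : normalFrames h) : Frame k n :=
  ⟨M.1, linearIndependent_of_submatrix_eq_one M.2.1⟩

theorem rowSpan_normalFrameToFrame_mem {h : k ≤ n} (M : normalFrames h) :
    rowSpan (normalFrameToFrame M) ∈ refinedOpenBruhatCell k n :=
  rowSpan_mem_refinedOpenBruhatCell.mpr M.2.2

/-- The refined open Bruhat cell is homeomorphic to the space of normal forms. -/
noncomputable def refinedOpenBruhatCellHomeomorph (h : k ≤ n) (hn : 0 < n) :
    refinedOpenBruhatCell k n ≃ₜ normalFrames h where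
  -- The chosen frame is arbitrary; `normalForm_eq_of_rowSpan_eq` shows that the choice does not
  -- matter.
  toFun V := ⟨normalForm h (Function.surjInv rowSpan_surjective V.1).1,
    normalForm_mem h hn (by rw [Function.surjInv_eq rowSpan_surjective]; exact V.2)⟩
  invFun M := ⟨rowSpan (normalFrameToFrame M), (rowSpan_normalFrameToFrame_mem M)⟩
  left_inv V := by
    refine Subtype.ext ((rowSpan_normalForm h hn ?_ _).trans ?_)
    · rw [Function.surjInv_eq rowSpan_surjective]; exact V.2
    · rw [Function.surjInv_eq rowSpan_surjective]
  right_inv M := by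
    refine Subtype.ext ?_
    simp only
    rw [← normalForm_eq_of_rowSpan_eq h hn (rowSpan_normalFrameToFrame_mem M)]
    · exact normalForm_of_mem h M.2
    · rw [Function.surjInv_eq rowSpan_surjective]
  continuous_toFun := by
    -- Over an open set the row span map stays a quotient map, so continuity may be tested on
    -- frames, where the arbitrary frame can be replaced by the given one.
    have hq := isQuotientMap_rowSpan.restrictPreimage_isOpen
      (isOpen_refinedOpenBruhatCell (k := k) (n := n))
    rw [hq.continuous_iff]
    refine Continuous.subtype_mk ?_ _
    have heq : ∀ A : rowSpan ⁻¹' refinedOpenBruhatCell k n,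
        normalForm h (Function.surjInv rowSpan_surjective (rowSpan A.1)).1 =
          normalForm h A.1.1 := fun A =>
      (normalForm_eq_of_rowSpan_eq h hn A.2 (Function.surjInv_eq _ _)).symm
    change Continuous fun A : rowSpan ⁻¹' refinedOpenBruhatCell k n =>
      normalForm h (Function.surjInv rowSpan_surjective (rowSpan A.1)).1
    simp only [heq]
    have hval : Continuous fun A : rowSpan ⁻¹' refinedOpenBruhatCell k n => A.1.1 :=
      continuous_subtype_val.comp continuous_subtype_val
    have hsub := hval.matrix_submatrix id (Fin.castLE h)
    have hinv : Continuous fun A : rowSpan ⁻¹' refinedOpenBruhatCell k n =>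
        (A.1.1.submatrix id (Fin.castLE h))⁻¹ := by
      simp only [Matrix.inv_def, Ring.inverse_eq_inv']
      refine Continuous.smul (hsub.matrix_det.inv₀ fun A => ?_) hsub.matrix_adjugate
      have := rowSpan_mem_refinedOpenBruhatCell.mp A.2 ⟨0, hn⟩
      rwa [cyclicColumns_zero h hn] at this
    exact hinv.matrix_mul hval
  continuous_invFun :=
    (isQuotientMap_rowSpan.continuous.comp (continuous_subtype_val.subtype_mk _)).subtype_mk _

end NormalForm

/-! ### Counting connected components -/

section Counting

open Topology

theorem Homeomorph.card_connectedComponents {X Y : Type*} [TopologicalSpace X]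
    [TopologicalSpace Y] (e : X ≃ₜ Y) :
    Nat.card (ConnectedComponents X) = Nat.card (ConnectedComponents Y) := by
  refine Nat.card_congr ⟨e.continuous.connectedComponentsMap,
    e.symm.continuous.connectedComponentsMap, fun c => ?_, fun c => ?_⟩
  · obtain ⟨x, rfl⟩ := ConnectedComponents.surjective_coe c
    exact congrArg ConnectedComponents.mk (e.symm_apply_apply x)
  · obtain ⟨x, rfl⟩ := ConnectedComponents.surjective_coe c
    exact congrArg ConnectedComponents.mk (e.apply_symm_apply x)

theorem card_connectedComponents_prod (T X : Type*) [TopologicalSpace T] [DiscreteTopology T]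
    [TopologicalSpace X] :
    Nat.card (ConnectedComponents (T × X)) = Nat.card T * Nat.card (ConnectedComponents X) := by
  rw [← Nat.card_prod]
  have hf : Continuous fun p : T × X => (p.1, (p.2 : ConnectedComponents X)) :=
    continuous_fst.prodMk (ConnectedComponents.continuous_coe.comp continuous_snd)
  refine Nat.card_congr ⟨hf.connectedComponentsLift, fun p =>
    (Continuous.prodMk_right p.1).connectedComponentsMap p.2, fun c => ?_, fun p => ?_⟩
  · obtain ⟨x, rfl⟩ := ConnectedComponents.surjective_coe c
    rfl
  · obtain ⟨t, c⟩ := p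
    obtain ⟨x, rfl⟩ := ConnectedComponents.surjective_coe c
    rfl

/-- If finitely many points meet every component and as many values of a continuous function with
discrete codomain are attained, then both numbers are the number of components. -/
theorem card_connectedComponents_eq {X D R : Type*} [TopologicalSpace X] [TopologicalSpace D]
    [DiscreteTopology D] [Finite R] {f : X → D} (hf : Continuous f) (hs : Function.Surjective f)
    (r : R → X) (hr : ∀ x : X, ∃ i, (x : ConnectedComponents X) = r i)
    (hcard : Nat.card R = Nat.card D) : Nat.card (ConnectedComponents X) = Nat.card D := by
  have hr' : Function.Surjective fun i => (r i : ConnectedComponents X) := fun c => by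
    obtain ⟨x, rfl⟩ := ConnectedComponents.surjective_coe c
    obtain ⟨i, hi⟩ := hr x
    exact ⟨i, hi.symm⟩
  have hs' : Function.Surjective hf.connectedComponentsLift := fun d => by
    obtain ⟨x, hx⟩ := hs d
    exact ⟨x, hx⟩
  have := Finite.of_surjective _ hr'
  have h1 := Nat.card_le_card_of_surjective _ hr'
  have h2 := Nat.card_le_card_of_surjective _ hs'
  omega

theorem IsPreconnected.coe_eq_coe {X : Type*} [TopologicalSpace X] {s : Set X}
    (hs : IsPreconnected s) {x y : X} (hx : x ∈ s) (hy : y ∈ s) :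
    (x : ConnectedComponents X) = y :=
  ConnectedComponents.coe_eq_coe'.mpr (hs.subset_connectedComponent hy hx)

end Counting

/-! ### Normalizing the signs of the columns -/

section Signs

open Topology Matrix

/-- The sign of a nonzero real number. -/
noncomputable def signUnit (x : ℝ) : ℤˣ := if 0 < x then 1 else -1

theorem signUnit_mul_self_pos {x : ℝ} (hx : x ≠ 0) : 0 < ((signUnit x : ℤ) : ℝ) * x := by
  unfold signUnit
  split_ifs with h
  · simpa using h
  · simpa using lt_of_le_of_ne (not_lt.mp h) hx

theorem signUnit_mul {x : ℝ} (u : ℤˣ) (hx : 0 < x) : signUnit (((u : ℤ) : ℝ) * x) = u := by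
  rcases Int.units_eq_one_or u with rfl | rfl
  · simp [signUnit, hx]
  · simp [signUnit, hx.le]

theorem continuous_signUnit {X : Type*} [TopologicalSpace X] {f : X → ℝ} (hf : Continuous f)
    (h0 : ∀ x, f x ≠ 0) : Continuous fun x => signUnit (f x) := by
  refine continuous_iff_continuousAt.mpr fun x => ?_
  refine (continuousAt_const (y := signUnit (f x))).congr ?_
  rcases lt_or_gt_of_ne (h0 x) with h | h
  · filter_upwards [hf.continuousAt.eventually (gt_mem_nhds h)] with y hy
    simp [signUnit, h.not_gt, hy.not_gt]
  · filter_upwards [hf.continuousAt.eventually (lt_mem_nhds h)] with y hy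
    simp [signUnit, h, hy]

/-- The signs, starting with `k` ones, whose products over `k` consecutive places are
prescribed. -/
def signRec (k : ℕ) (s : ℕ → ℤˣ) (j : ℕ) : ℤˣ :=
  if _h : j < k then 1
  else s (j + 1 - k) * ∏ l : Fin (k - 1), signRec k s (j - 1 - l)
termination_by j
decreasing_by have := l.2; omega

theorem signRec_of_lt {k j : ℕ} (s : ℕ → ℤˣ) (h : j < k) : signRec k s j = 1 := by
  rw [signRec, dif_pos h]

theorem continuous_signRec (k j : ℕ) : Continuous fun s => signRec k s j := by
  induction j using Nat.strong_induction_on with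
  | _ j ih =>
    by_cases h : j < k
    · simpa only [signRec_of_lt _ h] using continuous_const
    · have heq : (fun s => signRec k s j) =
          fun s => s (j + 1 - k) * ∏ l : Fin (k - 1), signRec k s (j - 1 - l) := by
        funext s
        rw [signRec, dif_neg h]
      rw [heq]
      refine (continuous_apply _).mul (continuous_finsetProd _ fun l _ => ih _ ?_)
      have := l.2
      omega

theorem prod_range_eq_mul_prod {k : ℕ} (hk : 0 < k) (e : ℕ → ℤˣ) (i : ℕ) :
    ∏ l : Fin k, e (i + l) = e (i + k - 1) * ∏ l : Fin (k - 1), e (i + k - 1 - 1 - l) := by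
  obtain ⟨k, rfl⟩ := Nat.exists_eq_succ_of_ne_zero hk.ne'
  rw [Nat.succ_eq_add_one, Fin.prod_univ_castSucc, mul_comm]
  refine congrArg₂ _ rfl ?_
  change ∏ l : Fin k, e (i + (Fin.castSucc l : Fin (k + 1))) =
    ∏ l : Fin k, e (i + (k + 1) - 1 - 1 - l)
  rw [← Equiv.prod_comp Fin.revPerm]
  refine Finset.prod_congr rfl fun l _ => ?_
  have := l.2
  congr 1
  simp only [Fin.revPerm_apply, Fin.val_castSucc, Fin.val_rev]
  omega

/-- The recursion solves the condition of each window for its last sign, signs being their own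
inverses. Window `0` is excluded because its signs are fixed to be `1`. -/
theorem prod_signRec {k : ℕ} (hk : 0 < k) (s : ℕ → ℤˣ) {i : ℕ} (hi : 0 < i) :
    ∏ l : Fin k, signRec k s (i + l) = s i := by
  rw [prod_range_eq_mul_prod hk, signRec, dif_neg (by omega),
    show i + k - 1 + 1 - k = i by omega, mul_assoc, Int.units_mul_self, mul_one]

/-- The last sign of a window is forced by the earlier ones. Only windows within the first `n`
places are prescribed, hence the restriction to `j < n`. -/
theorem signRec_unique {k n : ℕ} (hk : 0 < k) (s e : ℕ → ℤˣ) (h1 : ∀ j < k, e j = 1)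
    (hs : ∀ i, 0 < i → i + k ≤ n → ∏ l : Fin k, e (i + l) = s i) :
    ∀ j < n, e j = signRec k s j := by
  intro j
  induction j using Nat.strong_induction_on with
  | _ j ih =>
    intro hj
    by_cases h : j < k
    · rw [h1 j h, signRec_of_lt _ h]
    · have h2 := hs (j + 1 - k) (by omega) (by omega)
      rw [← prod_signRec hk s (by omega), prod_range_eq_mul_prod hk,
        prod_range_eq_mul_prod hk] at h2
      rw [show j + 1 - k + k - 1 = j by omega] at h2
      have hp : ∏ l : Fin (k - 1), e (j - 1 - l) = ∏ l : Fin (k - 1), signRec k s (j - 1 - l) :=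
        Finset.prod_congr rfl fun l _ => ih _ (by have := l.2; omega) (by omega)
      rw [hp] at h2
      exact mul_right_cancel h2

variable {k n : ℕ}

/-- Change the signs of the columns of a matrix. -/
noncomputable def signColumns (e : ℕ → ℤˣ) (M : Matrix (Fin k) (Fin n) ℝ) :
    Matrix (Fin k) (Fin n) ℝ :=
  fun a j => ((e j : ℤ) : ℝ) * M a j

theorem signColumns_signColumns {e e' : ℕ → ℤˣ} (h : ∀ j < n, e j = e' j)
    (M : Matrix (Fin k) (Fin n) ℝ) : signColumns e (signColumns e' M) = M := by
  ext a j
  simp only [signColumns, h j j.2, ← mul_assoc]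
  have : ((e' j : ℤ) : ℝ) * ((e' j : ℤ) : ℝ) = 1 := by
    rw [← Int.cast_mul, ← Units.val_mul, Int.units_mul_self, Units.val_one, Int.cast_one]
  rw [this, one_mul]

theorem det_submatrix_signColumns (e : ℕ → ℤˣ) (M : Matrix (Fin k) (Fin n) ℝ)
    (c : Fin k → Fin n) :
    ((signColumns e M).submatrix id c).det =
      (((∏ l, e (c l) : ℤˣ) : ℤ) : ℝ) * (M.submatrix id c).det := by
  have := Matrix.det_mul_row (fun l => ((e (c l) : ℤ) : ℝ)) (M.submatrix id c)
  push_cast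
  rw [← this]
  rfl

theorem signColumns_submatrix_initial {h : k ≤ n} {e : ℕ → ℤˣ} (he : ∀ j < k, e j = 1)
    {M : Matrix (Fin k) (Fin n) ℝ} (hM : M.submatrix id (Fin.castLE h) = 1) :
    (signColumns e M).submatrix id (Fin.castLE h) = 1 := by
  rw [← hM]
  ext a j
  simp [signColumns, he j j.2]

theorem continuous_signColumns {X : Type*} [TopologicalSpace X] {e : X → ℕ → ℤˣ}
    {M : X → Matrix (Fin k) (Fin n) ℝ} (he : ∀ j, Continuous fun x => e x j)
    (hM : Continuous M) : Continuous fun x => signColumns (e x) (M x) := by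
  refine continuous_matrix fun a j => Continuous.mul ?_ (hM.matrix_elem a j)
  exact (continuous_of_discreteTopology (f := fun u : ℤˣ => ((u : ℤ) : ℝ))).comp (he j)

/-- Matrices in normal form whose minors on consecutive columns are positive, except for those on
columns that wrap around, which are only required to be nonzero. -/
def positiveFrames (h : k ≤ n) : Set (Matrix (Fin k) (Fin n) ℝ) :=
  {M | M ∈ normalFrames h ∧
    ∀ i : Fin n, (i : ℕ) + k ≤ n → 0 < (M.submatrix id (cyclicColumns k i)).det}

/-- The signs of the minors on consecutive columns. -/
noncomputable def minorSigns (M : Matrix (Fin k) (Fin n) ℝ) (i : ℕ) : ℤˣ :=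
  if h : i < n then signUnit (M.submatrix id (cyclicColumns k ⟨i, h⟩)).det else 1

theorem continuous_minorSigns (h : k ≤ n) :
    Continuous fun M : normalFrames h => minorSigns M.1 := by
  refine continuous_pi fun i => ?_
  unfold minorSigns
  split_ifs with hi
  · exact continuous_signUnit (continuous_subtype_val.matrix_submatrix _ _).matrix_det
      fun M => M.2.2 _
  · exact continuous_const

theorem prod_cyclicColumns (e : ℕ → ℤˣ) {i : Fin n} (hi : (i : ℕ) + k ≤ n) :
    ∏ l, e (cyclicColumns k i l) = ∏ l : Fin k, e (i + l) := by
  refine Finset.prod_congr rfl fun l _ => ?_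
  rw [cyclicColumns_of_le hi]

theorem signColumns_mem_normalFrames {h : k ≤ n} {e : ℕ → ℤˣ} (he : ∀ j < k, e j = 1)
    {M : Matrix (Fin k) (Fin n) ℝ} (hM : M ∈ normalFrames h) :
    signColumns e M ∈ normalFrames h := by
  refine ⟨signColumns_submatrix_initial he hM.1, fun i => ?_⟩
  rw [det_submatrix_signColumns]
  exact mul_ne_zero (by exact_mod_cast Units.ne_zero _) (hM.2 i)

theorem signColumns_mem_positiveFrames (hk : 0 < k) {h : k ≤ n}
    {M : Matrix (Fin k) (Fin n) ℝ} (hM : M ∈ normalFrames h) :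
    signColumns (signRec k (minorSigns M)) M ∈ positiveFrames h := by
  refine ⟨signColumns_mem_normalFrames (fun j hj => signRec_of_lt _ hj) hM, fun i hi => ?_⟩
  rw [det_submatrix_signColumns, prod_cyclicColumns _ hi]
  -- The window at `0` is the identity block and needs no correction.
  rcases Nat.eq_zero_or_pos (i : ℕ) with h0 | h0
  · rw [Finset.prod_eq_one fun l _ => signRec_of_lt _ (by have := l.2; omega)]
    have : i = ⟨0, by omega⟩ := Fin.ext h0
    rw [this, cyclicColumns_zero h, hM.1]
    simp
  · rw [prod_signRec hk _ h0, minorSigns, dif_pos i.2]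
    exact signUnit_mul_self_pos (hM.2 i)

/-- Extend signs of the noninitial columns by ones. -/
def extendSigns (k : ℕ) {n : ℕ} (t : Fin (n - k) → ℤˣ) (j : ℕ) : ℤˣ :=
  if h : k ≤ j ∧ j < n then t ⟨j - k, by omega⟩ else 1

theorem extendSigns_of_lt {t : Fin (n - k) → ℤˣ} {j : ℕ} (h : j < k) :
    extendSigns k t j = 1 := by
  rw [extendSigns, dif_neg (by omega)]

/-- Since the minors of `M` are positive, those of the re-signed matrix reveal the products of the
signs over windows, and these determine `t`. -/
theorem signRec_minorSigns_signColumns (hk : 0 < k) {h : k ≤ n} {M : Matrix (Fin k) (Fin n) ℝ}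
    (hM : M ∈ positiveFrames h) (t : Fin (n - k) → ℤˣ) :
    ∀ j < n, extendSigns k t j =
      signRec k (minorSigns (signColumns (extendSigns k t) M)) j := by
  refine signRec_unique hk _ _ (fun j hj => extendSigns_of_lt hj) fun i _ hi => ?_
  rw [minorSigns, dif_pos (by omega), det_submatrix_signColumns,
    signUnit_mul _ (hM.2 ⟨i, by omega⟩ hi), prod_cyclicColumns _ hi]

/-- The space of normal forms is a product of signs and the positive part. -/
noncomputable def normalFramesHomeomorph (hk : 0 < k) (h : k ≤ n) :
    normalFrames h ≃ₜ (Fin (n - k) → ℤˣ) × positiveFrames h where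
  toFun M := (fun j => signRec k (minorSigns M.1) (j + k),
    ⟨signColumns (signRec k (minorSigns M.1)) M.1, signColumns_mem_positiveFrames hk M.2⟩)
  invFun p := ⟨signColumns (extendSigns k p.1) p.2.1,
    signColumns_mem_normalFrames (fun _ hj => extendSigns_of_lt hj) p.2.2.1⟩
  left_inv M := by
    refine Subtype.ext (signColumns_signColumns (fun j hj => ?_) M.1)
    by_cases hj' : j < k
    · rw [extendSigns_of_lt hj', signRec_of_lt _ hj']
    · rw [extendSigns, dif_pos ⟨by omega, hj⟩]
      simp only [show j - k + k = j by omega]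
  right_inv p := by
    have key := signRec_minorSigns_signColumns hk p.2.2 p.1
    refine Prod.ext ?_ (Subtype.ext ?_)
    · funext j
      have := j.2
      simp only
      rw [← key _ (by omega), extendSigns, dif_pos (by omega)]
      simp
    · exact signColumns_signColumns (fun j hj => (key j hj).symm) _
  continuous_toFun := by
    have hc : ∀ j, Continuous fun M : normalFrames h => signRec k (minorSigns M.1) j :=
      fun j => (continuous_signRec k j).comp (continuous_minorSigns h)
    exact (continuous_pi fun j => hc _).prodMk
      ((continuous_signColumns hc continuous_subtype_val).subtype_mk _)
  continuous_invFun := by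
    refine Continuous.subtype_mk (continuous_signColumns (fun j => ?_)
      (continuous_subtype_val.comp continuous_snd)) _
    unfold extendSigns
    split_ifs with hj
    · exact (continuous_apply _).comp continuous_fst
    · exact continuous_const

theorem card_connectedComponents_refinedOpenBruhatCell (hk : 0 < k) (h : k ≤ n) :
    Nat.card (ConnectedComponents (refinedOpenBruhatCell k n)) =
      2 ^ (n - k) * Nat.card (ConnectedComponents (positiveFrames h)) := by
  rw [((refinedOpenBruhatCellHomeomorph h (by omega)).trans
    (normalFramesHomeomorph hk h)).card_connectedComponents, card_connectedComponents_prod]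
  congr 1
  simp

end Signs

/-! ### Planar configurations -/

section Plane

open Topology Matrix

variable {n : ℕ}

/-- The columns of a matrix with two rows as complex numbers, continued by ones. -/
noncomputable def planarColumn (M : Matrix (Fin 2) (Fin n) ℝ) (j : ℕ) : ℂ :=
  if h : j < n then ⟨M 0 ⟨j, h⟩, M 1 ⟨j, h⟩⟩ else 1

theorem det_cyclicColumns_two {M : Matrix (Fin 2) (Fin n) ℝ} {i : ℕ} (hi : i + 1 < n) :
    (M.submatrix id (cyclicColumns 2 (⟨i, by omega⟩ : Fin n))).det =
      (planarColumn M i).re * (planarColumn M (i + 1)).im -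
        (planarColumn M (i + 1)).re * (planarColumn M i).im := by
  rw [det_fin_two]
  simp only [submatrix_apply, id, cyclicColumns_of_le (k := 2) (i := (⟨i, by omega⟩ : Fin n))
    (by simp only; omega), planarColumn, dif_pos hi, dif_pos (show i < n by omega)]
  rfl

theorem det_cyclicColumns_two_last {M : Matrix (Fin 2) (Fin n) ℝ} (hn : 2 ≤ n)
    (h0 : planarColumn M 0 = 1) :
    (M.submatrix id (cyclicColumns 2 (⟨n - 1, by omega⟩ : Fin n))).det =
      -(planarColumn M (n - 1)).im := by
  have c0 : cyclicColumns 2 (⟨n - 1, by omega⟩ : Fin n) 0 = ⟨n - 1, by omega⟩ := by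
    ext
    exact Nat.mod_eq_of_lt (by simp only [Fin.val_zero]; omega)
  have c1 : cyclicColumns 2 (⟨n - 1, by omega⟩ : Fin n) 1 = ⟨0, by omega⟩ := by
    ext
    simp [cyclicColumns, show n - 1 + 1 = n by omega]
  rw [planarColumn, dif_pos (by omega)] at h0
  have hre := congrArg Complex.re h0
  have him := congrArg Complex.im h0
  simp only [Complex.one_re, Complex.one_im] at hre him
  rw [det_fin_two]
  simp only [submatrix_apply, id, c0, c1, planarColumn, dif_pos (show n - 1 < n by omega), hre,
    him]
  ring

/-- Only the window starting at the last column wraps around. It pairs that column with `1`, which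
leaves its imaginary part up to sign. -/
theorem mem_positiveFrames_two (h : 2 ≤ n) {M : Matrix (Fin 2) (Fin n) ℝ} :
    M ∈ positiveFrames h ↔ planarColumn M 0 = 1 ∧ planarColumn M 1 = Complex.I ∧
      (∀ j, j + 1 < n → 0 < (planarColumn M j).re * (planarColumn M (j + 1)).im -
        (planarColumn M (j + 1)).re * (planarColumn M j).im) ∧
      (planarColumn M (n - 1)).im ≠ 0 := by
  have hcol : M.submatrix id (Fin.castLE h) = 1 ↔
      planarColumn M 0 = 1 ∧ planarColumn M 1 = Complex.I := by
    rw [← Matrix.ext_iff]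
    simp only [Fin.forall_fin_two, submatrix_apply, id, planarColumn, Complex.ext_iff,
      dif_pos (show 0 < n by omega), dif_pos (show 1 < n by omega)]
    simp
    tauto
  constructor
  · rintro ⟨⟨h1, h2⟩, h3⟩
    obtain ⟨hz0, hz1⟩ := hcol.mp h1
    refine ⟨hz0, hz1, fun j hj => ?_, ?_⟩
    · rw [← det_cyclicColumns_two hj]
      exact h3 ⟨j, by omega⟩ hj
    · have := h2 ⟨n - 1, by omega⟩
      rwa [det_cyclicColumns_two_last h hz0, neg_ne_zero] at this
  · rintro ⟨hz0, hz1, h3, h4⟩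
    have h3' : ∀ i : Fin n, (i : ℕ) + 2 ≤ n →
        0 < (M.submatrix id (cyclicColumns 2 i)).det := fun i hi => by
      have := h3 i (by omega)
      rwa [← det_cyclicColumns_two (by omega)] at this
    refine ⟨⟨hcol.mpr ⟨hz0, hz1⟩, fun i => ?_⟩, h3'⟩
    by_cases hi : (i : ℕ) + 2 ≤ n
    · exact (h3' i hi).ne'
    · have : i = ⟨n - 1, by omega⟩ := Fin.ext (by have := i.2; simp only; omega)
      rw [this, det_cyclicColumns_two_last h hz0, neg_ne_zero]
      exact h4

theorem continuous_planarColumn (j : ℕ) :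
    Continuous fun M : Matrix (Fin 2) (Fin n) ℝ => planarColumn M j := by
  unfold planarColumn
  split_ifs with h
  · exact Complex.equivRealProdCLM.symm.continuous.comp
      ((continuous_id.matrix_elem 0 _).prodMk (continuous_id.matrix_elem 1 _))
  · exact continuous_const

/-- The cross product divided by `|z| ^ 2` is the imaginary part of `w / z`. -/
theorem im_div_pos {z w : ℂ} (h : 0 < z.re * w.im - w.re * z.im) : 0 < (w / z).im := by
  have hz : z ≠ 0 := by
    rintro rfl
    simp at h
  have hz' : 0 < Complex.normSq z := Complex.normSq_pos.mpr hz
  rw [Complex.div_im, ← sub_div]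
  exact div_pos (by linarith) hz'

/-- The angle from one column to the next. -/
noncomputable def columnAngle (M : Matrix (Fin 2) (Fin n) ℝ) (j : ℕ) : ℝ :=
  (planarColumn M (j + 1) / planarColumn M j).arg

/-- The angle by which the columns turn. -/
noncomputable def totalAngle (M : Matrix (Fin 2) (Fin n) ℝ) : ℝ :=
  ∑ j ∈ Finset.range (n - 1), columnAngle M j

theorem arg_mem_Ioo {z : ℂ} (hz : 0 < z.im) : z.arg ∈ Set.Ioo 0 Real.pi := by
  refine ⟨lt_of_le_of_ne (Complex.arg_nonneg_iff.mpr hz.le) fun h => ?_,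
    lt_of_le_of_ne (Complex.arg_le_pi z) fun h => ?_⟩
  · exact hz.ne' (Complex.arg_eq_zero_iff.mp h.symm).2
  · exact hz.ne' (Complex.arg_eq_pi_iff.mp h).2

variable {h : 2 ≤ n}

theorem columnAngle_mem {M : Matrix (Fin 2) (Fin n) ℝ} (hM : M ∈ positiveFrames h) {j : ℕ}
    (hj : j + 1 < n) : columnAngle M j ∈ Set.Ioo 0 Real.pi :=
  arg_mem_Ioo (im_div_pos (((mem_positiveFrames_two h).mp hM).2.2.1 j hj))

theorem columnAngle_zero {M : Matrix (Fin 2) (Fin n) ℝ} (hM : M ∈ positiveFrames h) :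
    columnAngle M 0 = Real.pi / 2 := by
  obtain ⟨h0, h1, -⟩ := (mem_positiveFrames_two h).mp hM
  rw [columnAngle, h0, h1, div_one, Complex.arg_I]

theorem planarColumn_ne_zero {M : Matrix (Fin 2) (Fin n) ℝ} (hM : M ∈ positiveFrames h) (j : ℕ) :
    planarColumn M j ≠ 0 := by
  obtain ⟨h0, h1, h2, h3⟩ := (mem_positiveFrames_two h).mp hM
  by_cases hj : j + 1 < n
  · intro hz
    have := h2 j hj
    simp [hz] at this
  · by_cases hj' : j < n
    · have : j = n - 1 := by omega
      subst this
      intro hz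
      simp [hz] at h3
    · rw [planarColumn, dif_neg hj']
      exact one_ne_zero

/-- Quotients of neighbouring columns lie in the open upper half plane, away from the branch cut of
`arg`. -/
theorem continuous_totalAngle : Continuous fun M : positiveFrames h => totalAngle M.1 := by
  refine continuous_finsetSum _ fun j hj => ?_
  have hj : j + 1 < n := by
    have := Finset.mem_range.mp hj
    omega
  refine continuous_iff_continuousAt.mpr fun M => ?_
  have hs := im_div_pos (((mem_positiveFrames_two h).mp M.2).2.2.1 j hj)
  refine (Complex.continuousAt_arg (Complex.mem_slitPlane_iff.mpr (.inr hs.ne'))).comp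
    (f := fun M : positiveFrames h => planarColumn M.1 (j + 1) / planarColumn M.1 j) ?_
  exact ContinuousAt.div₀ ((continuous_planarColumn _).comp continuous_subtype_val).continuousAt
    ((continuous_planarColumn _).comp continuous_subtype_val).continuousAt
    (planarColumn_ne_zero M.2 j)

/-- The quotients telescope: partial sums of the angles are arguments of the columns, without
reduction modulo `2π`. -/
theorem planarColumn_eq {M : Matrix (Fin 2) (Fin n) ℝ} (hM : M ∈ positiveFrames h) (j : ℕ) :
    planarColumn M j = (‖planarColumn M j‖ : ℂ) *
      Complex.exp ((∑ i ∈ Finset.range j, columnAngle M i : ℝ) * Complex.I) := by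
  induction j with
  | zero => simp [((mem_positiveFrames_two h).mp hM).1]
  | succ j ih =>
    have hz := planarColumn_ne_zero hM j
    have hn : (‖planarColumn M j‖ : ℂ) ≠ 0 := by simpa using hz
    have key := Complex.norm_mul_exp_arg_mul_I (planarColumn M (j + 1) / planarColumn M j)
    rw [Finset.sum_range_succ, Complex.ofReal_add, add_mul, Complex.exp_add]
    calc planarColumn M (j + 1)
        = planarColumn M (j + 1) / planarColumn M j * planarColumn M j :=
          (div_mul_cancel₀ _ hz).symm
      _ = _ := by
          conv_lhs => rw [← key]
          conv_lhs => enter [2]; rw [ih]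
          rw [norm_div, Complex.ofReal_div, columnAngle]
          field_simp

theorem sin_totalAngle_ne_zero {M : Matrix (Fin 2) (Fin n) ℝ} (hM : M ∈ positiveFrames h) :
    Real.sin (totalAngle M) ≠ 0 := by
  intro hs
  refine ((mem_positiveFrames_two h).mp hM).2.2.2 ?_
  rw [planarColumn_eq hM]
  simp only [Complex.im_ofReal_mul, Complex.exp_ofReal_mul_I_im]
  exact mul_eq_zero_of_right _ hs

theorem floor_totalAngle {M : Matrix (Fin 2) (Fin n) ℝ} (hM : M ∈ positiveFrames h) :
    0 < totalAngle M / Real.pi ∧ totalAngle M / Real.pi < (n - 1 : ℕ) := by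
  have hpi := Real.pi_pos
  have hne : (Finset.range (n - 1)).Nonempty := ⟨0, by simp; omega⟩
  constructor
  · refine div_pos (Finset.sum_pos (fun j hj => ?_) hne) hpi
    exact (columnAngle_mem hM (by have := Finset.mem_range.mp hj; omega)).1
  · rw [div_lt_iff₀ hpi]
    refine (Finset.sum_lt_sum_of_nonempty hne (g := fun _ => Real.pi) fun j hj => ?_).trans_eq
      (by simp)
    exact (columnAngle_mem hM (by have := Finset.mem_range.mp hj; omega)).2

/-- The number of half turns completed by the columns. -/
noncomputable def halfTurns (M : positiveFrames h) : Fin (n - 1) :=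
  ⟨⌊totalAngle M.1 / Real.pi⌋₊, (Nat.floor_lt (floor_totalAngle M.2).1.le).mpr
    (floor_totalAngle M.2).2⟩

theorem totalAngle_bounds (M : positiveFrames h) :
    (halfTurns M : ℕ) * Real.pi < totalAngle M.1 ∧
      totalAngle M.1 < ((halfTurns M : ℕ) + 1) * Real.pi := by
  have hpi := Real.pi_pos
  constructor
  · refine lt_of_le_of_ne ?_ fun heq => sin_totalAngle_ne_zero M.2 ?_
    · exact (le_div_iff₀ hpi).mp (Nat.floor_le (floor_totalAngle M.2).1.le)
    · rw [← heq, Real.sin_nat_mul_pi]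
  · exact (div_lt_iff₀ hpi).mp (Nat.lt_floor_add_one _)

theorem halfTurns_eq_of_bounds {M : positiveFrames h} {m : Fin (n - 1)}
    (h1 : (m : ℕ) * Real.pi < totalAngle M.1) (h2 : totalAngle M.1 < ((m : ℕ) + 1) * Real.pi) :
    halfTurns M = m := by
  have hpi := Real.pi_pos
  refine Fin.ext ((Nat.floor_eq_iff (floor_totalAngle M.2).1.le).mpr ⟨?_, ?_⟩)
  · exact (le_div_iff₀ hpi).mpr h1.le
  · exact (div_lt_iff₀ hpi).mpr h2

/-- The total angle lies strictly between two consecutive multiples of `π`, and these bounds persist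
nearby. -/
theorem continuous_halfTurns : Continuous (halfTurns (h := h)) := by
  refine continuous_iff_continuousAt.mpr fun M => ?_
  refine (continuousAt_const (y := halfTurns M)).congr ?_
  obtain ⟨h1, h2⟩ := totalAngle_bounds M
  filter_upwards [continuous_totalAngle.continuousAt.eventually (lt_mem_nhds h1),
    continuous_totalAngle.continuousAt.eventually (gt_mem_nhds h2)] with N hN1 hN2
  exact (halfTurns_eq_of_bounds hN1 hN2).symm

/-- Polar coordinates of configurations completing `m` half turns. -/
def polarDomain (n m : ℕ) : Set ((ℕ → ℝ) × (ℕ → ℝ)) :=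
  {p | (∀ j, 0 < p.1 j) ∧ p.1 0 = 1 ∧ p.1 1 = 1 ∧ (∀ j, 0 < p.2 j) ∧ (∀ j, p.2 j < Real.pi) ∧
    p.2 0 = Real.pi / 2 ∧ m * Real.pi < ∑ j ∈ Finset.range (n - 1), p.2 j ∧
    ∑ j ∈ Finset.range (n - 1), p.2 j < (m + 1) * Real.pi}

theorem convex_polarDomain (n m : ℕ) : Convex ℝ (polarDomain n m) := by
  have hsum : IsLinearMap ℝ fun p : (ℕ → ℝ) × (ℕ → ℝ) => ∑ j ∈ Finset.range (n - 1), p.2 j :=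
    ⟨fun p q => by simp [Finset.sum_add_distrib], fun c p => by simp [Finset.mul_sum]⟩
  have h1 : ∀ j, IsLinearMap ℝ fun p : (ℕ → ℝ) × (ℕ → ℝ) => p.1 j :=
    fun j => ⟨fun p q => rfl, fun c p => rfl⟩
  have h2 : ∀ j, IsLinearMap ℝ fun p : (ℕ → ℝ) × (ℕ → ℝ) => p.2 j :=
    fun j => ⟨fun p q => rfl, fun c p => rfl⟩
  have heq : polarDomain n m =
      (⋂ j, {p | 0 < p.1 j}) ∩ ({p | p.1 0 = 1} ∩ ({p | p.1 1 = 1} ∩ ((⋂ j, {p | 0 < p.2 j}) ∩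
        ((⋂ j, {p | p.2 j < Real.pi}) ∩ ({p | p.2 0 = Real.pi / 2} ∩
          ({p | m * Real.pi < ∑ j ∈ Finset.range (n - 1), p.2 j} ∩
            {p | ∑ j ∈ Finset.range (n - 1), p.2 j < (m + 1) * Real.pi})))))) := by
    ext p
    simp [polarDomain]
  rw [heq]
  exact (convex_iInter fun j => convex_halfSpace_gt (h1 j) _).inter
    ((convex_hyperplane (h1 0) _).inter ((convex_hyperplane (h1 1) _).inter
    ((convex_iInter fun j => convex_halfSpace_gt (h2 j) _).inter
    ((convex_iInter fun j => convex_halfSpace_lt (h2 j) _).inter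
    ((convex_hyperplane (h2 0) _).inter ((convex_halfSpace_gt hsum _).inter
    (convex_halfSpace_lt hsum _)))))))

/-- The configuration with given polar coordinates. -/
noncomputable def ofPolar (n : ℕ) (p : (ℕ → ℝ) × (ℕ → ℝ)) : Matrix (Fin 2) (Fin n) ℝ :=
  Matrix.of ![fun j => p.1 j * Real.cos (∑ i ∈ Finset.range j, p.2 i),
    fun j => p.1 j * Real.sin (∑ i ∈ Finset.range j, p.2 i)]

theorem continuous_ofPolar : Continuous (ofPolar n) := by
  refine continuous_matrix fun a j => ?_
  have hs : Continuous fun p : (ℕ → ℝ) × (ℕ → ℝ) => ∑ i ∈ Finset.range (j : ℕ), p.2 i :=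
    continuous_finsetSum _ fun i _ => (continuous_apply i).comp continuous_snd
  have hr : Continuous fun p : (ℕ → ℝ) × (ℕ → ℝ) => p.1 j :=
    (continuous_apply (j : ℕ)).comp continuous_fst
  fin_cases a
  · exact hr.mul (Real.continuous_cos.comp hs)
  · exact hr.mul (Real.continuous_sin.comp hs)

theorem planarColumn_ofPolar (p : (ℕ → ℝ) × (ℕ → ℝ)) {j : ℕ} (hj : j < n) :
    planarColumn (ofPolar n p) j =
      p.1 j * Complex.exp ((∑ i ∈ Finset.range j, p.2 i : ℝ) * Complex.I) := by
  rw [planarColumn, dif_pos hj]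
  apply Complex.ext
  · simp only [Complex.re_ofReal_mul, Complex.exp_ofReal_mul_I_re]
    rfl
  · simp only [Complex.im_ofReal_mul, Complex.exp_ofReal_mul_I_im]
    rfl

theorem ofPolar_mem (h : 2 ≤ n) {m : ℕ} {p : (ℕ → ℝ) × (ℕ → ℝ)} (hp : p ∈ polarDomain n m) :
    ofPolar n p ∈ positiveFrames h := by
  obtain ⟨h1, h2, h3, h4, h5, h6, h7, h8⟩ := hp
  refine (mem_positiveFrames_two h).mpr ⟨?_, ?_, fun j hj => ?_, ?_⟩
  · simp [planarColumn_ofPolar p (show 0 < n by omega), h2]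
  · rw [planarColumn_ofPolar p (show 1 < n by omega)]
    simp [h3, h6, Complex.exp_pi_div_two_mul_I]
  · rw [planarColumn_ofPolar p hj, planarColumn_ofPolar p (show j < n by omega),
      Finset.sum_range_succ]
    simp only [Complex.re_ofReal_mul, Complex.im_ofReal_mul, Complex.exp_ofReal_mul_I_re,
      Complex.exp_ofReal_mul_I_im]
    -- The cross product of neighbours is the product of their radii and the sine of the angle
    -- between them.
    have hs := Real.sin_sub (∑ i ∈ Finset.range j, p.2 i + p.2 j) (∑ i ∈ Finset.range j, p.2 i)
    rw [add_sub_cancel_left] at hs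
    have := mul_pos (mul_pos (h1 j) (h1 (j + 1))) (Real.sin_pos_of_pos_of_lt_pi (h4 j) (h5 j))
    rw [hs] at this
    linarith
  · rw [planarColumn_ofPolar p (show n - 1 < n by omega)]
    simp only [Complex.im_ofReal_mul, Complex.exp_ofReal_mul_I_im]
    refine mul_ne_zero (h1 _).ne' fun hs => ?_
    have hs' : Real.sin (∑ i ∈ Finset.range (n - 1), p.2 i - m * Real.pi) = 0 := by
      rw [Real.sin_sub_nat_mul_pi, hs, mul_zero]
    exact (Real.sin_pos_of_pos_of_lt_pi (by linarith) (by linarith)).ne' hs'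

theorem totalAngle_ofPolar {m : ℕ} {p : (ℕ → ℝ) × (ℕ → ℝ)} (hp : p ∈ polarDomain n m) :
    totalAngle (ofPolar n p) = ∑ j ∈ Finset.range (n - 1), p.2 j := by
  obtain ⟨h1, h2, h3, h4, h5, h6, h7, h8⟩ := hp
  refine Finset.sum_congr rfl fun j hj => ?_
  have hj := Finset.mem_range.mp hj
  rw [columnAngle, planarColumn_ofPolar p (show j + 1 < n by omega),
    planarColumn_ofPolar p (show j < n by omega), Finset.sum_range_succ, Complex.ofReal_add,
    add_mul, Complex.exp_add]
  have hpos := div_pos (h1 (j + 1)) (h1 j)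
  have hne : (p.1 j : ℂ) ≠ 0 := by exact_mod_cast (h1 j).ne'
  have hexp := Complex.exp_ne_zero ((∑ i ∈ Finset.range j, p.2 i : ℝ) * Complex.I)
  have heq : (p.1 (j + 1) : ℂ) * (Complex.exp ((∑ i ∈ Finset.range j, p.2 i : ℝ) * Complex.I) *
      Complex.exp (p.2 j * Complex.I)) /
      (p.1 j * Complex.exp ((∑ i ∈ Finset.range j, p.2 i : ℝ) * Complex.I)) =
      (p.1 (j + 1) / p.1 j : ℝ) * Complex.exp (p.2 j * Complex.I) := by
    rw [Complex.ofReal_div]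
    field_simp
  rw [heq, Complex.arg_real_mul _ hpos, Complex.arg_exp_mul_I, toIocMod_eq_self]
  exact ⟨by linarith [h4 j, Real.pi_pos], by linarith [h5 j]⟩

theorem exists_polar (M : positiveFrames h) :
    ∃ p ∈ polarDomain n (halfTurns M), ofPolar n p = M.1 := by
  have hpi := Real.pi_pos
  have hsum : ∀ l ≤ n - 1, ∑ j ∈ Finset.range l,
      (if j + 1 < n then columnAngle M.1 j else Real.pi / 2) =
        ∑ j ∈ Finset.range l, columnAngle M.1 j := fun l hl =>
    Finset.sum_congr rfl fun j hj => if_pos (by have := Finset.mem_range.mp hj; omega)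
  obtain ⟨h0, h1, -⟩ := (mem_positiveFrames_two h).mp M.2
  -- The domain constrains all indices, so angles past the last column are set to `π / 2`.
  refine ⟨(fun j => ‖planarColumn M.1 j‖,
    fun j => if j + 1 < n then columnAngle M.1 j else Real.pi / 2),
    ⟨fun j => norm_pos_iff.mpr (planarColumn_ne_zero M.2 j), by simp [h0], by simp [h1],
      fun j => ?_, fun j => ?_, ?_, ?_, ?_⟩, ?_⟩
  · dsimp only
    split_ifs with hj
    · exact (columnAngle_mem M.2 hj).1
    · linarith
  · dsimp only
    split_ifs with hj
    · exact (columnAngle_mem M.2 hj).2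
    · linarith
  · simp only [columnAngle_zero M.2, ite_self]
  · simp only [hsum _ le_rfl]
    exact (totalAngle_bounds M).1
  · simp only [hsum _ le_rfl]
    exact (totalAngle_bounds M).2
  · have key : ∀ j : Fin n, planarColumn (ofPolar n (fun j => ‖planarColumn M.1 j‖,
        fun j => if j + 1 < n then columnAngle M.1 j else Real.pi / 2)) j =
          planarColumn M.1 j := fun j => by
      rw [planarColumn_ofPolar _ j.2, planarColumn_eq M.2 j]
      simp only [hsum _ (show (j : ℕ) ≤ n - 1 by have := j.2; omega)]
    ext a j
    have := key j
    simp only [planarColumn, dif_pos j.2, Complex.mk.injEq] at this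
    fin_cases a
    · exact this.1
    · exact this.2

theorem polarDomain_nonempty (hn : 3 ≤ n) {m : ℕ} (hm : m < n - 1) :
    (polarDomain n m).Nonempty := by
  have hpi := Real.pi_pos
  obtain ⟨l, rfl⟩ := Nat.exists_eq_add_of_le' (show 2 ≤ n by omega)
  have hml : (m : ℝ) + 1 ≤ l + 1 := by exact_mod_cast (show m + 1 ≤ l + 1 by omega)
  have hl : (0 : ℝ) < l + 1 := by positivity
  -- With `t = (m + 1/2) / (l + 1)` in `(0, 1)`, the angle `π / 2` followed by `l` angles `tπ` has
  -- sum `(m + 1 - t)π`, strictly between `mπ` and `(m + 1)π`.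
  have ht0 : 0 < (m + 1 / 2) / ((l : ℝ) + 1) := by positivity
  have ht1 : (m + 1 / 2) / ((l : ℝ) + 1) < 1 := by
    rw [div_lt_one hl]
    linarith
  have hsum : ∑ j ∈ Finset.range (l + 2 - 1),
      (if j = 0 then Real.pi / 2 else (m + 1 / 2) / ((l : ℝ) + 1) * Real.pi) =
        (m + 1 - (m + 1 / 2) / ((l : ℝ) + 1)) * Real.pi := by
    rw [show l + 2 - 1 = l + 1 by omega, Finset.sum_range_succ']
    simp
    field_simp
    ring
  refine ⟨(fun _ => 1, fun j => if j = 0 then Real.pi / 2 else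
    (m + 1 / 2) / ((l : ℝ) + 1) * Real.pi), fun _ => one_pos, rfl, rfl, fun j => ?_, fun j => ?_,
    rfl, ?_, ?_⟩
  · dsimp only
    split_ifs
    · linarith
    · positivity
  · dsimp only
    split_ifs
    · linarith
    · nlinarith
  · simp only [hsum]
    nlinarith
  · simp only [hsum]
    nlinarith

theorem card_connectedComponents_positiveFrames_two (hn : 3 ≤ n) (h : 2 ≤ n) :
    Nat.card (ConnectedComponents (positiveFrames h)) = n - 1 := by
  have hs : Function.Surjective (halfTurns (h := h)) := fun m => by
    obtain ⟨p, hp⟩ := polarDomain_nonempty hn m.2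
    refine ⟨⟨ofPolar n p, ofPolar_mem h hp⟩, halfTurns_eq_of_bounds ?_ ?_⟩
    · rw [totalAngle_ofPolar hp]
      exact hp.2.2.2.2.2.2.1
    · rw [totalAngle_ofPolar hp]
      exact hp.2.2.2.2.2.2.2
  have hr : ∀ M : positiveFrames h, ∃ i, (M : ConnectedComponents (positiveFrames h)) =
      (Function.surjInv hs i : positiveFrames h) := by
    intro M
    refine ⟨halfTurns M, ?_⟩
    set N := Function.surjInv hs (halfTurns M) with hN
    have hMN : halfTurns N = halfTurns M := Function.surjInv_eq hs _
    have := (convex_polarDomain n (halfTurns M)).isPreconnected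
    have hc : Continuous fun p : polarDomain n (halfTurns M) =>
        (⟨ofPolar n p.1, ofPolar_mem h p.2⟩ : positiveFrames h) :=
      (continuous_ofPolar.comp continuous_subtype_val).subtype_mk _
    have := Subtype.preconnectedSpace this
    obtain ⟨p, hp, hpM⟩ := exists_polar M
    obtain ⟨q, hq, hqN⟩ := exists_polar N
    rw [hMN] at hq
    exact (isPreconnected_range hc).coe_eq_coe ⟨⟨p, hp⟩, Subtype.ext hpM⟩
      ⟨⟨q, hq⟩, Subtype.ext hqN⟩
  rw [card_connectedComponents_eq continuous_halfTurns hs (Function.surjInv hs) hr rfl]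
  simp

end Plane

/-! ### Chains of vectors in space -/

section Chain

open Topology

/-- The area form of the last two coordinates. -/
def wedge (v w : ℝ × ℝ × ℝ) : ℝ := v.2.1 * w.2.2 - v.2.2 * w.2.1

/-- The volume form. -/
def vol (u v w : ℝ × ℝ × ℝ) : ℝ := u.1 * wedge v w - v.1 * wedge u w + w.1 * wedge u v

/-- The chain starting with the second and third basis vectors and continued by `u`. -/
def chain {m : ℕ} (u : Fin m → ℝ × ℝ × ℝ) : ℕ → ℝ × ℝ × ℝ
  | 0 => (0, 1, 0)
  | 1 => (0, 0, 1)
  | k + 2 => if h : k < m then u ⟨k, h⟩ else 0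

/-- Chains with positive consecutive volumes whose end is transversal to the start. -/
def chainSpace (m : ℕ) : Set (Fin m → ℝ × ℝ × ℝ) :=
  {u | (∀ k < m, 0 < vol (chain u k) (chain u (k + 1)) (chain u (k + 2))) ∧
    wedge (chain u m) (chain u (m + 1)) ≠ 0 ∧ (chain u (m + 1)).2.2 ≠ 0}

/-- The interleaved sequence of the areas of consecutive vectors and the last coordinates. -/
noncomputable def coord (s : ℕ → ℝ × ℝ × ℝ) (j : ℕ) : ℝ :=
  if j % 2 = 0 then wedge (s (j / 2)) (s (j / 2 + 1)) else (s (j / 2 + 1)).2.2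

/-- The sign encoded by a bit. -/
def bitSign (b : Bool) : ℝ := if b then -1 else 1

/-- The coordinates of the chain have the signs encoded by `x`. -/
def HasSigns {m : ℕ} (x : ℕ → Bool) (u : Fin m → ℝ × ℝ × ℝ) : Prop :=
  ∀ j < 2 * m + 2, 0 < bitSign (x j) * coord (chain u) j

theorem coord_even (s : ℕ → ℝ × ℝ × ℝ) (k : ℕ) : coord s (2 * k) = wedge (s k) (s (k + 1)) := by
  simp [coord]

theorem coord_odd (s : ℕ → ℝ × ℝ × ℝ) (k : ℕ) : coord s (2 * k + 1) = (s (k + 1)).2.2 := by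
  rw [coord, if_neg (by omega), show (2 * k + 1) / 2 = k by omega]

theorem coord_chain_zero {m : ℕ} (u : Fin m → ℝ × ℝ × ℝ) : coord (chain u) 0 = 1 := by
  simp [coord, chain, wedge]

theorem coord_chain_one {m : ℕ} (u : Fin m → ℝ × ℝ × ℝ) : coord (chain u) 1 = 1 := by
  simp [coord, chain]

theorem bitSign_ne_zero (b : Bool) : bitSign b ≠ 0 := by
  cases b <;> simp [bitSign]

theorem bitSign_mul_self (b : Bool) : bitSign b * bitSign b = 1 := by
  cases b <;> simp [bitSign]

theorem exists_bitSign {a : ℝ} (ha : a ≠ 0) : ∃ b, 0 < bitSign b * a := by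
  rcases lt_or_gt_of_ne ha with h | h
  · exact ⟨true, by simpa [bitSign] using h⟩
  · exact ⟨false, by simpa [bitSign] using h⟩

theorem eq_false_of_bitSign_pos {b : Bool} (h : 0 < bitSign b) : b = false := by
  cases b
  · rfl
  · simp [bitSign] at h
    linarith

theorem HasSigns.zero_one {m : ℕ} {x : ℕ → Bool} {u : Fin m → ℝ × ℝ × ℝ} (h : HasSigns x u) :
    x 0 = false ∧ x 1 = false := by
  have h0 := h 0 (by omega)
  have h1 := h 1 (by omega)
  rw [coord_chain_zero, mul_one] at h0
  rw [coord_chain_one, mul_one] at h1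
  exact ⟨eq_false_of_bitSign_pos h0, eq_false_of_bitSign_pos h1⟩

theorem HasSigns.congr {m : ℕ} {x y : ℕ → Bool} {u : Fin m → ℝ × ℝ × ℝ} (h : HasSigns x u)
    (hxy : ∀ i < 2 * m + 2, x i = y i) : HasSigns y u := fun j hj => by
  rw [← hxy j hj]
  exact h j hj

variable {m : ℕ}

theorem continuous_chain (k : ℕ) : Continuous fun u : Fin m → ℝ × ℝ × ℝ => chain u k := by
  match k with
  | 0 => exact continuous_const
  | 1 => exact continuous_const
  | k + 2 =>
    simp only [chain]
    split_ifs with h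
    · exact continuous_apply _
    · exact continuous_const

theorem Continuous.wedge {X : Type*} [TopologicalSpace X] {f g : X → ℝ × ℝ × ℝ}
    (hf : Continuous f) (hg : Continuous g) : Continuous fun x => wedge (f x) (g x) := by
  unfold _root_.wedge
  fun_prop

theorem Continuous.vol {X : Type*} [TopologicalSpace X] {f g h : X → ℝ × ℝ × ℝ}
    (hf : Continuous f) (hg : Continuous g) (hh : Continuous h) :
    Continuous fun x => vol (f x) (g x) (h x) := by
  unfold _root_.vol
  have h1 := hg.wedge hh
  have h2 := hf.wedge hh
  have h3 := hf.wedge hg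
  fun_prop

theorem continuous_coord (j : ℕ) :
    Continuous fun u : Fin m → ℝ × ℝ × ℝ => coord (chain u) j := by
  unfold coord
  split_ifs
  · exact (continuous_chain _).wedge (continuous_chain _)
  · exact continuous_snd.comp (continuous_snd.comp (continuous_chain _))

theorem isOpen_chainSpace (m : ℕ) : IsOpen (chainSpace m) := by
  have heq : chainSpace m =
      (⋂ k : Fin m, {u | 0 < vol (chain u k) (chain u (k + 1)) (chain u (k + 2))}) ∩
        ({u | wedge (chain u m) (chain u (m + 1)) ≠ 0} ∩ {u | (chain u (m + 1)).2.2 ≠ 0}) := by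
    ext u
    simp [chainSpace, Fin.forall_iff]
  rw [heq]
  refine (isOpen_iInter_of_finite fun k => ?_).inter (IsOpen.inter ?_ ?_)
  · exact isOpen_lt continuous_const
      ((continuous_chain _).vol (continuous_chain _) (continuous_chain _))
  · exact isOpen_ne_fun ((continuous_chain _).wedge (continuous_chain _)) continuous_const
  · exact isOpen_ne_fun (continuous_snd.comp (continuous_snd.comp (continuous_chain _)))
      continuous_const

/-- Nearby points of the chain space lie in the same component. -/
theorem eventually_mem_component (u₀ : chainSpace m) :
    ∀ᶠ u in 𝓝 u₀.1, ∃ hu : u ∈ chainSpace m,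
      ((⟨u, hu⟩ : chainSpace m) : ConnectedComponents (chainSpace m)) = u₀ := by
  have hopen := (isOpen_chainSpace m).connectedComponentIn (x := u₀.1)
  filter_upwards [hopen.mem_nhds (mem_connectedComponentIn u₀.2)] with u hu
  rw [connectedComponentIn_eq_image u₀.2] at hu
  obtain ⟨v, hv, rfl⟩ := hu
  exact ⟨v.2, ConnectedComponents.coe_eq_coe'.mpr hv⟩

theorem chain_add_single (u : Fin m → ℝ × ℝ × ℝ) {i : ℕ} (hi : i < m) (d : ℝ × ℝ × ℝ) (δ : ℝ)
    (k : ℕ) : chain (u + δ • (Pi.single ⟨i, hi⟩ d : Fin m → ℝ × ℝ × ℝ)) k =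
      if k = i + 2 then chain u k + δ • d else chain u k := by
  match k with
  | 0 => simp [chain]
  | 1 => simp [chain]
  | k + 2 =>
    by_cases hk : k = i
    · subst hk
      simp [chain, hi]
    · simp only [chain, add_left_inj, hk, if_false]
      split_ifs with h
      · simp [hk]
      · rfl

/-- Each coordinate can be changed linearly, given that a preceding last coordinate is nonzero. -/
theorem exists_perturbation (u : Fin m → ℝ × ℝ × ℝ) {j : ℕ} (hj2 : 2 ≤ j) (hj : j < 2 * m + 2)
    (h : j % 2 = 0 → coord (chain u) (j - 1) ≠ 0) :
    ∃ (d : Fin m → ℝ × ℝ × ℝ) (κ : ℝ), κ ≠ 0 ∧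
      ∀ δ : ℝ, coord (chain (u + δ • d)) j = coord (chain u) j + δ * κ := by
  rcases Nat.even_or_odd' j with ⟨k, rfl | rfl⟩
  · have h := h (by omega)
    obtain ⟨k, rfl⟩ := Nat.exists_eq_add_of_le' (show 1 ≤ k by omega)
    rw [show 2 * (k + 1) - 1 = 2 * k + 1 by omega, coord_odd] at h
    -- Moving the second vector of an area along `e₂` changes the area by minus the last coordinate
    -- of the first vector, which is the preceding coordinate of the sequence.
    refine ⟨Pi.single ⟨k, by omega⟩ (0, 1, 0), -(chain u (k + 1)).2.2, neg_ne_zero.mpr h,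
      fun δ => ?_⟩
    rw [coord_even, coord_even, chain_add_single, chain_add_single, if_neg (by omega),
      if_pos (by omega)]
    simp only [wedge, Prod.snd_add, Prod.fst_add, Prod.smul_mk, smul_eq_mul]
    ring
  · obtain ⟨k, rfl⟩ := Nat.exists_eq_add_of_le' (show 1 ≤ k by omega)
    refine ⟨Pi.single ⟨k, by omega⟩ (0, 0, 1), 1, one_ne_zero, fun δ => ?_⟩
    rw [coord_odd, coord_odd, chain_add_single, if_pos (by omega)]
    simp

theorem tendsto_add_smul (u d : Fin m → ℝ × ℝ × ℝ) :
    Filter.Tendsto (fun δ : ℝ => u + δ • d) (𝓝 0) (𝓝 u) := by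
  have : Continuous fun δ : ℝ => u + δ • d := by fun_prop
  simpa using this.tendsto 0

/-- Nonvanishing of the coordinates is a dense condition. -/
theorem exists_coord_ne_zero {U : Set (Fin m → ℝ × ℝ × ℝ)} (hU : IsOpen U) (hne : U.Nonempty)
    (l : ℕ) (hl : l ≤ 2 * m + 2) : ∃ u ∈ U, ∀ j < l, coord (chain u) j ≠ 0 := by
  induction l with
  | zero => exact ⟨hne.some, hne.some_mem, by simp⟩
  | succ l ih =>
    obtain ⟨u, hu, h⟩ := ih (by omega)
    suffices H : ∃ v ∈ U, (∀ j < l, coord (chain v) j ≠ 0) ∧ coord (chain v) l ≠ 0 by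
      obtain ⟨v, hv, h1, h2⟩ := H
      refine ⟨v, hv, fun j hj => ?_⟩
      rcases Nat.lt_succ_iff_lt_or_eq.mp hj with hj | rfl
      · exact h1 j hj
      · exact h2
    by_cases h0 : coord (chain u) l = 0
    · have hl2 : 2 ≤ l := by
        by_contra hc
        interval_cases l
        · rw [coord_chain_zero] at h0
          exact one_ne_zero h0
        · rw [coord_chain_one] at h0
          exact one_ne_zero h0
      obtain ⟨d, κ, hκ, hd⟩ := exists_perturbation u hl2 (by omega)
        fun _ => h (l - 1) (by omega)
      -- A small perturbation makes coordinate `l` nonzero without leaving `U` or losing the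
      -- coordinates already treated.
      have hev : ∀ᶠ v in 𝓝 u, v ∈ U ∧ ∀ j < l, coord (chain v) j ≠ 0 := by
        refine (hU.eventually_mem hu).and ((Set.finite_lt_nat l).eventually_all.mpr fun j hj => ?_)
        exact (continuous_coord j).continuousAt.eventually_ne (h j hj)
      have hev' := ((tendsto_add_smul u d).eventually hev)
      obtain ⟨δ, hδ, hδ0⟩ := ((hev'.filter_mono nhdsWithin_le_nhds).and
        (self_mem_nhdsWithin (s := {(0 : ℝ)}ᶜ))).exists
      refine ⟨u + δ • d, hδ.1, hδ.2, ?_⟩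
      rw [hd, h0, zero_add]
      exact mul_ne_zero hδ0 hκ
    · exact ⟨u, hu, h, h0⟩

/-- Every component contains a chain with nonzero coordinates. -/
theorem exists_hasSigns (u : chainSpace m) :
    ∃ (x : ℕ → Bool) (v : chainSpace m), HasSigns x v.1 ∧
      (u : ConnectedComponents (chainSpace m)) = v := by
  obtain ⟨U, hU, hUo, hu⟩ := eventually_nhds_iff.mp (eventually_mem_component u)
  obtain ⟨v, hv, h⟩ := exists_coord_ne_zero hUo ⟨u.1, hu⟩ (2 * m + 2) le_rfl
  obtain ⟨hv', hvu⟩ := hU v hv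
  have : ∀ j, ∃ b : Bool, j < 2 * m + 2 → 0 < bitSign b * coord (chain v) j := fun j => by
    by_cases hj : j < 2 * m + 2
    · obtain ⟨b, hb⟩ := exists_bitSign (h j hj)
      exact ⟨b, fun _ => hb⟩
    · exact ⟨false, fun hj' => (hj hj').elim⟩
  choose x hx using this
  exact ⟨x, ⟨v, hv'⟩, hx, hvu.symm⟩

theorem mem_chainSpace_of_hasSigns {x : ℕ → Bool} {u : Fin m → ℝ × ℝ × ℝ} (h : HasSigns x u)
    (hv : ∀ k < m, 0 < vol (chain u k) (chain u (k + 1)) (chain u (k + 2))) :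
    u ∈ chainSpace m := by
  refine ⟨hv, ?_, ?_⟩
  · have := h (2 * m) (by omega)
    rw [coord_even] at this
    exact right_ne_zero_of_mul this.ne'
  · have := h (2 * m + 1) (by omega)
    rw [coord_odd] at this
    exact right_ne_zero_of_mul this.ne'

/-- If exactly one interior coordinate of a chain vanishes, then the chain is in the closure of
the chains for both signs of this coordinate. -/
theorem exists_hasSigns_flip {x : ℕ → Bool} {j : ℕ} (hj2 : 2 ≤ j) (hj : j < 2 * m + 2)
    (u : chainSpace m) (hu0 : coord (chain u.1) j = 0)
    (hu : ∀ i < 2 * m + 2, i ≠ j → 0 < bitSign (x i) * coord (chain u.1) i) (b : Bool) :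
    ∃ v : chainSpace m, (v : ConnectedComponents (chainSpace m)) = u ∧
      ∀ i < 2 * m + 2, 0 < bitSign (if i = j then b else x i) * coord (chain v.1) i := by
  obtain ⟨d, κ, hκ, hd⟩ := exists_perturbation u.1 hj2 hj
    fun _ => right_ne_zero_of_mul (hu (j - 1) (by omega) (by omega)).ne'
  have hev : ∀ᶠ v in 𝓝 u.1, (∃ hv : v ∈ chainSpace m,
      ((⟨v, hv⟩ : chainSpace m) : ConnectedComponents (chainSpace m)) = u) ∧
      ∀ i < 2 * m + 2, i ≠ j → 0 < bitSign (x i) * coord (chain v) i := by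
    refine (eventually_mem_component u).and
      ((Set.finite_lt_nat (2 * m + 2)).eventually_all.mpr fun i hi => ?_)
    by_cases hij : i = j
    · exact Filter.Eventually.of_forall fun v h => (h hij).elim
    · filter_upwards [(continuous_const.mul (continuous_coord i)).continuousAt.eventually
        (lt_mem_nhds (hu i hi hij))] with v hv _ using hv
  obtain ⟨ε, hε, hball⟩ := Metric.eventually_nhds_iff.mp ((tendsto_add_smul u.1 d).eventually hev)
  have hκ' : 0 < |κ| := abs_pos.mpr hκ
  -- The displacement has size `ε / 2`, and its sign is chosen so that its product with `κ` has the
  -- sign encoded by `b`.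
  obtain ⟨⟨hv, hvu⟩, hi⟩ := hball (y := bitSign b * (ε / 2) * (κ / |κ|)) (by
    have hb : |bitSign b| = 1 := by cases b <;> simp [bitSign]
    rw [Real.dist_0_eq_abs, abs_mul, abs_mul, hb, abs_of_pos (half_pos hε), abs_div, abs_abs,
      div_self hκ'.ne']
    linarith)
  refine ⟨⟨_, hv⟩, hvu, fun i hi' => ?_⟩
  by_cases hij : i = j
  · subst hij
    rw [if_pos rfl, hd, hu0]
    have : bitSign b * (0 + bitSign b * (ε / 2) * (κ / |κ|) * κ) =
        (bitSign b * bitSign b) * (ε / 2) * (κ * κ / |κ|) := by ring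
    rw [this, bitSign_mul_self]
    have := mul_self_pos.mpr hκ
    positivity
  · rw [if_neg hij]
    exact hi i hi' hij

end Chain

/-! ### Reconstruction of chains from their coordinates -/

section Rebuild

open Topology

variable {m : ℕ}

/-- The vector following `u` and `v` with last coordinate `p`, area `q` with `v`, and volume `c`
with `u` and `v`. -/
noncomputable def nextVector (u v : ℝ × ℝ × ℝ) (p q c : ℝ) : ℝ × ℝ × ℝ :=
  ((c - (u.1 * wedge v (0, (v.2.1 * p - q) / v.2.2, p) -
    v.1 * wedge u (0, (v.2.1 * p - q) / v.2.2, p))) / wedge u v, (v.2.1 * p - q) / v.2.2, p)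

theorem wedge_nextVector (u : ℝ × ℝ × ℝ) {v : ℝ × ℝ × ℝ} (p q c : ℝ) (hv : v.2.2 ≠ 0) :
    wedge v (nextVector u v p q c) = q := by
  simp only [wedge, nextVector]
  field_simp
  ring

theorem vol_nextVector {u v : ℝ × ℝ × ℝ} (p q c : ℝ) (huv : wedge u v ≠ 0) :
    vol u v (nextVector u v p q c) = c := by
  have h : ∀ a b : ℝ × ℝ × ℝ, wedge a b = wedge a (0, b.2) := fun a b => rfl
  rw [vol, h v, h u (nextVector u v p q c)]
  simp only [nextVector]
  rw [div_mul_cancel₀ _ huv]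
  ring

/-- Last coordinate, area and volume form a triangular linear system for `w`, with pivots `1`,
`v.2.2` and `wedge u v`. -/
theorem nextVector_eq {u v w : ℝ × ℝ × ℝ} (hv : v.2.2 ≠ 0) (huv : wedge u v ≠ 0) :
    nextVector u v w.2.2 (wedge v w) (vol u v w) = w := by
  have hβ : (v.2.1 * w.2.2 - wedge v w) / v.2.2 = w.2.1 := by
    rw [wedge]
    field_simp
    ring
  refine Prod.ext ?_ (Prod.ext ?_ rfl)
  · simp only [nextVector, hβ]
    rw [div_eq_iff huv]
    simp only [vol]
    have h : ∀ a : ℝ × ℝ × ℝ, wedge a w = wedge a (0, w.2.1, w.2.2) := fun a => rfl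
    rw [← h, ← h]
    ring
  · simpa only [nextVector] using hβ

/-- Consecutive pairs of the chain with given coordinates and volumes. -/
noncomputable def rebuildPair (B C : ℕ → ℝ) : ℕ → (ℝ × ℝ × ℝ) × (ℝ × ℝ × ℝ)
  | 0 => ((0, 1, 0), (0, 0, 1))
  | k + 1 => ((rebuildPair B C k).2, nextVector (rebuildPair B C k).1 (rebuildPair B C k).2
      (B (2 * k + 3)) (B (2 * k + 2)) (C k))

/-- The chain with given coordinates and volumes. -/
noncomputable def rebuild (B C : ℕ → ℝ) (k : ℕ) : ℝ × ℝ × ℝ := (rebuildPair B C k).1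

theorem rebuild_add_two (B C : ℕ → ℝ) (k : ℕ) :
    rebuild B C (k + 2) = nextVector (rebuild B C k) (rebuild B C (k + 1)) (B (2 * k + 3))
      (B (2 * k + 2)) (C k) := rfl

theorem coord_rebuild_odd {B : ℕ → ℝ} (C : ℕ → ℝ) (h1 : B 1 = 1) (k : ℕ) :
    coord (rebuild B C) (2 * k + 1) = B (2 * k + 1) := by
  rw [coord_odd]
  match k with
  | 0 => exact h1.symm
  | k + 1 => rfl

/-- Prescribing an area divides only by the preceding last coordinate. A vanishing area affects only
the later control of a volume, which matters at the walls. For `k = 0` the truncated index is `0`.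
-/
theorem coord_rebuild_even {B : ℕ → ℝ} (C : ℕ → ℝ) (h0 : B 0 = 1) (h1 : B 1 = 1) (k : ℕ)
    (h : B (2 * k - 1) ≠ 0) : coord (rebuild B C) (2 * k) = B (2 * k) := by
  rw [coord_even]
  match k with
  | 0 => simp [rebuild, rebuildPair, wedge, h0]
  | k + 1 =>
    rw [rebuild_add_two]
    refine wedge_nextVector _ _ _ _ ?_
    rw [← coord_odd, coord_rebuild_odd C h1]
    exact h

theorem vol_rebuild {B C : ℕ → ℝ} {k : ℕ} (h : coord (rebuild B C) (2 * k) ≠ 0) :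
    vol (rebuild B C k) (rebuild B C (k + 1)) (rebuild B C (k + 2)) = C k := by
  rw [coord_even] at h
  exact vol_nextVector _ _ _ h

/-- The noninitial vectors of the chain with given coordinates and volumes. -/
noncomputable def rebuildChain (m : ℕ) (B C : ℕ → ℝ) : Fin m → ℝ × ℝ × ℝ :=
  fun i => rebuild B C (i + 2)

theorem chain_rebuildChain (B C : ℕ → ℝ) {k : ℕ} (hk : k < m + 2) :
    chain (rebuildChain m B C) k = rebuild B C k := by
  match k with
  | 0 => rfl
  | 1 => rfl
  | k + 2 => simp [chain, rebuildChain, show k < m by omega]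

theorem coord_rebuildChain (B C : ℕ → ℝ) {j : ℕ} (hj : j < 2 * m + 2) :
    coord (chain (rebuildChain m B C)) j = coord (rebuild B C) j := by
  unfold coord
  rw [chain_rebuildChain _ _ (by omega), chain_rebuildChain _ _ (by omega)]

theorem rebuildChain_eq {u : Fin m → ℝ × ℝ × ℝ} {B C : ℕ → ℝ}
    (h0 : ∀ j < 2 * m + 2, coord (chain u) j ≠ 0)
    (hB : ∀ j < 2 * m + 2, B j = coord (chain u) j)
    (hC : ∀ k < m, C k = vol (chain u k) (chain u (k + 1)) (chain u (k + 2))) :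
    rebuildChain m B C = u := by
  have key : ∀ k ≤ m, rebuild B C k = chain u k ∧ rebuild B C (k + 1) = chain u (k + 1) := by
    intro k
    induction k with
    | zero => exact fun _ => ⟨rfl, rfl⟩
    | succ k ih =>
      intro hk
      obtain ⟨ih1, ih2⟩ := ih (by omega)
      refine ⟨ih2, ?_⟩
      have hp := h0 (2 * k + 1) (by omega)
      have hq := h0 (2 * k) (by omega)
      rw [coord_odd] at hp
      rw [coord_even] at hq
      rw [rebuild_add_two, ih1, ih2, hB _ (by omega), hB _ (by omega), hC k (by omega),
        show 2 * k + 3 = 2 * (k + 1) + 1 by ring, show 2 * k + 2 = 2 * (k + 1) by ring,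
        coord_odd, coord_even]
      exact nextVector_eq hp hq
  funext i
  have := (key (i + 1) i.2).2
  rw [rebuildChain, this]
  simp [chain]

/-- Admissible coordinates and volumes with given signs. -/
def signDomain (x : ℕ → Bool) : Set ((ℕ → ℝ) × (ℕ → ℝ)) :=
  {p | p.1 0 = 1 ∧ p.1 1 = 1 ∧ (∀ j, 0 < bitSign (x j) * p.1 j) ∧ ∀ k, 0 < p.2 k}

theorem convex_signDomain (x : ℕ → Bool) : Convex ℝ (signDomain x) := by
  have h1 : ∀ j, IsLinearMap ℝ fun p : (ℕ → ℝ) × (ℕ → ℝ) => p.1 j :=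
    fun j => ⟨fun p q => rfl, fun c p => rfl⟩
  have h2 : ∀ j, IsLinearMap ℝ fun p : (ℕ → ℝ) × (ℕ → ℝ) => p.2 j :=
    fun j => ⟨fun p q => rfl, fun c p => rfl⟩
  have h3 : ∀ j, IsLinearMap ℝ fun p : (ℕ → ℝ) × (ℕ → ℝ) => bitSign (x j) * p.1 j :=
    fun j => ⟨fun p q => mul_add _ _ _, fun c p => mul_left_comm _ _ _⟩
  have heq : signDomain x = {p | p.1 0 = 1} ∩ ({p | p.1 1 = 1} ∩
      ((⋂ j, {p | 0 < bitSign (x j) * p.1 j}) ∩ ⋂ k, {p | 0 < p.2 k})) := by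
    ext p
    simp [signDomain]
  rw [heq]
  exact (convex_hyperplane (h1 0) _).inter ((convex_hyperplane (h1 1) _).inter
    ((convex_iInter fun j => convex_halfSpace_gt (h3 j) _).inter
    (convex_iInter fun j => convex_halfSpace_gt (h2 j) _)))

theorem coord_rebuild {x : ℕ → Bool} {p : (ℕ → ℝ) × (ℕ → ℝ)} (hp : p ∈ signDomain x) (j : ℕ) :
    coord (rebuild p.1 p.2) j = p.1 j := by
  obtain ⟨h0, h1, h2, -⟩ := hp
  rcases Nat.even_or_odd' j with ⟨k, rfl | rfl⟩
  · exact coord_rebuild_even _ h0 h1 k (right_ne_zero_of_mul (h2 _).ne')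
  · exact coord_rebuild_odd _ h1 k

theorem continuous_nextVector {X : Type*} [TopologicalSpace X] {u v : X → ℝ × ℝ × ℝ}
    {p q c : X → ℝ} (hu : Continuous u) (hv : Continuous v) (hp : Continuous p)
    (hq : Continuous q) (hc : Continuous c) (hv0 : ∀ x, (v x).2.2 ≠ 0)
    (huv : ∀ x, wedge (u x) (v x) ≠ 0) :
    Continuous fun x => nextVector (u x) (v x) (p x) (q x) (c x) := by
  have hβ : Continuous fun x => ((v x).2.1 * p x - q x) / (v x).2.2 :=
    Continuous.div (by fun_prop) (by fun_prop) hv0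
  have hw : Continuous fun x => ((0 : ℝ), ((v x).2.1 * p x - q x) / (v x).2.2, p x) :=
    continuous_const.prodMk (hβ.prodMk hp)
  have h1 := hv.wedge hw
  have h2 := hu.wedge hw
  exact (Continuous.div (by fun_prop) (hu.wedge hv) huv).prodMk (hβ.prodMk hp)

theorem continuous_rebuildPair (x : ℕ → Bool) (k : ℕ) :
    Continuous fun p : signDomain x => rebuildPair p.1.1 p.1.2 k := by
  induction k with
  | zero => exact continuous_const
  | succ k ih =>
    have hB : ∀ j, Continuous fun p : signDomain x => p.1.1 j := fun j =>
      (continuous_apply j).comp (continuous_fst.comp continuous_subtype_val)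
    have hC : ∀ j, Continuous fun p : signDomain x => p.1.2 j := fun j =>
      (continuous_apply j).comp (continuous_snd.comp continuous_subtype_val)
    refine (continuous_snd.comp ih).prodMk (continuous_nextVector (continuous_fst.comp ih)
      (continuous_snd.comp ih) (hB _) (hB _) (hC _) (fun p => ?_) fun p => ?_)
    · have := coord_rebuild p.2 (2 * k + 1)
      rw [coord_odd] at this
      exact this.trans_ne (right_ne_zero_of_mul (p.2.2.2.1 _).ne')
    · have := coord_rebuild p.2 (2 * k)
      rw [coord_even] at this
      exact this.trans_ne (right_ne_zero_of_mul (p.2.2.2.1 _).ne')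

theorem continuous_rebuildChain (x : ℕ → Bool) :
    Continuous fun p : signDomain x => rebuildChain m p.1.1 p.1.2 :=
  continuous_pi fun _ => continuous_fst.comp (continuous_rebuildPair x _)

theorem hasSigns_rebuildChain {x : ℕ → Bool} {p : (ℕ → ℝ) × (ℕ → ℝ)} (hp : p ∈ signDomain x) :
    HasSigns x (rebuildChain m p.1 p.2) := fun j hj => by
  rw [coord_rebuildChain _ _ hj, coord_rebuild hp]
  exact hp.2.2.1 j

theorem rebuildChain_mem {x : ℕ → Bool} {p : (ℕ → ℝ) × (ℕ → ℝ)} (hp : p ∈ signDomain x) :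
    rebuildChain m p.1 p.2 ∈ chainSpace m := by
  refine mem_chainSpace_of_hasSigns (hasSigns_rebuildChain hp) fun k hk => ?_
  rw [chain_rebuildChain _ _ (by omega), chain_rebuildChain _ _ (by omega),
    chain_rebuildChain _ _ (by omega), vol_rebuild]
  · exact hp.2.2.2 k
  · rw [coord_rebuild hp]
    exact right_ne_zero_of_mul (hp.2.2.1 _).ne'

theorem exists_chain_hasSigns (m : ℕ) {x : ℕ → Bool} (h0 : x 0 = false) (h1 : x 1 = false) :
    ∃ u : chainSpace m, HasSigns x u.1 := by
  have hp : ((fun j => bitSign (x j), fun _ => 1) : (ℕ → ℝ) × (ℕ → ℝ)) ∈ signDomain x :=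
    ⟨by simp [h0, bitSign], by simp [h1, bitSign],
      fun j => by simp only [bitSign_mul_self]; exact one_pos, fun _ => one_pos⟩
  exact ⟨⟨_, rebuildChain_mem hp⟩, hasSigns_rebuildChain hp⟩

theorem exists_rebuildChain_eq {x : ℕ → Bool} {u : Fin m → ℝ × ℝ × ℝ} (hu : u ∈ chainSpace m)
    (hx : HasSigns x u) : ∃ p ∈ signDomain x, rebuildChain m p.1 p.2 = u := by
  -- The domain consists of infinite sequences, so the finite data are padded with admissible
  -- values.
  refine ⟨(fun j => if j < 2 * m + 2 then coord (chain u) j else bitSign (x j),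
    fun k => if k < m then vol (chain u k) (chain u (k + 1)) (chain u (k + 2)) else 1),
    ⟨?_, ?_, fun j => ?_, fun k => ?_⟩, rebuildChain_eq (fun j hj => ?_) (fun j hj => ?_)
    fun k hk => ?_⟩
  · simp [coord_chain_zero]
  · simp [coord_chain_one]
  · dsimp only
    split_ifs with hj
    · exact hx j hj
    · rw [bitSign_mul_self]
      exact one_pos
  · dsimp only
    split_ifs with hk
    · exact hu.1 k hk
    · exact one_pos
  · exact right_ne_zero_of_mul (hx j hj).ne'
  · exact if_pos hj
  · exact if_pos hk

/-- Chains with the same signs lie in the same component. -/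
theorem coe_eq_of_hasSigns {x : ℕ → Bool} {u v : chainSpace m} (hu : HasSigns x u.1)
    (hv : HasSigns x v.1) : (u : ConnectedComponents (chainSpace m)) = v := by
  have := Subtype.preconnectedSpace (convex_signDomain x).isPreconnected
  have hc : Continuous fun p : signDomain x =>
      (⟨rebuildChain m p.1.1 p.1.2, rebuildChain_mem p.2⟩ : chainSpace m) :=
    (continuous_rebuildChain x).subtype_mk _
  obtain ⟨p, hp, hpu⟩ := exists_rebuildChain_eq u.2 hu
  obtain ⟨q, hq, hqv⟩ := exists_rebuildChain_eq v.2 hv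
  exact (isPreconnected_range hc).coe_eq_coe ⟨⟨p, hp⟩, Subtype.ext hpu⟩
    ⟨⟨q, hq⟩, Subtype.ext hqv⟩

/-! ### Wall crossing -/

theorem bitSign_prod_of_parity {x : ℕ → Bool} {j : ℕ} (h : BitGame.parity x j = true) :
    bitSign (x (j - 2)) * bitSign (x (j - 1)) * bitSign (x (j + 1)) * bitSign (x (j + 2)) =
      -1 := by
  unfold BitGame.parity at h
  revert h
  cases x (j - 2) <;> cases x (j - 1) <;> cases x (j + 1) <;> cases x (j + 2) <;>
    simp [bitSign]

/-- The source of the parity rule at a vanishing last coordinate: if the four neighbours `a₃`, `a ∧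
b`, `b ∧ c`, `c₃` are nonzero, their product is negative. -/
theorem wedge_mul_of_eq_zero {a b c : ℝ × ℝ × ℝ} (hb : b.2.2 = 0) :
    wedge b c * a.2.2 = -(wedge a b * c.2.2) := by
  simp only [wedge, hb]
  ring

/-- The parity rule at a vanishing area: when both volumes are positive and the four neighbours `a ∧
b`, `b₃`, `c₃`, `c ∧ d` are nonzero, their product is negative. -/
theorem vol_mul_of_wedge_eq_zero {a b c d : ℝ × ℝ × ℝ} (h : wedge b c = 0) :
    vol b c d * (wedge a b * c.2.2) = -(vol a b c * (wedge c d * b.2.2)) := by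
  simp only [vol, h]
  simp only [wedge] at h ⊢
  linear_combination (-(b.1 * (c.2.1 * d.2.2 - c.2.2 * d.2.1) * a.2.2) -
    c.1 * (a.2.1 * b.2.2 - a.2.2 * b.2.1) * d.2.2) * h

/-- If a flip is possible, there is a chain at the wall between the two sign patterns. -/
theorem exists_wall {x : ℕ → Bool} (h0 : x 0 = false) (h1 : x 1 = false) {j : ℕ} (hj : 2 ≤ j)
    (hjm : j + 2 < 2 * m + 2) (hp : BitGame.parity x j = true) :
    ∃ u : chainSpace m, coord (chain u.1) j = 0 ∧
      ∀ i < 2 * m + 2, i ≠ j → 0 < bitSign (x i) * coord (chain u.1) i := by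
  set B : ℕ → ℝ := fun i => if i = j then 0 else bitSign (x i) with hB
  set C : ℕ → ℝ := fun _ => 1 with hC
  have hB0 : B 0 = 1 := by simp [hB, h0, bitSign, show 0 ≠ j by omega]
  have hB1 : B 1 = 1 := by simp [hB, h1, bitSign, show 1 ≠ j by omega]
  have hBj : B j = 0 := if_pos rfl
  have hBi : ∀ i, i ≠ j → B i = bitSign (x i) := fun i hi => if_neg hi
  have hBne : ∀ i, i ≠ j → B i ≠ 0 := fun i hi => by
    rw [hBi i hi]
    exact bitSign_ne_zero _
  have hsq : ∀ i, bitSign (x i) * bitSign (x i) = 1 := fun i => bitSign_mul_self _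
  have hprod := bitSign_prod_of_parity hp
  suffices H : coord (rebuild B C) j = 0 ∧
      (∀ i < 2 * m + 2, i ≠ j → 0 < bitSign (x i) * coord (rebuild B C) i) ∧
      ∀ k < m, 0 < vol (rebuild B C k) (rebuild B C (k + 1)) (rebuild B C (k + 2)) by
    obtain ⟨H1, H2, H3⟩ := H
    refine ⟨⟨rebuildChain m B C, fun k hk => ?_, ?_, ?_⟩, ?_, fun i hi hij => ?_⟩
    · rw [chain_rebuildChain _ _ (by omega), chain_rebuildChain _ _ (by omega),
        chain_rebuildChain _ _ (by omega)]
      exact H3 k hk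
    · rw [← coord_even, coord_rebuildChain _ _ (by omega)]
      exact right_ne_zero_of_mul (H2 (2 * m) (by omega) (by omega)).ne'
    · rw [← coord_odd, coord_rebuildChain _ _ (by omega)]
      exact right_ne_zero_of_mul (H2 (2 * m + 1) (by omega) (by omega)).ne'
    · rw [coord_rebuildChain _ _ (by omega), H1]
    · rw [coord_rebuildChain _ _ hi]
      exact H2 i hi hij
  rcases Nat.even_or_odd' j with ⟨k, rfl | rfl⟩
  · obtain ⟨k, rfl⟩ := Nat.exists_eq_add_of_le' (show 1 ≤ k by omega)
    have hcoord : ∀ i, coord (rebuild B C) i = B i := fun i => by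
      rcases Nat.even_or_odd' i with ⟨l, rfl | rfl⟩
      · exact coord_rebuild_even _ hB0 hB1 l (hBne _ (by omega))
      · exact coord_rebuild_odd _ hB1 l
    have hvol : ∀ l, l ≠ k + 1 →
        vol (rebuild B C l) (rebuild B C (l + 1)) (rebuild B C (l + 2)) = 1 := fun l hl =>
      vol_rebuild (by rw [hcoord]; exact hBne _ (by omega))
    refine ⟨(hcoord _).trans hBj, fun i hi hij => ?_, fun l hl => ?_⟩
    · rw [hcoord, hBi i hij, hsq]
      exact one_pos
    · by_cases hlk : l = k + 1
      · subst hlk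
        have hid := vol_mul_of_wedge_eq_zero (a := rebuild B C k) (d := rebuild B C (k + 1 + 2))
          ((coord_even (rebuild B C) (k + 1)).symm.trans ((hcoord _).trans hBj))
        rw [show k + 1 + 1 = k + 2 by ring, hvol k (by omega), ← coord_even,
          show rebuild B C (k + 1 + 2) = rebuild B C (k + 2 + 1) by rfl, ← coord_even,
          ← coord_odd, ← coord_odd, hcoord, hcoord, hcoord, hcoord, hBi _ (by omega),
          hBi _ (by omega), hBi _ (by omega), hBi _ (by omega)] at hid
        rw [show 2 * (k + 1) - 2 = 2 * k by omega, show 2 * (k + 1) - 1 = 2 * k + 1 by omega,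
          show 2 * (k + 1) + 2 = 2 * (k + 2) by ring] at hprod
        change 0 < vol (rebuild B C (k + 1)) (rebuild B C (k + 2)) (rebuild B C (k + 2 + 1))
        have e1 := hsq (2 * k)
        have e2 := hsq (2 * (k + 1) + 1)
        have : vol (rebuild B C (k + 1)) (rebuild B C (k + 2)) (rebuild B C (k + 2 + 1)) = 1 := by
          linear_combination (bitSign (x (2 * k)) * bitSign (x (2 * (k + 1) + 1))) * hid -
            hprod - (vol (rebuild B C (k + 1)) (rebuild B C (k + 2)) (rebuild B C (k + 2 + 1)) *
              bitSign (x (2 * (k + 1) + 1)) ^ 2) * e1 -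
            vol (rebuild B C (k + 1)) (rebuild B C (k + 2)) (rebuild B C (k + 2 + 1)) * e2
        rw [this]
        exact one_pos
      · rw [hvol l hlk]
        exact one_pos
  · obtain ⟨k, rfl⟩ := Nat.exists_eq_add_of_le' (show 1 ≤ k by omega)
    -- Here the recursion divides by the vanishing last coordinate, so only the next area is
    -- uncontrolled. The wall relation and the odd parity give it the right sign (`hspecial`).
    have hcoord : ∀ i, i ≠ 2 * (k + 2) → coord (rebuild B C) i = B i := fun i hi => by
      rcases Nat.even_or_odd' i with ⟨l, rfl | rfl⟩
      · exact coord_rebuild_even _ hB0 hB1 l (hBne _ (by omega))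
      · exact coord_rebuild_odd _ hB1 l
    have hid := wedge_mul_of_eq_zero (a := rebuild B C (k + 1)) (b := rebuild B C (k + 2))
      (c := rebuild B C (k + 3)) ((coord_odd (rebuild B C) (k + 1)).symm.trans
        ((hcoord _ (by omega)).trans hBj))
    rw [show rebuild B C (k + 3) = rebuild B C (k + 2 + 1) by rfl, ← coord_even, ← coord_odd,
      show rebuild B C (k + 2) = rebuild B C (k + 1 + 1) by rfl, ← coord_even,
      ← coord_odd, hcoord (2 * k + 1) (by omega), hcoord (2 * (k + 1)) (by omega),
      hcoord (2 * (k + 2) + 1) (by omega), hBi _ (by omega), hBi _ (by omega),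
      hBi _ (by omega)] at hid
    rw [show 2 * (k + 1) + 1 - 2 = 2 * k + 1 by omega,
      show 2 * (k + 1) + 1 - 1 = 2 * (k + 1) by omega,
      show 2 * (k + 1) + 1 + 1 = 2 * (k + 2) by ring,
      show 2 * (k + 1) + 1 + 2 = 2 * (k + 2) + 1 by ring] at hprod
    have e1 := hsq (2 * k + 1)
    have hspecial : bitSign (x (2 * (k + 2))) * coord (rebuild B C) (2 * (k + 2)) = 1 := by
      linear_combination (bitSign (x (2 * (k + 2))) * bitSign (x (2 * k + 1))) * hid - hprod -
        (bitSign (x (2 * (k + 2))) * coord (rebuild B C) (2 * (k + 2))) * e1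
    have hpos : ∀ i, i ≠ 2 * (k + 1) + 1 → 0 < bitSign (x i) * coord (rebuild B C) i := by
      intro i hij
      by_cases hi : i = 2 * (k + 2)
      · rw [hi, hspecial]
        exact one_pos
      · rw [hcoord i hi, hBi i hij, hsq]
        exact one_pos
    refine ⟨(hcoord _ (by omega)).trans hBj, fun i _ hij => hpos i hij, fun l _ => ?_⟩
    rw [vol_rebuild (right_ne_zero_of_mul (hpos (2 * l) (by omega)).ne')]
    exact one_pos

/-- A chain on the wall has chains with either sign pattern in its component, and each pattern lies
in a single component. -/
theorem coe_eq_of_flip {x : ℕ → Bool} {j : ℕ} (hj : 2 ≤ j) (hjm : j + 2 < 2 * m + 2)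
    (hp : BitGame.parity x j = true) {u v : chainSpace m} (hu : HasSigns x u.1)
    (hv : HasSigns (BitGame.flip x j) v.1) : (u : ConnectedComponents (chainSpace m)) = v := by
  obtain ⟨h0, h1⟩ := hu.zero_one
  obtain ⟨w, hw, hwi⟩ := exists_wall h0 h1 hj hjm hp
  obtain ⟨u', hu', hu's⟩ := exists_hasSigns_flip hj (by omega) w hw hwi (x j)
  obtain ⟨v', hv', hv's⟩ := exists_hasSigns_flip hj (by omega) w hw hwi (!x j)
  have h1 : (u : ConnectedComponents (chainSpace m)) = u' := coe_eq_of_hasSigns hu fun i hi => by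
    have := hu's i hi
    split_ifs at this with hij
    · subst hij
      exact this
    · exact this
  have h2 : (v : ConnectedComponents (chainSpace m)) = v' := coe_eq_of_hasSigns hv fun i hi => by
    have := hv's i hi
    split_ifs at this with hij
    · subst hij
      rwa [BitGame.flip_self]
    · rwa [BitGame.flip_ne hij]
  rw [h1, h2, hu', hv']

theorem coe_eq_of_equiv {x y : ℕ → Bool} (h : BitGame.Equiv (2 * m + 2) x y) :
    ∀ {u v : chainSpace m}, HasSigns x u.1 → HasSigns y v.1 →
      (u : ConnectedComponents (chainSpace m)) = v := by
  induction h with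
  | rel x y h =>
    intro u v hu hv
    rcases h with h | ⟨j, hj, hjm, hp, rfl⟩
    · exact coe_eq_of_hasSigns (hu.congr h) hv
    · exact coe_eq_of_flip hj hjm hp hu hv
  | refl x => exact fun hu hv => coe_eq_of_hasSigns hu hv
  | symm x y _ ih => exact fun hu hv => (ih hv hu).symm
  | trans x y z hxy _ ih ih' =>
    intro u v hu hv
    obtain ⟨h0, h1⟩ := hu.zero_one
    obtain ⟨h0', h1'⟩ := BitGame.Equiv.zero_one (by omega) hxy
    -- Moves preserve the two leading zeros, so the intermediate pattern is realized by a chain.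
    obtain ⟨w, hw⟩ := exists_chain_hasSigns m (h0'.symm.trans h0) (h1'.symm.trans h1)
    exact (ih hu hw).trans (ih' hw hv)

/-- There are at most twelve components. -/
theorem exists_component_reps (hm : 4 ≤ m) :
    ∃ r : (Bool × Bool) ⊕ Fin 8 → chainSpace m,
      ∀ u : chainSpace m, ∃ i, (u : ConnectedComponents (chainSpace m)) = r i := by
  obtain ⟨rep, hrep, h⟩ := BitGame.exists_reps (M := 2 * m + 2) (by omega)
  choose r hr using fun i => exists_chain_hasSigns m (hrep i).1 (hrep i).2
  refine ⟨r, fun u => ?_⟩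
  obtain ⟨x, v, hx, huv⟩ := exists_hasSigns u
  obtain ⟨h0, h1⟩ := hx.zero_one
  obtain ⟨i, hi⟩ := h x h0 h1
  exact ⟨i, huv.trans (coe_eq_of_equiv hi hx (hr i))⟩

end Rebuild

/-! ### Convex chains -/

section Convex

open Topology

/-- The three-term Plücker relation of `a`, `b`, `c` and `e₂` in the last two coordinates. -/
theorem wedge_mul_third (a b c : ℝ × ℝ × ℝ) :
    wedge a c * b.2.2 = wedge a b * c.2.2 + a.2.2 * wedge b c := by
  simp only [wedge]
  ring

/-- In a chain all of whose areas are nonnegative, consecutive areas and the last coordinates are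
positive. -/
theorem wedge_pos_of_nonneg {m : ℕ} {s : ℕ → ℝ × ℝ × ℝ} (h0 : s 0 = (0, 1, 0))
    (h1 : s 1 = (0, 0, 1)) (hvol : ∀ k < m, 0 < vol (s k) (s (k + 1)) (s (k + 2)))
    (hq : wedge (s m) (s (m + 1)) ≠ 0) (hp : (s (m + 1)).2.2 ≠ 0)
    (hnn : ∀ i j, i < j → j ≤ m + 1 → 0 ≤ wedge (s i) (s j)) :
    ∀ k ≤ m, 0 < wedge (s k) (s (k + 1)) ∧ 0 < (s (k + 1)).2.2 := by
  have hw0 : ∀ j, wedge (s 0) (s j) = (s j).2.2 := fun j => by simp [h0, wedge]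
  have hw1 : ∀ j, wedge (s 1) (s j) = -(s j).2.1 := fun j => by simp [h1, wedge]
  have hpnn : ∀ k ≤ m, 0 ≤ (s (k + 1)).2.2 := fun k hk => by
    rw [← hw0]
    exact hnn 0 (k + 1) (by omega) (by omega)
  have hplast : 0 < (s (m + 1)).2.2 := lt_of_le_of_ne (hpnn m le_rfl) hp.symm
  -- If an interior vector projected to zero, the volume in which it is the middle vector would make
  -- its first coordinate negative, and the one in which it is the first vector would make it
  -- positive.
  have hne : ∀ k ≤ m, ¬((s (k + 1)).2.1 = 0 ∧ (s (k + 1)).2.2 = 0) := by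
    rintro k hk ⟨hb, hc⟩
    rcases Nat.lt_or_ge (k + 1) m with hkm | hkm
    · have hz : ∀ x, wedge (s (k + 1)) x = 0 := fun x => by simp [wedge, hb, hc]
      have hz' : ∀ x, wedge x (s (k + 1)) = 0 := fun x => by simp [wedge, hb, hc]
      have hv1 := hvol k (by omega)
      have hv2 := hvol (k + 1) hkm
      rw [vol, hz, hz'] at hv1
      rw [vol, hz, hz] at hv2
      have n1 := hnn k (k + 2) (by omega) (by omega)
      have n2 := hnn (k + 1 + 1) (k + 1 + 2) (by omega) (by omega)
      have hpos : 0 < (s (k + 1)).1 := by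
        by_contra hcon
        nlinarith
      nlinarith
    · rcases Nat.lt_or_ge k m with hkm' | hkm'
      · have : m = k + 1 := by omega
        subst this
        exact hq (by simp [wedge, hb, hc])
      · have : m = k := by omega
        subst this
        exact hp hc
  -- If a last coordinate vanished, the areas with `s 1` and with `s (m + 1)` would force the second
  -- coordinate to vanish too.
  have hppos : ∀ k ≤ m, 0 < (s (k + 1)).2.2 := by
    intro k hk
    refine lt_of_le_of_ne (hpnn k hk) fun h => ?_
    rcases Nat.eq_zero_or_pos k with rfl | hk0
    · simp [h1] at h
    · have hkm : k ≠ m := by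
        rintro rfl
        exact hp h.symm
      have n1 := hnn (k + 1) (m + 1) (by omega) le_rfl
      have n2 := hnn 1 (k + 1) (by omega) (by omega)
      rw [hw1] at n2
      rw [wedge, ← h, zero_mul, sub_zero] at n1
      have := nonneg_of_mul_nonneg_left n1 hplast
      exact hne k hk ⟨by linarith, h.symm⟩
  refine fun k hk => ⟨lt_of_le_of_ne (hnn k (k + 1) (by omega) (by omega)) fun h => ?_,
    hppos k hk⟩
  rcases Nat.eq_zero_or_pos k with rfl | hk0
  · simp [h0, h1, wedge] at h
  · obtain ⟨k, rfl⟩ := Nat.exists_eq_add_of_le' hk0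
    have hkm : k + 1 ≠ m := by
      rintro rfl
      exact hq h.symm
    -- At a vanishing area the two sides of the wall relation have opposite weak signs, so both are
    -- zero. Then all areas among `s k`, `s (k + 1)`, `s (k + 2)` vanish, and so does their volume.
    have hid := vol_mul_of_wedge_eq_zero (a := s k) (d := s (k + 3)) h.symm
    have v1 := hvol k (by omega)
    have v2 : 0 < vol (s (k + 1)) (s (k + 1 + 1)) (s (k + 3)) := hvol (k + 1) (by omega)
    have n1 := hnn k (k + 1) (by omega) (by omega)
    have n2 := hnn (k + 1 + 1) (k + 3) (by omega) (by omega)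
    have p1 := hppos k (by omega)
    have p2 := hppos (k + 1) hk
    have hab : wedge (s k) (s (k + 1)) = 0 := by
      have r1 := mul_nonneg v1.le (mul_nonneg n2 p1.le)
      have r2 := mul_nonneg v2.le (mul_nonneg n1 p2.le)
      have r3 : vol (s (k + 1)) (s (k + 1 + 1)) (s (k + 3)) *
          (wedge (s k) (s (k + 1)) * (s (k + 1 + 1)).2.2) = 0 := by linarith
      rcases mul_eq_zero.mp r3 with r | r
      · exact absurd r v2.ne'
      · exact (mul_eq_zero.mp r).resolve_right p2.ne'
    have hac : wedge (s k) (s (k + 1 + 1)) = 0 := by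
      have := wedge_mul_third (s k) (s (k + 1)) (s (k + 1 + 1))
      rw [hab, ← h, zero_mul, mul_zero, add_zero] at this
      exact (mul_eq_zero.mp this).resolve_right p1.ne'
    change 0 < vol (s k) (s (k + 1)) (s (k + 1 + 1)) at v1
    rw [vol, hab, ← h, hac] at v1
    simp at v1

/-- If consecutive areas and the last coordinates are positive, then all areas are nonnegative. -/
theorem wedge_nonneg_of_pos {m : ℕ} {s : ℕ → ℝ × ℝ × ℝ} (h0 : s 0 = (0, 1, 0))
    (h : ∀ k ≤ m, 0 < wedge (s k) (s (k + 1)) ∧ 0 < (s (k + 1)).2.2) :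
    ∀ i j, i < j → j ≤ m + 1 → 0 ≤ wedge (s i) (s j) := by
  intro i j hij
  induction j, (show i + 1 ≤ j from hij) using Nat.le_induction with
  | base => exact fun hj => (h i (by omega)).1.le
  | succ j hj ih =>
    intro hjm
    have ih := ih hj (by omega)
    obtain ⟨l, rfl⟩ := Nat.exists_eq_add_of_le' (show 1 ≤ j by omega)
    -- The Plücker relation with the last vector reached in the middle extends nonnegativity by one
    -- index, after division by its positive last coordinate.
    have hid := wedge_mul_third (s i) (s (l + 1)) (s (l + 1 + 1))
    have hi : 0 ≤ (s i).2.2 := by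
      match i with
      | 0 => simp [h0]
      | i + 1 => exact (h i (by omega)).2.le
    have q := (h (l + 1) (by omega)).1
    have p1 := (h l (by omega)).2
    have p2 := (h (l + 1) (by omega)).2
    refine nonneg_of_mul_nonneg_left ?_ p1
    rw [hid]
    exact add_nonneg (mul_nonneg ih p2.le) (mul_nonneg hi q.le)

/-- Signs of period three with product one. -/
def periodicSign (b : Bool × Bool) (i : ℕ) : ℝ :=
  if i % 3 = 0 then bitSign b.1 else if i % 3 = 1 then bitSign b.2
  else bitSign b.1 * bitSign b.2

theorem periodicSign_mul_self (b : Bool × Bool) (i : ℕ) :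
    periodicSign b i * periodicSign b i = 1 := by
  unfold periodicSign
  split_ifs
  · exact bitSign_mul_self _
  · exact bitSign_mul_self _
  · rw [mul_mul_mul_comm, bitSign_mul_self, bitSign_mul_self, one_mul]

theorem periodicSign_prod (b : Bool × Bool) (i : ℕ) :
    periodicSign b i * periodicSign b (i + 1) * periodicSign b (i + 2) = 1 := by
  have h1 := bitSign_mul_self b.1
  have h2 := bitSign_mul_self b.2
  have h : i % 3 = 0 ∨ i % 3 = 1 ∨ i % 3 = 2 := by omega
  rcases h with h | h | h
  · simp only [periodicSign, h, show (i + 1) % 3 = 1 by omega, show (i + 2) % 3 = 2 by omega]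
    norm_num
    linear_combination h1 * bitSign b.2 ^ 2 + h2
  · simp only [periodicSign, h, show (i + 1) % 3 = 2 by omega, show (i + 2) % 3 = 0 by omega]
    norm_num
    linear_combination h1 * bitSign b.2 ^ 2 + h2
  · simp only [periodicSign, h, show (i + 1) % 3 = 0 by omega, show (i + 2) % 3 = 1 by omega]
    norm_num
    linear_combination h1 * bitSign b.2 ^ 2 + h2

/-- Change the signs of the vectors and of the coordinates. -/
def twist (b : Bool × Bool) (s : ℕ → ℝ × ℝ × ℝ) (k : ℕ) : ℝ × ℝ × ℝ :=
  periodicSign b (k + 1) • (periodicSign b 0 * (s k).1, periodicSign b 1 * (s k).2.1,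
    periodicSign b 2 * (s k).2.2)

theorem wedge_twist (b : Bool × Bool) (s : ℕ → ℝ × ℝ × ℝ) (i j : ℕ) :
    wedge (twist b s i) (twist b s j) = periodicSign b (i + 1) * periodicSign b (j + 1) *
      (periodicSign b 1 * periodicSign b 2) * wedge (s i) (s j) := by
  simp only [wedge, twist, Prod.smul_mk, smul_eq_mul]
  ring

theorem third_twist (b : Bool × Bool) (s : ℕ → ℝ × ℝ × ℝ) (k : ℕ) :
    (twist b s k).2.2 = periodicSign b (k + 1) * periodicSign b 2 * (s k).2.2 := by
  simp only [twist, Prod.smul_mk, smul_eq_mul]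
  ring

/-- The signs of three consecutive vectors have product one, and so do the signs of the three
coordinates. -/
theorem vol_twist (b : Bool × Bool) (s : ℕ → ℝ × ℝ × ℝ) (k : ℕ) :
    vol (twist b s k) (twist b s (k + 1)) (twist b s (k + 2)) =
      vol (s k) (s (k + 1)) (s (k + 2)) := by
  have h1 := periodicSign_prod b (k + 1)
  have h2 := periodicSign_prod b 0
  simp only [vol, wedge_twist]
  simp only [twist, Prod.smul_mk, smul_eq_mul]
  rw [show k + 1 + 2 = k + 2 + 1 by ring] at h1
  rw [show 0 + 1 = 1 by ring, show 0 + 2 = 2 by ring] at h2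
  linear_combination ((s k).1 * wedge (s (k + 1)) (s (k + 2)) -
    (s (k + 1)).1 * wedge (s k) (s (k + 2)) + (s (k + 2)).1 * wedge (s k) (s (k + 1))) *
    (h1 * (periodicSign b 0 * periodicSign b 1 * periodicSign b 2) + h2)

theorem twist_twist (b : Bool × Bool) (s : ℕ → ℝ × ℝ × ℝ) (k : ℕ) :
    twist b (twist b s) k = s k := by
  have h := periodicSign_mul_self b (k + 1)
  have h0 := periodicSign_mul_self b 0
  have h1 := periodicSign_mul_self b 1
  have h2 := periodicSign_mul_self b 2
  refine Prod.ext ?_ (Prod.ext ?_ ?_)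
  · simp only [twist, Prod.smul_mk, smul_eq_mul]
    linear_combination (s k).1 * (h * periodicSign b 0 ^ 2 + h0)
  · simp only [twist, Prod.smul_mk, smul_eq_mul]
    linear_combination (s k).2.1 * (h * periodicSign b 1 ^ 2 + h1)
  · simp only [twist, Prod.smul_mk, smul_eq_mul]
    linear_combination (s k).2.2 * (h * periodicSign b 2 ^ 2 + h2)

variable {m : ℕ}

/-- The shift `k + 1` in the sign of vector `k` matches the coordinate in which the initial vector
is supported, so the two signs cancel. -/
theorem twist_chain_zero (b : Bool × Bool) (u : Fin m → ℝ × ℝ × ℝ) :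
    twist b (chain u) 0 = (0, 1, 0) := by
  simp [twist, chain, periodicSign_mul_self]

theorem twist_chain_one (b : Bool × Bool) (u : Fin m → ℝ × ℝ × ℝ) :
    twist b (chain u) 1 = (0, 0, 1) := by
  simp [twist, chain, periodicSign_mul_self]

theorem periodicSign_ne_zero (b : Bool × Bool) (i : ℕ) : periodicSign b i ≠ 0 :=
  left_ne_zero_of_mul_eq_one (periodicSign_mul_self b i)

/-- The chains which are convex after a change of signs. -/
def convexPart (m : ℕ) (b : Bool × Bool) : Set (chainSpace m) :=
  {u | ∀ i j, i < j → j ≤ m + 1 →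
    0 ≤ wedge (twist b (chain u.1) i) (twist b (chain u.1) j)}

/-- Weak inequalities for all pairs are equivalent to strict ones for neighbours. The former are
closed conditions, the latter open. -/
theorem mem_convexPart {b : Bool × Bool} {u : chainSpace m} :
    u ∈ convexPart m b ↔ ∀ k ≤ m,
      0 < wedge (twist b (chain u.1) k) (twist b (chain u.1) (k + 1)) ∧
      0 < (twist b (chain u.1) (k + 1)).2.2 := by
  refine ⟨fun h => wedge_pos_of_nonneg (twist_chain_zero b u.1) (twist_chain_one b u.1)
    (fun k hk => ?_) ?_ ?_ h, fun h => wedge_nonneg_of_pos (twist_chain_zero b u.1) h⟩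
  · rw [vol_twist]
    exact u.2.1 k hk
  · rw [wedge_twist]
    exact mul_ne_zero (mul_ne_zero (mul_ne_zero (periodicSign_ne_zero _ _)
      (periodicSign_ne_zero _ _)) (mul_ne_zero (periodicSign_ne_zero _ _)
      (periodicSign_ne_zero _ _))) u.2.2.1
  · rw [third_twist]
    exact mul_ne_zero (mul_ne_zero (periodicSign_ne_zero _ _) (periodicSign_ne_zero _ _)) u.2.2.2

theorem continuous_twist (b : Bool × Bool) (k : ℕ) :
    Continuous fun u : chainSpace m => twist b (chain u.1) k := by
  have : Continuous fun u : chainSpace m => chain u.1 k :=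
    (continuous_chain k).comp continuous_subtype_val
  unfold twist
  fun_prop

theorem isClopen_convexPart (m : ℕ) (b : Bool × Bool) : IsClopen (convexPart m b) := by
  constructor
  · have heq : convexPart m b = ⋂ (i : ℕ) (j : ℕ) (_ : i < j) (_ : j ≤ m + 1),
        {u : chainSpace m | 0 ≤ wedge (twist b (chain u.1) i) (twist b (chain u.1) j)} := by
      ext u
      simp [convexPart]
    rw [heq]
    exact isClosed_iInter fun i => isClosed_iInter fun j => isClosed_iInter fun _ =>
      isClosed_iInter fun _ => isClosed_le continuous_const
        ((continuous_twist b i).wedge (continuous_twist b j))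
  · have heq : convexPart m b = ⋂ k : Fin (m + 1),
        {u : chainSpace m | 0 < wedge (twist b (chain u.1) k) (twist b (chain u.1) (k + 1))} ∩
          {u : chainSpace m | 0 < (twist b (chain u.1) (k + 1)).2.2} := by
      ext u
      simp [mem_convexPart, Fin.forall_iff]
    rw [heq]
    refine isOpen_iInter_of_finite fun k => IsOpen.inter ?_ ?_
    · exact isOpen_lt continuous_const ((continuous_twist b _).wedge (continuous_twist b _))
    · exact isOpen_lt continuous_const
        (continuous_snd.comp (continuous_snd.comp (continuous_twist b _)))

theorem convexPart_nonempty (m : ℕ) (b : Bool × Bool) : (convexPart m b).Nonempty := by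
  -- A chain with only positive coordinates is convex; as `twist b` is an involution, its twist lies
  -- in the part of `b`.
  obtain ⟨u, hu⟩ := exists_chain_hasSigns m (x := fun _ => false) rfl rfl
  set v : Fin m → ℝ × ℝ × ℝ := fun i => twist b (chain u.1) (i + 2) with hv
  have hchain : ∀ k < m + 2, chain v k = twist b (chain u.1) k := by
    intro k hk
    match k with
    | 0 => exact (twist_chain_zero b u.1).symm
    | 1 => exact (twist_chain_one b u.1).symm
    | k + 2 => simp [chain, hv, show k < m by omega]
  have htw : ∀ k < m + 2, twist b (chain v) k = chain u.1 k := fun k hk => by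
    rw [← twist_twist b (chain u.1) k, twist, twist, hchain k hk]
  have hmem : v ∈ chainSpace m := by
    refine ⟨fun k hk => ?_, ?_, ?_⟩
    · rw [hchain _ (by omega), hchain _ (by omega), hchain _ (by omega), vol_twist]
      exact u.2.1 k hk
    · rw [hchain _ (by omega), hchain _ (by omega), wedge_twist]
      exact mul_ne_zero (mul_ne_zero (mul_ne_zero (periodicSign_ne_zero _ _)
        (periodicSign_ne_zero _ _)) (mul_ne_zero (periodicSign_ne_zero _ _)
        (periodicSign_ne_zero _ _))) u.2.2.1
    · rw [hchain _ (by omega), third_twist]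
      exact mul_ne_zero (mul_ne_zero (periodicSign_ne_zero _ _) (periodicSign_ne_zero _ _))
        u.2.2.2
  refine ⟨⟨v, hmem⟩, mem_convexPart.mpr fun k hk => ?_⟩
  rw [htw k (by omega), htw (k + 1) (by omega)]
  have h1 := hu (2 * k) (by omega)
  have h2 := hu (2 * k + 1) (by omega)
  rw [coord_even] at h1
  rw [coord_odd] at h2
  simpa [bitSign] using And.intro h1 h2

/-- The parts are distinguished by the signs of two coordinates, and two further coordinates have
equal signs on each of them. -/
theorem signs_of_mem_convexPart (hm : 2 ≤ m) {b : Bool × Bool} {u : chainSpace m}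
    (hu : u ∈ convexPart m b) :
    0 < bitSign b.2 * (chain u.1 2).2.2 ∧ 0 < bitSign b.1 * (chain u.1 3).2.2 ∧
      0 < bitSign b.2 * wedge (chain u.1 2) (chain u.1 3) := by
  have hu := mem_convexPart.mp hu
  have h1 := (hu 1 (by omega)).2
  have h2 := (hu 2 (by omega)).2
  have h3 := (hu 2 (by omega)).1
  rw [third_twist] at h1 h2
  rw [wedge_twist] at h3
  have e1 := bitSign_mul_self b.1
  have e2 := bitSign_mul_self b.2
  simp only [periodicSign] at h1 h2 h3
  norm_num at h1 h2 h3
  refine ⟨?_, ?_, ?_⟩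
  · convert h1 using 1
    linear_combination -(bitSign b.2 * (chain u.1 2).2.2) * e1
  · convert h2 using 1
    linear_combination -(bitSign b.1 * (chain u.1 3).2.2) * e2
  · convert h3 using 1
    linear_combination -(bitSign b.2 * wedge (chain u.1 2) (chain u.1 3)) *
      (e1 * bitSign b.2 ^ 2 + e2)

theorem bitSign_injective_of_pos {b c : Bool} {a : ℝ} (hb : 0 < bitSign b * a)
    (hc : 0 < bitSign c * a) : b = c := by
  cases b <;> cases c <;> simp [bitSign] at hb hc ⊢ <;> linarith

theorem eq_of_mem_convexPart (hm : 2 ≤ m) {b c : Bool × Bool} {u : chainSpace m}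
    (hb : u ∈ convexPart m b) (hc : u ∈ convexPart m c) : b = c := by
  have h1 := signs_of_mem_convexPart hm hb
  have h2 := signs_of_mem_convexPart hm hc
  exact Prod.ext (bitSign_injective_of_pos h1.2.1 h2.2.1) (bitSign_injective_of_pos h1.1 h2.1)

theorem not_mem_convexPart_of_neg (hm : 2 ≤ m) {b : Bool × Bool} {u : chainSpace m}
    (h : (chain u.1 2).2.2 * wedge (chain u.1 2) (chain u.1 3) < 0) : u ∉ convexPart m b := by
  intro hu
  obtain ⟨h1, -, h2⟩ := signs_of_mem_convexPart hm hu
  have := mul_pos h1 h2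
  have e := bitSign_mul_self b.2
  have : 0 < (bitSign b.2 * bitSign b.2) *
      ((chain u.1 2).2.2 * wedge (chain u.1 2) (chain u.1 3)) := by linarith
  rw [e] at this
  linarith

end Convex

/-! ### Lifting chains to the quaternions -/

section Spin

open Topology Quaternion

/-- The quaternion with given components. -/
def quat (a b c d : ℝ) : ℍ[ℝ] := ⟨a, b, c, d⟩

@[simp] theorem quat_re (a b c d : ℝ) : (quat a b c d).re = a := rfl

@[simp] theorem quat_imI (a b c d : ℝ) : (quat a b c d).imI = b := rfl

@[simp] theorem quat_imJ (a b c d : ℝ) : (quat a b c d).imJ = c := rfl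

@[simp] theorem quat_imK (a b c d : ℝ) : (quat a b c d).imK = d := rfl

/-- The purely imaginary quaternion with given components. -/
def pureQuaternion (v : ℝ × ℝ × ℝ) : ℍ[ℝ] := quat 0 v.1 v.2.1 v.2.2

/-- Conjugation of a vector by a quaternion. -/
noncomputable def rot (q : ℍ[ℝ]) (v : ℝ × ℝ × ℝ) : ℝ × ℝ × ℝ :=
  ((q * pureQuaternion v * star q).imI, (q * pureQuaternion v * star q).imJ,
    (q * pureQuaternion v * star q).imK)

/-- The cross product. -/
def cross (v w : ℝ × ℝ × ℝ) : ℝ × ℝ × ℝ :=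
  (v.2.1 * w.2.2 - v.2.2 * w.2.1, v.2.2 * w.1 - v.1 * w.2.2, v.1 * w.2.1 - v.2.1 * w.1)

/-- The squared norm of a quaternion. -/
def sqNorm (q : ℍ[ℝ]) : ℝ := q.re ^ 2 + q.imI ^ 2 + q.imJ ^ 2 + q.imK ^ 2

theorem rot_apply (q : ℍ[ℝ]) (v : ℝ × ℝ × ℝ) : rot q v =
    ((q.re ^ 2 + q.imI ^ 2 - q.imJ ^ 2 - q.imK ^ 2) * v.1 +
      2 * (q.imI * q.imJ - q.re * q.imK) * v.2.1 + 2 * (q.imI * q.imK + q.re * q.imJ) * v.2.2,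
    2 * (q.imI * q.imJ + q.re * q.imK) * v.1 +
      (q.re ^ 2 - q.imI ^ 2 + q.imJ ^ 2 - q.imK ^ 2) * v.2.1 +
      2 * (q.imJ * q.imK - q.re * q.imI) * v.2.2,
    2 * (q.imI * q.imK - q.re * q.imJ) * v.1 + 2 * (q.imJ * q.imK + q.re * q.imI) * v.2.1 +
      (q.re ^ 2 - q.imI ^ 2 - q.imJ ^ 2 + q.imK ^ 2) * v.2.2) := by
  refine Prod.ext ?_ (Prod.ext ?_ ?_) <;> simp [rot, pureQuaternion] <;> ring

theorem pureQuaternion_rot (q : ℍ[ℝ]) (v : ℝ × ℝ × ℝ) :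
    pureQuaternion (rot q v) = q * pureQuaternion v * star q := by
  ext
  · simp [rot, pureQuaternion]
    ring
  · rfl
  · rfl
  · rfl

theorem rot_mul (q r : ℍ[ℝ]) (v : ℝ × ℝ × ℝ) : rot (q * r) v = rot q (rot r v) := by
  have h : q * r * pureQuaternion v * star (q * r) = q * pureQuaternion (rot r v) * star q := by
    rw [pureQuaternion_rot, star_mul]
    simp only [mul_assoc]
  simp only [rot] at h ⊢
  rw [h]

theorem rot_smul (q : ℍ[ℝ]) (c : ℝ) (v : ℝ × ℝ × ℝ) : rot q (c • v) = c • rot q v := by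
  simp only [rot_apply]
  refine Prod.ext ?_ (Prod.ext ?_ ?_) <;> simp <;> ring

theorem rot_rot_star (q : ℍ[ℝ]) (v : ℝ × ℝ × ℝ) : rot q (rot (star q) v) = sqNorm q ^ 2 • v := by
  simp only [rot_apply, sqNorm]
  refine Prod.ext ?_ (Prod.ext ?_ ?_) <;> simp <;> ring

theorem rot_star_rot (q : ℍ[ℝ]) (v : ℝ × ℝ × ℝ) : rot (star q) (rot q v) = sqNorm q ^ 2 • v := by
  simp only [rot_apply, sqNorm]
  refine Prod.ext ?_ (Prod.ext ?_ ?_) <;> simp <;> ring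

theorem cross_rot (q : ℍ[ℝ]) (v w : ℝ × ℝ × ℝ) :
    cross (rot q v) (rot q w) = sqNorm q • rot q (cross v w) := by
  simp only [rot_apply, sqNorm, cross]
  refine Prod.ext ?_ (Prod.ext ?_ ?_) <;> simp <;> ring

theorem cross_smul_smul (a b : ℝ) (v w : ℝ × ℝ × ℝ) :
    cross (a • v) (b • w) = (a * b) • cross v w := by
  simp only [cross]
  refine Prod.ext ?_ (Prod.ext ?_ ?_) <;> simp <;> ring

/-- The volume pairs `a × b` with `v`, and `rot (star q)` is the adjoint of `rot q`. -/
theorem vol_eq_of_cross_eq {a b v : ℝ × ℝ × ℝ} {q : ℍ[ℝ]} {μ : ℝ}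
    (h : cross a b = μ • rot q (1, 0, 0)) : vol a b v = μ * (rot (star q) v).1 := by
  have h1 := congrArg Prod.fst h
  have h2 := congrArg (fun x => x.2.1) h
  have h3 := congrArg (fun x => x.2.2) h
  simp only [cross, rot_apply, Prod.smul_mk, smul_eq_mul] at h1 h2 h3
  simp only [vol, wedge, rot_apply, Quaternion.re_star, Quaternion.imI_star,
    Quaternion.imJ_star, Quaternion.imK_star]
  linear_combination v.1 * h1 + v.2.1 * h2 + v.2.2 * h3

/-- The product of a turn about the third axis and a turn about the first axis. -/
noncomputable def turn (t s : ℝ) : ℍ[ℝ] := quat 1 0 0 t * quat 1 s 0 0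

theorem turn_eq (t s : ℝ) : turn t s = quat 1 s (t * s) t := by
  ext <;> simp [turn]

theorem rot_turn_third (t s : ℝ) : rot (turn t s) (0, 0, 1) =
    (4 * s * t, -(2 * s * (1 - t ^ 2)), (1 + t ^ 2) * (1 - s ^ 2)) := by
  rw [turn_eq, rot_apply]
  refine Prod.ext ?_ (Prod.ext ?_ ?_) <;> simp <;> ring

theorem rot_turn_first (t s : ℝ) : rot (turn t s) (1, 0, 0) =
    (1 + s ^ 2) • (1 - t ^ 2, 2 * t, 0) := by
  rw [turn_eq, rot_apply]
  refine Prod.ext ?_ (Prod.ext ?_ ?_) <;> simp <;> ring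

/-- The half-angle tangent of the first turn towards a vector. -/
noncomputable def firstTurn (y : ℝ × ℝ × ℝ) : ℝ :=
  (√(y.1 ^ 2 + y.2.1 ^ 2) + y.2.1) / y.1

/-- The half-angle tangent of the second turn towards a vector. -/
noncomputable def secondTurn (y : ℝ × ℝ × ℝ) : ℝ :=
  √(y.1 ^ 2 + y.2.1 ^ 2) / (√(y.1 ^ 2 + y.2.1 ^ 2 + y.2.2 ^ 2) + y.2.2)

theorem lt_sqrt_sq_add {a b : ℝ} (ha : 0 < a) : 0 < √(a + b ^ 2) + b := by
  have h : |b| < √(a + b ^ 2) := by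
    rw [← Real.sqrt_sq_eq_abs]
    exact Real.sqrt_lt_sqrt (sq_nonneg b) (by linarith)
  linarith [neg_abs_le b]

theorem firstTurn_pos {y : ℝ × ℝ × ℝ} (hy : 0 < y.1) : 0 < firstTurn y :=
  div_pos (lt_sqrt_sq_add (by positivity)) hy

theorem secondTurn_pos {y : ℝ × ℝ × ℝ} (hy : 0 < y.1) : 0 < secondTurn y :=
  div_pos (Real.sqrt_pos.mpr (by positivity)) (lt_sqrt_sq_add (by positivity))

/-- The vector `(1 - t², 2t)` points in the direction with half-angle tangent `t`. The target is the
direction of `e₃ × y`, which lies in the open upper half plane because `y.1` is positive. -/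
theorem firstTurn_spec {y : ℝ × ℝ × ℝ} (hy : 0 < y.1) :
    ∃ c : ℝ, 0 < c ∧ (1 - firstTurn y ^ 2, 2 * firstTurn y, (0 : ℝ)) = c • (-y.2.1, y.1, (0 : ℝ)) := by
  obtain ⟨A, B, C⟩ := y
  simp only at hy
  have hρ : √(A ^ 2 + B ^ 2) ^ 2 = A ^ 2 + B ^ 2 := Real.sq_sqrt (by positivity)
  refine ⟨2 * firstTurn (A, B, C) / A, div_pos (mul_pos two_pos (firstTurn_pos hy)) hy, ?_⟩
  refine Prod.ext ?_ (Prod.ext ?_ ?_)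
  · simp only [firstTurn, Prod.smul_mk, smul_eq_mul]
    field_simp
    linear_combination -hρ
  · simp only [Prod.smul_mk, smul_eq_mul]
    field_simp
  · simp

theorem rot_turn_spec {y : ℝ × ℝ × ℝ} (hy : 0 < y.1) :
    ∃ c : ℝ, 0 < c ∧ rot (turn (firstTurn y) (secondTurn y)) (0, 0, 1) = c • y := by
  have ht := firstTurn_pos hy
  have hs := secondTurn_pos hy
  obtain ⟨A, B, C⟩ := y
  simp only at hy
  have hρ : √(A ^ 2 + B ^ 2) ^ 2 = A ^ 2 + B ^ 2 := Real.sq_sqrt (by positivity)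
  have hν : √(A ^ 2 + B ^ 2 + C ^ 2) ^ 2 = A ^ 2 + B ^ 2 + C ^ 2 := Real.sq_sqrt (by positivity)
  have hden : 0 < √(A ^ 2 + B ^ 2 + C ^ 2) + C := lt_sqrt_sq_add (by positivity)
  have htA : firstTurn (A, B, C) * A = √(A ^ 2 + B ^ 2) + B := div_mul_cancel₀ _ hy.ne'
  have hsD : secondTurn (A, B, C) * (√(A ^ 2 + B ^ 2 + C ^ 2) + C) = √(A ^ 2 + B ^ 2) :=
    div_mul_cancel₀ _ hden.ne'
  set t := firstTurn (A, B, C)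
  set s := secondTurn (A, B, C)
  set ρ := √(A ^ 2 + B ^ 2)
  set ν := √(A ^ 2 + B ^ 2 + C ^ 2)
  -- Half-angle formulas: by `e1` and `e2` the first turn has cosine `-B / ρ`; by `e3` the second
  -- has cotangent `C / ρ`.
  have e1 : (1 - t ^ 2) * A = -(2 * t * B) := by
    have : (1 - t ^ 2) * A * A = -(2 * t * B) * A := by
      linear_combination (-(t * A) - ρ + B) * htA - hρ
    exact mul_right_cancel₀ hy.ne' this
  have e2 : (1 + t ^ 2) * A = 2 * t * ρ := by
    have : (1 + t ^ 2) * A * A = 2 * t * ρ * A := by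
      linear_combination (t * A - ρ + B) * htA - hρ
    exact mul_right_cancel₀ hy.ne' this
  have e3 : (1 - s ^ 2) * ρ = 2 * s * C := by
    have : (1 - s ^ 2) * ρ * (ν + C) ^ 2 = 2 * s * C * (ν + C) ^ 2 := by
      linear_combination (-(s * (ν + C) * ρ) - ρ ^ 2 - 2 * C * (ν + C)) * hsD + ρ * hν - ρ * hρ
    exact mul_right_cancel₀ (pow_ne_zero 2 hden.ne') this
  refine ⟨4 * s * t / A, by positivity, ?_⟩
  rw [rot_turn_third]
  refine Prod.ext ?_ (Prod.ext ?_ ?_)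
  · simp only [Prod.smul_mk, smul_eq_mul]
    field_simp
  · simp only [Prod.smul_mk, smul_eq_mul]
    rw [div_mul_eq_mul_div, eq_div_iff hy.ne']
    linear_combination -(2 * s) * e1
  · simp only [Prod.smul_mk, smul_eq_mul]
    rw [div_mul_eq_mul_div, eq_div_iff hy.ne']
    linear_combination (1 - s ^ 2) * e2 + 2 * t * e3

/-- Positive turns are determined by the ray to which they move `e₃`. Hence the lift of a chain
built from a walk reproduces the walk. -/
theorem turns_of_rot_turn {t s c : ℝ} (ht : 0 < t) (hs : 0 < s) (hc : 0 < c) :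
    firstTurn (c • rot (turn t s) (0, 0, 1)) = t ∧
      secondTurn (c • rot (turn t s) (0, 0, 1)) = s := by
  have h1 : √((c * (4 * s * t)) ^ 2 + (c * -(2 * s * (1 - t ^ 2))) ^ 2) =
      c * (2 * s * (1 + t ^ 2)) := by
    rw [← Real.sqrt_sq (by positivity : 0 ≤ c * (2 * s * (1 + t ^ 2)))]
    congr 1
    ring
  have h2 : √((c * (4 * s * t)) ^ 2 + (c * -(2 * s * (1 - t ^ 2))) ^ 2 +
      (c * ((1 + t ^ 2) * (1 - s ^ 2))) ^ 2) = c * ((1 + t ^ 2) * (1 + s ^ 2)) := by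
    rw [← Real.sqrt_sq (by positivity : 0 ≤ c * ((1 + t ^ 2) * (1 + s ^ 2)))]
    congr 1
    ring
  rw [rot_turn_third]
  simp only [firstTurn, secondTurn, Prod.smul_mk, smul_eq_mul, h1, h2]
  constructor
  · field_simp
    ring
  · field_simp
    ring

/-- The quaternion `q` moves the standard flag to the flag spanned by `a` and `b`. -/
def IsLift (q : ℍ[ℝ]) (a b : ℝ × ℝ × ℝ) : Prop :=
  0 < sqNorm q ∧ (∃ c : ℝ, 0 < c ∧ b = c • rot q (0, 0, 1)) ∧ ∃ c : ℝ, 0 < c ∧ cross a b = c • rot q (1, 0, 0)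

theorem IsLift.vol_pos_iff {q : ℍ[ℝ]} {a b v : ℝ × ℝ × ℝ} (h : IsLift q a b) :
    0 < vol a b v ↔ 0 < (rot (star q) v).1 := by
  obtain ⟨-, -, μ, hμ, hab⟩ := h
  rw [vol_eq_of_cross_eq hab, mul_pos_iff_of_pos_left hμ]

theorem sqNorm_mul (q r : ℍ[ℝ]) : sqNorm (q * r) = sqNorm q * sqNorm r := by
  simp only [sqNorm, Quaternion.re_mul, Quaternion.imI_mul, Quaternion.imJ_mul,
    Quaternion.imK_mul]
  ring

/-- In the frame of `q` the new vector is `y` with positive first coordinate. The two turns move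
`e₃` to the ray of `y` and `e₁` to that of `e₃ × y`, and `q` carries this back. -/
theorem IsLift.step {q : ℍ[ℝ]} {a b v : ℝ × ℝ × ℝ} (h : IsLift q a b)
    (hv : 0 < (rot (star q) v).1) :
    IsLift (q * turn (firstTurn (rot (star q) v)) (secondTurn (rot (star q) v))) b v := by
  obtain ⟨hq, ⟨l, hl, hb⟩, -⟩ := h
  have hvq := rot_rot_star q v
  set y := rot (star q) v with hy
  obtain ⟨c, hc, hcy⟩ := rot_turn_spec hv
  obtain ⟨d, hd, hdy⟩ := firstTurn_spec hv
  have hv' : v = (sqNorm q ^ 2)⁻¹ • rot q y := by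
    rw [hvq, smul_smul, inv_mul_cancel₀ (by positivity), one_smul]
  have hs := secondTurn_pos hv
  refine ⟨?_, ⟨(sqNorm q ^ 2)⁻¹ * c⁻¹, by positivity, ?_⟩,
    l * (sqNorm q ^ 2)⁻¹ * sqNorm q * ((1 + secondTurn y ^ 2) * d)⁻¹, by positivity, ?_⟩
  · rw [sqNorm_mul, turn_eq]
    refine mul_pos hq ?_
    simp only [sqNorm]
    positivity
  · rw [rot_mul, hcy, rot_smul, mul_smul, smul_smul c⁻¹, inv_mul_cancel₀ hc.ne', one_smul, ← hv']
  · rw [rot_mul, rot_turn_first, hdy, rot_smul, rot_smul]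
    conv_lhs => rw [hb, hv', cross_smul_smul, cross_rot]
    have hcr : cross (0, 0, 1) y = (-y.2.1, y.1, 0) := by simp [cross]
    rw [hcr]
    simp only [smul_smul]
    congr 1
    field_simp

/-- The lifts of the flags of a chain. -/
noncomputable def lift (s : ℕ → ℝ × ℝ × ℝ) : ℕ → ℍ[ℝ]
  | 0 => 1
  | k + 1 => lift s k * turn (firstTurn (rot (star (lift s k)) (s (k + 2))))
      (secondTurn (rot (star (lift s k)) (s (k + 2))))

theorem isLift_one : IsLift 1 (0, 1, 0) (0, 0, 1) := by
  refine ⟨by simp [sqNorm], ⟨1, one_pos, ?_⟩, 1, one_pos, ?_⟩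
  · simp [rot_apply]
  · simp [rot_apply, cross]

theorem isLift_lift {m : ℕ} {s : ℕ → ℝ × ℝ × ℝ} (h0 : s 0 = (0, 1, 0)) (h1 : s 1 = (0, 0, 1))
    (hvol : ∀ k < m, 0 < vol (s k) (s (k + 1)) (s (k + 2))) :
    ∀ k ≤ m, IsLift (lift s k) (s k) (s (k + 1)) := by
  intro k
  induction k with
  | zero =>
    intro _
    rw [h0, h1]
    exact isLift_one
  | succ k ih =>
    intro hk
    have ih := ih (by omega)
    exact ih.step (ih.vol_pos_iff.mp (hvol k (by omega)))

variable {m : ℕ}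

theorem isLift_chain (u : chainSpace m) {k : ℕ} (hk : k ≤ m) :
    IsLift (lift (chain u.1) k) (chain u.1 k) (chain u.1 (k + 1)) :=
  isLift_lift rfl rfl u.2.1 k hk

theorem continuous_quaternion_mk {X : Type*} [TopologicalSpace X] {a b c d : X → ℝ}
    (ha : Continuous a) (hb : Continuous b) (hc : Continuous c) (hd : Continuous d) :
    Continuous fun x => quat (a x) (b x) (c x) (d x) := by
  have : (fun x => quat (a x) (b x) (c x) (d x)) = fun x =>
      a x • (1 : ℍ[ℝ]) + b x • quat 0 1 0 0 + c x • quat 0 0 1 0 +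
        d x • quat 0 0 0 1 := by
    funext x
    ext <;> simp
  rw [this]
  fun_prop

theorem Continuous.firstTurn {X : Type*} [TopologicalSpace X] {f : X → ℝ × ℝ × ℝ}
    (hf : Continuous f) (hpos : ∀ x, 0 < (f x).1) : Continuous fun x => firstTurn (f x) :=
  Continuous.div (by fun_prop) (by fun_prop) fun x => (hpos x).ne'

theorem Continuous.secondTurn {X : Type*} [TopologicalSpace X] {f : X → ℝ × ℝ × ℝ}
    (hf : Continuous f) (hpos : ∀ x, 0 < (f x).1) : Continuous fun x => secondTurn (f x) :=
  Continuous.div (by fun_prop) (by fun_prop) fun x =>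
    (lt_sqrt_sq_add (by have := hpos x; positivity)).ne'

/-- The turns are explicit functions, continuous where the first coordinate is positive, so no sign
has to be chosen in lifting to the quaternions. -/
theorem continuous_lift {k : ℕ} (hk : k ≤ m) :
    Continuous fun u : chainSpace m => lift (chain u.1) k := by
  induction k with
  | zero => exact continuous_const
  | succ k ih =>
    have ih := ih (by omega)
    have hs : Continuous fun u : chainSpace m => chain u.1 (k + 2) :=
      (continuous_chain (m := m) (k + 2)).comp continuous_subtype_val
    have hy : Continuous fun u : chainSpace m =>
        rot (star (lift (chain u.1) k)) (chain u.1 (k + 2)) := by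
      have h0 := Quaternion.continuous_re.comp ih
      have h1 := Quaternion.continuous_imI.comp ih
      have h2 := Quaternion.continuous_imJ.comp ih
      have h3 := Quaternion.continuous_imK.comp ih
      simp only [Function.comp_def] at h0 h1 h2 h3
      simp only [rot_apply, Quaternion.re_star, Quaternion.imI_star,
        Quaternion.imJ_star, Quaternion.imK_star]
      fun_prop
    have hpos : ∀ u : chainSpace m,
        0 < (rot (star (lift (chain u.1) k)) (chain u.1 (k + 2))).1 := fun u =>
      (isLift_chain u (by omega)).vol_pos_iff.mp (u.2.1 k (by omega))
    have ht := hy.firstTurn hpos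
    have hs' := hy.secondTurn hpos
    simp only [lift]
    refine ih.mul ?_
    simp only [turn_eq]
    exact continuous_quaternion_mk continuous_const hs' (ht.mul hs') ht

end Spin

/-! ### The spin class of a chain -/

section SpinClass

open Topology Quaternion

/-- Up to a positive factor, the first diagonal entry of the rotation of a quaternion. -/
def firstEntry (q : ℍ[ℝ]) : ℝ := q.re ^ 2 + q.imI ^ 2 - q.imJ ^ 2 - q.imK ^ 2

/-- Up to a positive factor, the third diagonal entry of the rotation of a quaternion. -/
def thirdEntry (q : ℍ[ℝ]) : ℝ := q.re ^ 2 - q.imI ^ 2 - q.imJ ^ 2 + q.imK ^ 2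

/-- The component of a quaternion that dominates when the two diagonal entries of its rotation have
the given signs. -/
def spinCoord : Bool → Bool → ℍ[ℝ] → ℝ
  | true, true, q => q.re
  | true, false, q => q.imI
  | false, true, q => q.imK
  | false, false, q => q.imJ

/-- The signs of the two diagonal entries and of the dominating component. -/
noncomputable def spinClass (q : ℍ[ℝ]) : Bool × Bool × Bool :=
  (decide (0 < firstEntry q), decide (0 < thirdEntry q),
    decide (0 < spinCoord (decide (0 < firstEntry q)) (decide (0 < thirdEntry q)) q))

/-- Half the sum and half the difference of the two entries are differences of two squares. In each
sign case one of them shows that the square of the dominating component is the strictly larger one.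
-/
theorem spinCoord_ne_zero {q : ℍ[ℝ]} (h1 : firstEntry q ≠ 0) (h3 : thirdEntry q ≠ 0) :
    spinCoord (decide (0 < firstEntry q)) (decide (0 < thirdEntry q)) q ≠ 0 := by
  rcases lt_or_gt_of_ne h1 with h1 | h1 <;> rcases lt_or_gt_of_ne h3 with h3 | h3 <;>
    simp only [h1, h3, h1.not_gt, h3.not_gt, decide_true, decide_false, spinCoord] <;>
    simp only [firstEntry, thirdEntry] at h1 h3 <;> intro h0 <;> rw [h0] at h1 h3 <;>
    nlinarith [sq_nonneg q.re, sq_nonneg q.imI, sq_nonneg q.imJ, sq_nonneg q.imK]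

theorem continuous_spinCoord (b c : Bool) : Continuous (spinCoord b c) := by
  cases b <;> cases c
  · exact Quaternion.continuous_imJ
  · exact Quaternion.continuous_imK
  · exact Quaternion.continuous_imI
  · exact Quaternion.continuous_re

theorem continuous_firstEntry : Continuous firstEntry := by
  have h0 := Quaternion.continuous_re
  have h1 := Quaternion.continuous_imI
  have h2 := Quaternion.continuous_imJ
  have h3 := Quaternion.continuous_imK
  exact (((h0.pow 2).add (h1.pow 2)).sub (h2.pow 2)).sub (h3.pow 2)

theorem continuous_thirdEntry : Continuous thirdEntry := by
  have h0 := Quaternion.continuous_re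
  have h1 := Quaternion.continuous_imI
  have h2 := Quaternion.continuous_imJ
  have h3 := Quaternion.continuous_imK
  exact (((h0.pow 2).sub (h1.pow 2)).sub (h2.pow 2)).add (h3.pow 2)

theorem eventually_decide_pos_eq {X : Type*} [TopologicalSpace X] {f : X → ℝ} (hf : Continuous f)
    {x : X} (hx : f x ≠ 0) : ∀ᶠ y in 𝓝 x, decide (0 < f y) = decide (0 < f x) := by
  rcases lt_or_gt_of_ne hx with h | h
  · filter_upwards [hf.continuousAt.eventually_lt_const h] with y hy
    simp [h.not_gt, hy.not_gt]
  · filter_upwards [hf.continuousAt.eventually_const_lt h] with y hy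
    simp [h, hy]

theorem eventually_spinClass_eq {q : ℍ[ℝ]} (h1 : firstEntry q ≠ 0) (h3 : thirdEntry q ≠ 0) :
    ∀ᶠ p in 𝓝 q, spinClass p = spinClass q := by
  filter_upwards [eventually_decide_pos_eq continuous_firstEntry h1,
    eventually_decide_pos_eq continuous_thirdEntry h3,
    eventually_decide_pos_eq (continuous_spinCoord _ _) (spinCoord_ne_zero h1 h3)] with p p1 p3 p2
  simp only [spinClass, p1, p3, p2]

theorem IsLift.exists_wedge_eq {q : ℍ[ℝ]} {a b : ℝ × ℝ × ℝ} (h : IsLift q a b) :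
    ∃ c : ℝ, 0 < c ∧ wedge a b = c * firstEntry q := by
  obtain ⟨-, -, c, hc, hab⟩ := h
  refine ⟨c, hc, ?_⟩
  have := congrArg Prod.fst hab
  simpa [cross, rot_apply, wedge, firstEntry] using this

theorem IsLift.exists_snd_snd_eq {q : ℍ[ℝ]} {a b : ℝ × ℝ × ℝ} (h : IsLift q a b) :
    ∃ c : ℝ, 0 < c ∧ b.2.2 = c * thirdEntry q := by
  obtain ⟨-, ⟨c, hc, hb⟩, -⟩ := h
  refine ⟨c, hc, ?_⟩
  have := congrArg (fun x => x.2.2) hb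
  simpa [rot_apply, thirdEntry] using this

variable {m : ℕ}

theorem entries_lift_ne_zero (u : chainSpace m) :
    firstEntry (lift (chain u.1) m) ≠ 0 ∧ thirdEntry (lift (chain u.1) m) ≠ 0 := by
  have h := isLift_chain u le_rfl
  obtain ⟨c, -, hc⟩ := h.exists_wedge_eq
  obtain ⟨d, -, hd⟩ := h.exists_snd_snd_eq
  exact ⟨right_ne_zero_of_mul (hc ▸ u.2.2.1), right_ne_zero_of_mul (hd ▸ u.2.2.2)⟩

/-- The convexity type of a chain, or its spin class if it is not convex. -/
noncomputable def chainType (u : chainSpace m) : (Bool × Bool) ⊕ (Bool × Bool × Bool) :=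
  open Classical in
  if h : ∃ b, u ∈ convexPart m b then Sum.inl h.choose else
    Sum.inr (spinClass (lift (chain u.1) m))

theorem chainType_of_mem (hm : 2 ≤ m) {b : Bool × Bool} {u : chainSpace m}
    (hu : u ∈ convexPart m b) : chainType u = Sum.inl b := by
  have h : ∃ b, u ∈ convexPart m b := ⟨b, hu⟩
  rw [chainType, dif_pos h, eq_of_mem_convexPart hm h.choose_spec hu]

theorem chainType_of_notMem {u : chainSpace m} (hu : ∀ b, u ∉ convexPart m b) :
    chainType u = Sum.inr (spinClass (lift (chain u.1) m)) :=
  dif_neg (not_exists.mpr hu)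

/-- The convex parts are clopen, and outside them the final lift varies continuously without leaving
its sector. -/
theorem continuous_chainType (hm : 2 ≤ m) :
    let _ : TopologicalSpace ((Bool × Bool) ⊕ (Bool × Bool × Bool)) := ⊥
    Continuous (chainType (m := m)) := by
  let _ : TopologicalSpace ((Bool × Bool) ⊕ (Bool × Bool × Bool)) := ⊥
  refine IsLocallyConstant.continuous ((IsLocallyConstant.iff_eventually_eq _).mpr fun u => ?_)
  by_cases h : ∃ b, u ∈ convexPart m b
  · obtain ⟨b, hb⟩ := h
    filter_upwards [(isClopen_convexPart m b).isOpen.mem_nhds hb] with v hv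
    rw [chainType_of_mem hm hv, chainType_of_mem hm hb]
  · rw [not_exists] at h
    have h1 : ∀ᶠ v in 𝓝 u, ∀ b, v ∉ convexPart m b := by
      rw [Filter.eventually_all]
      exact fun b => (isClopen_convexPart m b).isClosed.isOpen_compl.mem_nhds (h b)
    have h2 := (continuous_lift (m := m) le_rfl).continuousAt.eventually
      (eventually_spinClass_eq (entries_lift_ne_zero u).1 (entries_lift_ne_zero u).2)
    filter_upwards [h1, h2] with v hv1 hv2
    rw [chainType_of_notMem hv1, chainType_of_notMem h, hv2]

/-! ### Realizing all spin classes by walks of quaternions -/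

/-- The quaternion `q` is in the principal sector, rotated by `h`. -/
def Near (h q : ℍ[ℝ]) : Prop :=
  0 < firstEntry (q * star h) ∧ 0 < thirdEntry (q * star h) ∧ 0 < (q * star h).re

theorem near_eventually {h q : ℍ[ℝ]} (hq : Near h q) (e : ℍ[ℝ]) :
    ∀ᶠ t : ℝ in 𝓝[>] 0, Near h (q * (1 + t • e)) := by
  have hcont : Continuous fun t : ℝ => q * (1 + t • e) * star h := by fun_prop
  have key : ∀ f : ℍ[ℝ] → ℝ, Continuous f → 0 < f (q * star h) →
      ∀ᶠ t : ℝ in 𝓝[>] 0, 0 < f (q * (1 + t • e) * star h) := fun f hf h0 =>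
    ((hf.comp hcont).continuousAt.eventually_const_lt (by simpa using h0)).filter_mono
      nhdsWithin_le_nhds
  filter_upwards [key _ continuous_firstEntry hq.1, key _ continuous_thirdEntry hq.2.1,
    key _ Quaternion.continuous_re hq.2.2] with t h1 h2 h3
  exact ⟨h1, h2, h3⟩

theorem Near.of_smul {h q : ℍ[ℝ]} {t : ℝ} (ht : 0 < t) (hq : Near h q) : Near h (t • q) := by
  obtain ⟨h1, h2, h3⟩ := hq
  refine ⟨?_, ?_, ?_⟩ <;> rw [smul_mul_assoc]
  · have : firstEntry (t • (q * star h)) = t ^ 2 * firstEntry (q * star h) := by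
      simp only [firstEntry, Quaternion.re_smul, Quaternion.imI_smul, Quaternion.imJ_smul,
        Quaternion.imK_smul, smul_eq_mul]
      ring
    rw [this]
    positivity
  · have : thirdEntry (t • (q * star h)) = t ^ 2 * thirdEntry (q * star h) := by
      simp only [thirdEntry, Quaternion.re_smul, Quaternion.imI_smul, Quaternion.imJ_smul,
        Quaternion.imK_smul, smul_eq_mul]
      ring
    rw [this]
    positivity
  · rw [Quaternion.re_smul, smul_eq_mul]
    positivity

/-- For small `t` the factor `1 + t • e` barely moves `q`; for large `t` it is close to a multiple
of `e`. The second case reduces to the first for `star e`, with the inverse parameter and up to a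
positive scalar. -/
theorem Near.exists_half_step {h q e : ℍ[ℝ]} (hq : Near h q) (he : e * star e = 1) {h' : ℍ[ℝ]}
    (hh : h' = h ∨ h' = h * e) : ∃ t : ℝ, 0 < t ∧ Near h' (q * (1 + t • e)) := by
  rcases hh with rfl | rfl
  · obtain ⟨t, ht, h0⟩ := ((near_eventually hq e).and self_mem_nhdsWithin).exists
    exact ⟨t, h0, ht⟩
  · obtain ⟨t, ht, h0⟩ := ((near_eventually hq (star e)).and self_mem_nhdsWithin).exists
    have h0 : 0 < t := h0
    refine ⟨t⁻¹, inv_pos.mpr h0, ?_⟩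
    have hn := ht.of_smul (inv_pos.mpr h0)
    have heq : q * (1 + t⁻¹ • e) * star (h * e) = t⁻¹ • (q * (1 + t • star e)) * star h := by
      rw [star_mul, ← mul_assoc, mul_assoc q, add_mul, smul_mul_assoc, he, one_mul, ← mul_smul_comm,
        smul_add, smul_smul, inv_mul_cancel₀ h0.ne', one_smul, add_comm]
    rw [Near, heq]
    exact hn

/-- The quaternion with the given spin class that is a unit of the Lipschitz order. -/
def unitQuat : Bool × Bool × Bool → ℍ[ℝ]
  | (true, true, e) => quat (if e then 1 else -1) 0 0 0
  | (true, false, e) => quat 0 (if e then 1 else -1) 0 0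
  | (false, true, e) => quat 0 0 0 (if e then 1 else -1)
  | (false, false, e) => quat 0 0 (if e then 1 else -1) 0

/-- Right multiplication by the first imaginary unit. -/
def mulFirst : Bool × Bool × Bool → Bool × Bool × Bool
  | (true, true, e) => (true, false, e)
  | (true, false, e) => (true, true, !e)
  | (false, true, e) => (false, false, e)
  | (false, false, e) => (false, true, !e)

/-- Right multiplication by the third imaginary unit. -/
def mulThird : Bool × Bool × Bool → Bool × Bool × Bool
  | (true, true, e) => (false, true, e)
  | (true, false, e) => (false, false, !e)
  | (false, true, e) => (true, true, !e)
  | (false, false, e) => (true, false, e)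

theorem unitQuat_mulFirst (b : Bool × Bool × Bool) :
    unitQuat (mulFirst b) = unitQuat b * quat 0 1 0 0 := by
  obtain ⟨_ | _, _ | _, _ | _⟩ := b <;> ext <;> simp [unitQuat, mulFirst]

theorem unitQuat_mulThird (b : Bool × Bool × Bool) :
    unitQuat (mulThird b) = unitQuat b * quat 0 0 0 1 := by
  obtain ⟨_ | _, _ | _, _ | _⟩ := b <;> ext <;> simp [unitQuat, mulThird]

theorem firstEntry_mul_star_unitQuat (b : Bool × Bool × Bool) (q : ℍ[ℝ]) :
    firstEntry (q * star (unitQuat b)) = bitSign (!b.1) * firstEntry q := by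
  obtain ⟨_ | _, _ | _, _ | _⟩ := b <;> simp [unitQuat, firstEntry, bitSign] <;> ring

theorem thirdEntry_mul_star_unitQuat (b : Bool × Bool × Bool) (q : ℍ[ℝ]) :
    thirdEntry (q * star (unitQuat b)) = bitSign (!b.2.1) * thirdEntry q := by
  obtain ⟨_ | _, _ | _, _ | _⟩ := b <;> simp [unitQuat, thirdEntry, bitSign] <;> ring

theorem re_mul_star_unitQuat (b : Bool × Bool × Bool) (q : ℍ[ℝ]) :
    (q * star (unitQuat b)).re = bitSign (!b.2.2) * spinCoord b.1 b.2.1 q := by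
  obtain ⟨_ | _, _ | _, _ | _⟩ := b <;> simp [unitQuat, spinCoord, bitSign]

theorem decide_pos_of_bitSign_not {b : Bool} {a : ℝ} (h : 0 < bitSign (!b) * a) :
    decide (0 < a) = b := by
  cases b
  · simp only [bitSign, Bool.not_false, if_true] at h
    exact decide_eq_false (by linarith)
  · simp only [bitSign, Bool.not_true, Bool.false_eq_true, if_false] at h
    exact decide_eq_true (by linarith)

theorem Near.spinClass_eq {b : Bool × Bool × Bool} {q : ℍ[ℝ]} (hq : Near (unitQuat b) q) :
    firstEntry q ≠ 0 ∧ thirdEntry q ≠ 0 ∧ spinClass q = b := by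
  obtain ⟨h1, h3, h0⟩ := hq
  rw [firstEntry_mul_star_unitQuat] at h1
  rw [thirdEntry_mul_star_unitQuat] at h3
  rw [re_mul_star_unitQuat] at h0
  refine ⟨right_ne_zero_of_mul h1.ne', right_ne_zero_of_mul h3.ne', ?_⟩
  have e1 := decide_pos_of_bitSign_not h1
  have e3 := decide_pos_of_bitSign_not h3
  have e0 := decide_pos_of_bitSign_not h0
  simp only [spinClass, e1, e3, e0]

theorem turn_eq_mul (t s : ℝ) :
    turn t s = (1 + t • quat 0 0 0 1) * (1 + s • quat 0 1 0 0) := by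
  ext <;> simp [turn]

/-- The spin classes reachable in one step. -/
def SpinStep (b c : Bool × Bool × Bool) : Prop :=
  (c = b ∨ c = mulFirst b) ∨ c = mulThird b ∨ c = mulFirst (mulThird b)

instance (b c : Bool × Bool × Bool) : Decidable (SpinStep b c) := by
  unfold SpinStep
  infer_instance

/-- A turn is a half step along the third unit followed by one along the first. Each can be taken
small or large independently, which gives the four successors. -/
theorem Near.exists_step {b c : Bool × Bool × Bool} {q : ℍ[ℝ]} (hq : Near (unitQuat b) q)
    (h : SpinStep b c) : ∃ t s : ℝ, 0 < t ∧ 0 < s ∧ Near (unitQuat c) (q * turn t s) := by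
  have hI : quat 0 1 0 0 * star (quat 0 1 0 0) = 1 := by ext <;> simp
  have hK : quat 0 0 0 1 * star (quat 0 0 0 1) = 1 := by ext <;> simp
  have key : ∀ d, d = b ∨ d = mulThird b → c = d ∨ c = mulFirst d →
      ∃ t s : ℝ, 0 < t ∧ 0 < s ∧ Near (unitQuat c) (q * turn t s) := fun d hd hc => by
    obtain ⟨t, ht, hq'⟩ := hq.exists_half_step hK (h' := unitQuat d) (by
      rw [← unitQuat_mulThird]
      exact hd.imp (congrArg _) (congrArg _))
    obtain ⟨s, hs, hq''⟩ := hq'.exists_half_step hI (h' := unitQuat c) (by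
      rw [← unitQuat_mulFirst]
      exact hc.imp (congrArg _) (congrArg _))
    exact ⟨t, s, ht, hs, by rwa [turn_eq_mul, ← mul_assoc]⟩
  rcases h with h | h
  · exact key b (Or.inl rfl) h
  · exact key (mulThird b) (Or.inr rfl) h

theorem exists_walk (b : ℕ → Bool × Bool × Bool) (h0 : b 0 = (true, true, true))
    (hb : ∀ k, SpinStep (b k) (b (k + 1))) :
    ∃ Q : ℕ → ℍ[ℝ], Q 0 = 1 ∧ (∀ k, Near (unitQuat (b k)) (Q k)) ∧
      ∀ k, ∃ t s : ℝ, 0 < t ∧ 0 < s ∧ Q (k + 1) = Q k * turn t s := by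
  have hn : Near (unitQuat (b 0)) 1 := by
    rw [h0]
    simp [Near, unitQuat, firstEntry, thirdEntry]
  have hstep := fun (k : ℕ) (q : {q : ℍ[ℝ] // Near (unitQuat (b k)) q}) =>
    q.2.exists_step (hb k)
  choose t s ht hs hts using hstep
  let Q : ∀ k : ℕ, {q : ℍ[ℝ] // Near (unitQuat (b k)) q} := fun k =>
    Nat.rec ⟨1, hn⟩ (fun k q => ⟨q.1 * turn (t k q) (s k q), hts k q⟩) k
  exact ⟨fun k => (Q k).1, rfl, fun k => (Q k).2, fun k =>
    ⟨t k (Q k), s k (Q k), ht k (Q k), hs k (Q k), rfl⟩⟩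

/-- The chain along a walk of quaternions. -/
theorem exists_chain_of_walk (m : ℕ) {Q : ℕ → ℍ[ℝ]} (h0 : Q 0 = 1)
    (hQ : ∀ k, ∃ t s : ℝ, 0 < t ∧ 0 < s ∧ Q (k + 1) = Q k * turn t s) :
    ∃ u : Fin m → ℝ × ℝ × ℝ, (∀ k < m, 0 < vol (chain u k) (chain u (k + 1)) (chain u (k + 2))) ∧
      ∀ k ≤ m, lift (chain u) k = Q k := by
  -- A flag determines its line, so the new vector is the image of `e₃` under the next quaternion;
  -- its length is immaterial.
  set u : Fin m → ℝ × ℝ × ℝ := fun k => rot (Q (k + 1)) (0, 0, 1) with hu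
  have hchain : ∀ k < m, chain u (k + 2) = rot (Q (k + 1)) (0, 0, 1) := fun k hk => by
    simp [chain, hk, hu]
  have key : ∀ k < m, IsLift (Q k) (chain u k) (chain u (k + 1)) →
      0 < vol (chain u k) (chain u (k + 1)) (chain u (k + 2)) ∧
      Q (k + 1) = Q k * turn (firstTurn (rot (star (Q k)) (chain u (k + 2))))
        (secondTurn (rot (star (Q k)) (chain u (k + 2)))) := fun k hk hl => by
    obtain ⟨t, s, ht, hs, hts⟩ := hQ k
    have hy : rot (star (Q k)) (chain u (k + 2)) =
        sqNorm (Q k) ^ 2 • rot (turn t s) (0, 0, 1) := by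
      rw [hchain k hk, hts, rot_mul, rot_star_rot]
    have hc : 0 < sqNorm (Q k) ^ 2 := pow_pos hl.1 2
    have hturn := turns_of_rot_turn ht hs hc
    refine ⟨?_, ?_⟩
    · rw [hl.vol_pos_iff, hy, rot_turn_third]
      simp only [Prod.smul_mk, smul_eq_mul]
      positivity
    · rw [hy, hturn.1, hturn.2, hts]
  have hlift : ∀ k ≤ m, lift (chain u) k = Q k ∧ IsLift (Q k) (chain u k) (chain u (k + 1)) := by
    intro k
    induction k with
    | zero => exact fun _ => ⟨h0.symm, by rw [h0]; exact isLift_one⟩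
    | succ k ih =>
      intro hk
      obtain ⟨h1, h2⟩ := ih (by omega)
      obtain ⟨h3, h4⟩ := key k (by omega) h2
      refine ⟨?_, ?_⟩
      · rw [lift, h1, ← h4]
      · rw [h4]
        exact h2.step (h2.vol_pos_iff.mp h3)
  exact ⟨u, fun k hk => (key k hk (hlift k hk.le).2).1, fun k hk => (hlift k hk).1⟩

/-- A walk through the spin classes leaving the convex chains and ending in a given class. -/
def spinPath (b : Bool × Bool × Bool) : ℕ → Bool × Bool × Bool
  | 0 => (true, true, true)
  | 1 => (true, false, true)
  | 2 => if b = (true, false, true) ∨ b = (false, false, false) ∨ b = (false, true, true) then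
      (true, false, true) else (true, true, false)
  | 3 => if b = (true, true, true) ∨ b = (false, false, true) then (true, false, false) else b
  | _ + 4 => b

theorem spinStep_spinPath (b : Bool × Bool × Bool) (k : ℕ) :
    SpinStep (spinPath b k) (spinPath b (k + 1)) := by
  match k with
  | 0 => revert b; decide
  | 1 => revert b; decide
  | 2 => revert b; decide
  | 3 => revert b; decide
  | k + 4 => exact Or.inl (Or.inl rfl)

theorem spinPath_two_fst (b : Bool × Bool × Bool) : (spinPath b 2).1 = true := by
  revert b
  decide

theorem exists_chainType_eq_inr (hm : 4 ≤ m) (b : Bool × Bool × Bool) :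
    ∃ u : chainSpace m, chainType u = Sum.inr b := by
  obtain ⟨Q, h0, hn, hQ⟩ := exists_walk (spinPath b) rfl (spinStep_spinPath b)
  obtain ⟨u, hvol, hl⟩ := exists_chain_of_walk m h0 hQ
  have hlift : ∀ k ≤ m, IsLift (Q k) (chain u k) (chain u (k + 1)) := fun k hk => by
    rw [← hl k hk]
    exact isLift_lift rfl rfl hvol k hk
  obtain ⟨n1, n3, -⟩ := (hn m).spinClass_eq
  have hu : u ∈ chainSpace m := by
    obtain ⟨c, hc, hwedge⟩ := (hlift m le_rfl).exists_wedge_eq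
    obtain ⟨d, hd, hlast⟩ := (hlift m le_rfl).exists_snd_snd_eq
    refine ⟨hvol, ?_, ?_⟩
    · rw [hwedge]
      exact mul_ne_zero hc.ne' n1
    · rw [hlast]
      exact mul_ne_zero hd.ne' n3
  -- The class at time `1` makes the last coordinate of vector `2` negative, and the class at time
  -- `2` makes its area with vector `3` positive. On every convex part these signs agree.
  have hneg : (chain u 2).2.2 * wedge (chain u 2) (chain u 3) < 0 := by
    obtain ⟨c, hc, hlast⟩ := (hlift 1 (by omega)).exists_snd_snd_eq
    obtain ⟨d, hd, hwedge⟩ := (hlift 2 (by omega)).exists_wedge_eq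
    obtain ⟨-, p1, p2⟩ := (hn 1).spinClass_eq
    obtain ⟨-, -, q2⟩ := (hn 2).spinClass_eq
    have r1 : ¬ 0 < thirdEntry (Q 1) := by
      have : decide (0 < thirdEntry (Q 1)) = false := congrArg (fun x => x.2.1) p2
      exact of_decide_eq_false this
    have r2 : 0 < firstEntry (Q 2) := by
      have := (congrArg Prod.fst q2).trans (spinPath_two_fst b)
      exact of_decide_eq_true this
    rw [hlast, hwedge]
    exact mul_neg_of_neg_of_pos
      (mul_neg_of_pos_of_neg hc (lt_of_le_of_ne (not_lt.mp r1) p1)) (mul_pos hd r2)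
  refine ⟨⟨u, hu⟩, ?_⟩
  rw [chainType_of_notMem fun c => not_mem_convexPart_of_neg (by omega) hneg, hl m le_rfl,
    (hn m).spinClass_eq.2.2]
  -- From time `4` on the walk rests in the class `b`.
  obtain ⟨m, rfl⟩ := Nat.exists_eq_add_of_le' hm
  rfl

/-- Representatives from the flipping game bound the number above, the values of `chainType` bound
it below, and both are `4 + 8` in number. -/
theorem card_connectedComponents_chainSpace (hm : 4 ≤ m) :
    Nat.card (ConnectedComponents (chainSpace m)) = 12 := by
  let _ : TopologicalSpace ((Bool × Bool) ⊕ (Bool × Bool × Bool)) := ⊥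
  have : DiscreteTopology ((Bool × Bool) ⊕ (Bool × Bool × Bool)) := ⟨rfl⟩
  obtain ⟨r, hr⟩ := exists_component_reps hm
  rw [card_connectedComponents_eq (continuous_chainType (by omega)) ?_ r hr (by simp)]
  · simp
  · rintro (b | b)
    · obtain ⟨u, hu⟩ := convexPart_nonempty m b
      exact ⟨u, chainType_of_mem (by omega) hu⟩
    · exact exists_chainType_eq_inr hm b

end SpinClass

/-! ### Matrices with three rows as chains -/

section Space

open Matrix

variable {m : ℕ}

/-- The columns of the matrix of a chain. -/
def spaceColumn (u : Fin m → ℝ × ℝ × ℝ) : ℕ → ℝ × ℝ × ℝ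
  | 0 => (1, 0, 0)
  | k + 1 => chain u k

/-- The matrix with the first basis vector and the vectors of a chain as columns. -/
def chainMatrix (u : Fin m → ℝ × ℝ × ℝ) : Matrix (Fin 3) (Fin (m + 3)) ℝ :=
  of fun r j => ![(spaceColumn u j).1, (spaceColumn u j).2.1, (spaceColumn u j).2.2] r

/-- The columns of a matrix after the third one. -/
def matrixChain (M : Matrix (Fin 3) (Fin (m + 3)) ℝ) (i : Fin m) : ℝ × ℝ × ℝ :=
  (M 0 (i.addNat 3), M 1 (i.addNat 3), M 2 (i.addNat 3))

theorem det_chainMatrix_submatrix (u : Fin m → ℝ × ℝ × ℝ) (c : Fin 3 → Fin (m + 3)) :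
    ((chainMatrix u).submatrix id c).det =
      vol (spaceColumn u (c 0)) (spaceColumn u (c 1)) (spaceColumn u (c 2)) := by
  simp [det_fin_three, chainMatrix, vol, wedge]
  ring

theorem det_chainMatrix_cyclicColumns_succ (u : Fin m → ℝ × ℝ × ℝ) {k : ℕ} (hk : k < m) :
    ((chainMatrix u).submatrix id (cyclicColumns 3 (⟨k + 1, by omega⟩ : Fin (m + 3)))).det =
      vol (chain u k) (chain u (k + 1)) (chain u (k + 2)) := by
  simp only [det_chainMatrix_submatrix,
    cyclicColumns_of_le (k := 3) (i := (⟨k + 1, by omega⟩ : Fin (m + 3))) (by simp only; omega)]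
  rfl

theorem det_chainMatrix_cyclicColumns_penultimate (u : Fin m → ℝ × ℝ × ℝ) :
    ((chainMatrix u).submatrix id (cyclicColumns 3 (⟨m + 1, by omega⟩ : Fin (m + 3)))).det =
      wedge (chain u m) (chain u (m + 1)) := by
  have c0 : ((cyclicColumns 3 (⟨m + 1, by omega⟩ : Fin (m + 3)) 0 : Fin (m + 3)) : ℕ) = m + 1 :=
    Nat.mod_eq_of_lt (by simp)
  have c1 : ((cyclicColumns 3 (⟨m + 1, by omega⟩ : Fin (m + 3)) 1 : Fin (m + 3)) : ℕ) = m + 2 :=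
    Nat.mod_eq_of_lt (by simp)
  have c2 : ((cyclicColumns 3 (⟨m + 1, by omega⟩ : Fin (m + 3)) 2 : Fin (m + 3)) : ℕ) = 0 :=
    Nat.mod_self (m + 3)
  rw [det_chainMatrix_submatrix, c0, c1, c2]
  simp [spaceColumn, vol, wedge]

theorem det_chainMatrix_cyclicColumns_last (u : Fin m → ℝ × ℝ × ℝ) :
    ((chainMatrix u).submatrix id (cyclicColumns 3 (⟨m + 2, by omega⟩ : Fin (m + 3)))).det =
      (chain u (m + 1)).2.2 := by
  have c0 : ((cyclicColumns 3 (⟨m + 2, by omega⟩ : Fin (m + 3)) 0 : Fin (m + 3)) : ℕ) = m + 2 :=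
    Nat.mod_eq_of_lt (by simp)
  have c1 : ((cyclicColumns 3 (⟨m + 2, by omega⟩ : Fin (m + 3)) 1 : Fin (m + 3)) : ℕ) = 0 :=
    Nat.mod_self (m + 3)
  have c2 : ((cyclicColumns 3 (⟨m + 2, by omega⟩ : Fin (m + 3)) 2 : Fin (m + 3)) : ℕ) = 1 := by
    change (m + 3 + 1) % (m + 3) = 1
    rw [Nat.add_mod_left, Nat.mod_eq_of_lt (by omega)]
  rw [det_chainMatrix_submatrix, c0, c1, c2]
  simp [spaceColumn, vol, wedge, chain]

theorem chainMatrix_submatrix_castLE (h : 3 ≤ m + 3) (u : Fin m → ℝ × ℝ × ℝ) :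
    (chainMatrix u).submatrix id (Fin.castLE h) = 1 := by
  ext i j
  fin_cases i <;> fin_cases j <;> simp [chainMatrix, spaceColumn, chain]

/-- Windows avoiding the first column are consecutive volumes of the chain. The two wrapping ones
contain `e₁`, respectively `e₁` and `e₂`, and reduce to the final area and the final last
coordinate. -/
theorem chainMatrix_mem_positiveFrames (h : 3 ≤ m + 3) {u : Fin m → ℝ × ℝ × ℝ} :
    chainMatrix u ∈ positiveFrames h ↔ u ∈ chainSpace m := by
  constructor
  · rintro ⟨⟨-, h2⟩, h3⟩
    refine ⟨fun k hk => ?_, ?_, ?_⟩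
    · rw [← det_chainMatrix_cyclicColumns_succ u hk]
      exact h3 _ (by simp only; omega)
    · rw [← det_chainMatrix_cyclicColumns_penultimate]
      exact h2 _
    · rw [← det_chainMatrix_cyclicColumns_last]
      exact h2 _
  · rintro ⟨h1, h2, h3⟩
    have hpos : ∀ i : Fin (m + 3), (i : ℕ) + 3 ≤ m + 3 →
        0 < ((chainMatrix u).submatrix id (cyclicColumns 3 i)).det := by
      rintro ⟨_ | k, hi⟩ hi'
      · have : cyclicColumns 3 (⟨0, hi⟩ : Fin (m + 3)) = Fin.castLE h := cyclicColumns_zero h hi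
        rw [this, chainMatrix_submatrix_castLE h, det_one]
        exact one_pos
      · simp only at hi'
        rw [det_chainMatrix_cyclicColumns_succ u (by omega)]
        exact h1 k (by omega)
    refine ⟨⟨chainMatrix_submatrix_castLE h u, fun i => ?_⟩, hpos⟩
    by_cases hi : (i : ℕ) + 3 ≤ m + 3
    · exact (hpos i hi).ne'
    · rcases (show (i : ℕ) = m + 1 ∨ (i : ℕ) = m + 2 by omega) with hi | hi
      · rw [show i = ⟨m + 1, by omega⟩ from Fin.ext hi,
          det_chainMatrix_cyclicColumns_penultimate]
        exact h2
      · rw [show i = ⟨m + 2, by omega⟩ from Fin.ext hi, det_chainMatrix_cyclicColumns_last]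
        exact h3

theorem matrixChain_chainMatrix (u : Fin m → ℝ × ℝ × ℝ) : matrixChain (chainMatrix u) = u := by
  funext i
  simp [matrixChain, chainMatrix, spaceColumn, chain]

theorem chainMatrix_matrixChain (h : 3 ≤ m + 3) {M : Matrix (Fin 3) (Fin (m + 3)) ℝ}
    (hM : M.submatrix id (Fin.castLE h) = 1) : chainMatrix (matrixChain M) = M := by
  ext r ⟨j, hj⟩
  by_cases hj3 : j < 3
  · have h1 := congrFun (congrFun hM r) ⟨j, hj3⟩
    have h2 := congrFun (congrFun (chainMatrix_submatrix_castLE h (matrixChain M)) r) ⟨j, hj3⟩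
    exact h2.trans h1.symm
  · obtain ⟨k, rfl⟩ := Nat.exists_eq_add_of_le' (not_lt.mp hj3)
    have hk : k < m := by omega
    fin_cases r <;> simp [chainMatrix, matrixChain, spaceColumn, chain, hk]

/-- Positive frames with three rows correspond to chains. -/
def positiveFramesHomeomorph (h : 3 ≤ m + 3) : positiveFrames h ≃ₜ chainSpace m where
  toFun M := ⟨matrixChain M.1, by
    rw [← chainMatrix_mem_positiveFrames h, chainMatrix_matrixChain h M.2.1.1]
    exact M.2⟩
  invFun u := ⟨chainMatrix u.1, (chainMatrix_mem_positiveFrames h).mpr u.2⟩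
  left_inv M := Subtype.ext (chainMatrix_matrixChain h M.2.1.1)
  right_inv u := Subtype.ext (matrixChain_chainMatrix u.1)
  continuous_toFun := by
    refine Continuous.subtype_mk (continuous_pi fun i => ?_) _
    have he : ∀ r, Continuous fun M : positiveFrames h => M.1 r (i.addNat 3) := fun r =>
      continuous_subtype_val.matrix_elem r _
    exact (he 0).prodMk ((he 1).prodMk (he 2))
  continuous_invFun := by
    refine Continuous.subtype_mk (continuous_matrix fun r j => ?_) _
    have hc : Continuous fun u : chainSpace m => spaceColumn u.1 j := by
      rcases j with ⟨_ | k, hj⟩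
      · exact continuous_const
      · exact (continuous_chain k).comp continuous_subtype_val
    fin_cases r
    · exact continuous_fst.comp hc
    · exact continuous_fst.comp (continuous_snd.comp hc)
    · exact continuous_snd.comp (continuous_snd.comp hc)

end Space

theorem proposition3p10 :
    (∀ n : ℕ, 3 ≤ n →
      Nat.card (ConnectedComponents (refinedOpenBruhatCell 2 n)) = (n - 1) * 2 ^ (n - 2)) ∧
    (∀ n : ℕ, 7 ≤ n →
      Nat.card (ConnectedComponents (refinedOpenBruhatCell 3 n)) = 3 * 2 ^ (n - 1)) := by
  refine ⟨fun n hn => ?_, fun n hn => ?_⟩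
  · have h : 2 ≤ n := by omega
    rw [card_connectedComponents_refinedOpenBruhatCell two_pos h,
      card_connectedComponents_positiveFrames_two hn h, mul_comm]
  · obtain ⟨m, rfl⟩ := Nat.exists_eq_add_of_le' (show 3 ≤ n by omega)
    have h : 3 ≤ m + 3 := by omega
    rw [card_connectedComponents_refinedOpenBruhatCell three_pos h,
      (positiveFramesHomeomorph h).card_connectedComponents,
      card_connectedComponents_chainSpace (by omega), show m + 3 - 3 = m by omega,
      show m + 3 - 1 = m + 2 by omega]
    ring
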